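/- **Ribbon graphs.** All ribbon graphs are finite, connected, oriented, have at least one edge, and have vertices labelled by distinct integers; isomorphisms preserve the vertex labels, and $\operatorname{Aut}(G)$ is the automorphism group. For a function $w$ on the edges of $G$ (a *weight function*), the *perimeter* of a vertex is the sum of the weights of the edges at it, loops being counted twice. An edge $e$ of a non-bipartite $G$ is *static* if some connected component $G'$ of $G-e$ is bipartite. Colour such a $G'$ black and white so that $e$ has only black ends in $G'$, and let $I,J$ be the sets of labels of its black and white vertices. Then every weight function with vertex perimeters $b$ gives $e$ the weight $f_e(b)=\sum_{I}b_i-\sum_Jb_j$ if $e$ is a bridge, and half of this otherwise. For bipartite $G$ the static edges are the bridges, with the first formula for $f_e$ (for either side of $e$). **Walls.** Let $\kappa=(\kappa_1,\dots,\kappa_\ell)$ be odd positive integers, $g\ge 0$, $p\ge1$, and let $(I_0,I^0_1,I^1_1,\dots,I^0_p,I^1_p)$ be a partition of $\{1,\dots,n\}$ into non-empty sets; if $\ell\ge3$, $I_0=\emptyset$ is also allowed. Let $W\subset\mathbb R^n$ be the wall $\sum_{I^0_s}b_i=\sum_{I^1_s}b_i$, $s=1,\dots,p$. The hyperplanes $\sum_Ib_i=\sum_Jb_j$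 ($I\cap J=\emptyset$) subdivide $\mathbb R^n$ into cells. Let $b\in W$ lie on none of these hyperplanes except those that contain $W$, and let $C$ be its cell. Let $C_0$ be a highest-dimensional cell adjacent to $C$ and $b'(t)\in C_0$, $t\in(0,1]$, a path with $\lim_{t\to0}b'(t)=b$ and $$\sum_{i\in I^0_s}b'_i(t)-\sum_{i\in I^1_s}b'_i(t)=2^s\,t,\qquad s=1,\dots,p .$$ **Degeneration data.** Fix $m\ge1$; $g_0,\dots,g_m\ge0$ with sum $g$; a partition $A_0\sqcup\dots\sqcup A_m=\{1,\dots,p\}$ with $A_i\ne\emptyset$ for $i\ge1$; $\epsilon\in\{0,1\}^p$; and $a:\{1,\dots,m\}\to\{1,\dots,\ell\}$. Put $n^\bullet_i=\sum_{s\in A_i}|I^{\epsilon_s}_s|$, $n^\circ_i=\sum_{s\in A_i}|I^{1-\epsilon_s}_s|$, and $\kappa^0_i=\kappa_i-\sum_{j\in a^{-1}(i)}(4g_j+2n^\bullet_j+2n^\circ_j)$, and assume that all $\kappa^0_i>0$. Fix further a ribbon graph $G_0$ of genus $g_0$ with vertex labels $I_0\cup\bigcup_{s\in A_0}(I^0_s\cup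 I^1_s)$ and $\ell$ labelled faces, face $i$ having degree $\kappa^0_i$; and, for $i=1,\dots,m$, a bipartite ribbon graph $G_i$ of genus $g_i$ with one face and with vertex labels $\bigcup_{s\in A_i}I^{\epsilon_s}_s$ in one part and $\bigcup_{s\in A_i}I^{1-\epsilon_s}_s$ in the other. Assume that no $G_i$, $0\le i\le m$, has a static edge $e$ with $f_e(b)=0$. **Degenerating graphs.** A ribbon graph $G$ of genus $g$ with vertex labels $1,\dots,n$ and $\ell$ faces *degenerates* if it has a static edge $e$ with $f_e(b'(t))>0$ for $t\in(0,1]$ and $f_e(b)=0$. Deleting all such edges splits $G$ into connected pieces. $G$ is *well-labelled* if its faces are labelled so that face $i$ has degree $\kappa_i$, and its pieces are labelled by $0,\dots,m$, the non-bipartite piece being labelled $0$. It has the given degeneration data if its $i$-th piece, with the induced cyclic orders, is isomorphic to $G_i$ for $i=0,\dots,m$ (for $i=0$, by an isomorphism under which the face of $G_0$ labelled $k$ is part of the face of $G$ labelled $k$, for all $k$), and the face of $G_i$ is part of the face of $G$ labelled $a(i)$ for $i\ge1$. **Proposition.** The number of well-labelled degenerating ribbon graphs $G$ with the given degeneration data,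 up to isomorphism preserving all labels, is $$\frac{C_{g,A,\epsilon,a}}{|\operatorname{Aut}_F(G_0)|\cdot\prod_{i=1}^m|\operatorname{Aut}(G_i)|},\qquad C_{g,A,\epsilon,a}=\prod_{i=1}^{\ell}\left(\kappa^0_i\cdot\prod_{j\in a^{-1}(i)}(2g_j-1+n^\bullet_j+n^\circ_j)\cdot\frac{(\kappa_i-2)!!}{(\kappa_i-2|a^{-1}(i)|)!!}\right),$$ where $\operatorname{Aut}_F(G_0)\subset\operatorname{Aut}(G_0)$ is the subgroup of automorphisms fixing every face, and $(-1)!!=1$. -/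

import Mathlib

open scoped Nat

/-! ### Vertex-labelled ribbon graphs -/

/-- A connected ribbon graph (cellularly embedded in an oriented surface) with vertices labelled by
distinct elements of `V`, given by its half-edges `H`: `next` is the rotation around the vertices,
`opp` exchanges the two halves of each edge, and `vert h` is the label of the vertex at which `h` is
based.  Vertices, edges and faces are the cycles of `next`, `opp` and `next * opp`.
(There is at least one edge.) -/
structure RibbonGraph (V H : Type*) where
  next : Equiv.Perm H
  opp : Equiv.Perm H
  opp_opp : ∀ h, opp (opp h) = h
  opp_ne : ∀ h, opp h ≠ h
  vert : H → V
  vert_eq_iff : ∀ h k, vert h = vert k ↔ next.SameCycle h k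
  nonempty : Nonempty H
  connected : ∀ h k, Relation.ReflTransGen (fun x y => y = next x ∨ y = opp x) h k

namespace RibbonGraph

variable {V H : Type*}

/-- The permutation whose cycles are the faces; the length of a cycle is the degree of the face. -/
def face (G : RibbonGraph V H) : Equiv.Perm H := G.next * G.opp

/-- Euler's relation `#V - #E + #F = 2 - 2 g`: the ribbon graph has genus `g`. -/
def HasGenus (G : RibbonGraph V H) (g : ℕ) : Prop :=
  ((Set.range G.vert).ncard : ℤ) - (Nat.card H / 2 : ℕ)
    + Nat.card (Quotient (Equiv.Perm.SameCycle.setoid G.face)) = 2 - 2 * (g : ℤ)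

/-- `F` labels the faces by distinct labels, where `F h` is the label of the face containing `h`. -/
def IsFaceLabelling {L : Type*} (G : RibbonGraph V H) (F : H → L) : Prop :=
  ∀ h k, F h = F k ↔ G.face.SameCycle h k

/-- Isomorphisms of ribbon graphs respect the rotation, the edges and the vertex labels. -/
def IsIso {H' : Type*} (G : RibbonGraph V H) (G' : RibbonGraph V H') (f : H ≃ H') : Prop :=
  ∀ h, f (G.next h) = G'.next (f h) ∧ f (G.opp h) = G'.opp (f h) ∧ G'.vert (f h) = G.vert h

/-- The automorphism group of a vertex-labelled ribbon graph. -/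
def aut (G : RibbonGraph V H) : Subgroup (Equiv.Perm H) where
  carrier := {f | G.IsIso G f}
  mul_mem' := by
    intro f g hf hg h
    obtain ⟨h1, h2, h3⟩ := hg h
    obtain ⟨k1, k2, k3⟩ := hf (g h)
    simp only [Equiv.Perm.mul_apply]
    exact ⟨by rw [h1, k1], by rw [h2, k2], by rw [k3, h3]⟩
  one_mem' := fun _ => ⟨rfl, rfl, rfl⟩
  inv_mem' := by
    intro f hf h
    obtain ⟨h1, h2, h3⟩ := hf (f⁻¹ h)
    have e : f (f⁻¹ h) = h := f.apply_symm_apply h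
    rw [e] at h1 h2 h3
    refine ⟨?_, ?_, h3.symm⟩
    · rw [Equiv.Perm.inv_eq_iff_eq, h1]
    · rw [Equiv.Perm.inv_eq_iff_eq, h2]

/-- The automorphisms that map every face to itself. -/
def autFaces (G : RibbonGraph V H) : Subgroup (Equiv.Perm H) where
  carrier := {f | f ∈ G.aut ∧ ∀ h, G.face.SameCycle (f h) h}
  mul_mem' := by
    rintro f g ⟨hf, hf'⟩ ⟨hg, hg'⟩
    exact ⟨G.aut.mul_mem hf hg, fun h => (hf' (g h)).trans (hg' h)⟩
  one_mem' := ⟨G.aut.one_mem, fun _ => Equiv.Perm.SameCycle.refl _ _⟩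
  inv_mem' := by
    rintro f ⟨hf, hf'⟩
    refine ⟨G.aut.inv_mem hf, fun h => ?_⟩
    have := hf' (f⁻¹ h)
    have e : f (f⁻¹ h) = h := f.apply_symm_apply h
    rw [e] at this
    exact this.symm

/-- The vertices `u` and `v` are connected by a path of edges with no half-edge in `D`, that is,
they lie in the same connected component of `G - D`. -/
def Reach (G : RibbonGraph V H) (D : Set H) : V → V → Prop :=
  Relation.ReflTransGen (fun u v => ∃ h, h ∉ D ∧ G.vert h = u ∧ G.vert (G.opp h) = v)

/-- For the edge `e = {h, opp h}`: the connected component of `G - e` containing the vertex of `h`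
is bipartite, with parts `I` (black) and `J` (white), the end `h` of `e` being at a black vertex and
the other end not being at a white vertex of this component.  The last condition is automatic when
`G` is not bipartite; when `G` is bipartite it says that `e` is a bridge. -/
structure IsBipartiteSide (G : RibbonGraph V H) (h : H) (I J : Finset V) : Prop where
  component : ∀ v, (v ∈ I ∨ v ∈ J) ↔ G.Reach {h, G.opp h} (G.vert h) v
  disjoint : Disjoint I J
  base : G.vert h ∈ I
  other_end : G.vert (G.opp h) ∉ J
  black : ∀ x, x ≠ h → x ≠ G.opp h → G.vert x ∈ I → G.vert (G.opp x) ∈ J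
  white : ∀ x, x ≠ h → x ≠ G.opp h → G.vert x ∈ J → G.vert (G.opp x) ∈ I

open Classical in
/-- The edge `e = {h, opp h}` is static (some connected component of `G - e` is bipartite), and its
weight, as a linear function of the vertex perimeters `b`, is `f`: it is `∑_I b - ∑_J b` if `e` is a
bridge and half of this otherwise.  (For bipartite `G`, this is meant for bridges only.) -/
def HasStaticWeight (G : RibbonGraph V H) (h : H) (f : (V → ℝ) → ℝ) : Prop :=
  ∃ k, (k = h ∨ k = G.opp h) ∧ ∃ I J : Finset V, G.IsBipartiteSide k I J ∧
    f = fun b => (if G.vert (G.opp k) ∈ I then (1 / 2 : ℝ) else 1)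
      * (∑ v ∈ I, b v - ∑ v ∈ J, b v)

/-- The set of half-edges of those static edges whose weight goes from positive to zero along the
path `γ t` of vertex perimeters, `t ∈ (0, 1]`, that tends to `b` as `t → 0`. -/
def degenerating (G : RibbonGraph V H) (b : V → ℝ) (γ : ℝ → V → ℝ) : Set H :=
  {h | ∃ f, G.HasStaticWeight h f ∧ f b = 0 ∧ ∀ t ∈ Set.Ioc (0 : ℝ) 1, 0 < f (γ t)}

/-- `ι` identifies the ribbon graph `K` with the ribbon graph formed by the vertices of `G` with label
in `S` and the half-edges at these vertices that are not in `D`, with the rotation induced from `G`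
(the half-edges in `D` are skipped). -/
structure IsPiece {H' : Type*} (G : RibbonGraph V H) (D : Set H) (S : Set V)
    (K : RibbonGraph V H') (ι : H' → H) : Prop where
  injective : Function.Injective ι
  range_eq : Set.range ι = {h | h ∉ D ∧ G.vert h ∈ S}
  vert_eq : ∀ x, G.vert (ι x) = K.vert x
  opp_eq : ∀ x, G.opp (ι x) = ι (K.opp x)
  next_eq : ∀ x, ∃ k : ℕ, (G.next ^ (k + 1)) (ι x) = ι (K.next x) ∧
    ∀ j < k, (G.next ^ (j + 1)) (ι x) ∈ D

end RibbonGraph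

/-! ### Walls and cells -/

/-- The linear form `∑_{i ∈ I} b_i - ∑_{j ∈ J} b_j`. -/
def wallForm {n : ℕ} (I J : Finset (Fin n)) (b : Fin n → ℝ) : ℝ :=
  ∑ i ∈ I, b i - ∑ j ∈ J, b j

/-- The cell of `x`: the points lying on the same side as `x` of each hyperplane
`wallForm I J = 0` (or on it if `x` is). -/
def wallCell {n : ℕ} (x : Fin n → ℝ) : Set (Fin n → ℝ) :=
  {y | ∀ I J : Finset (Fin n), Disjoint I J →
    SignType.sign (wallForm I J y) = SignType.sign (wallForm I J x)}

/-- Highest-dimensional cells are the open ones. -/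
def IsTopCell {n : ℕ} (C : Set (Fin n → ℝ)) : Prop :=
  (∃ x, C = wallCell x) ∧ IsOpen C

/-- A partition `(I₀, I⁰₁, I¹₁, …, I⁰ₚ, I¹ₚ)` of `{1, …, n}` with all `I⁰ₛ`, `I¹ₛ` non-empty, where
`I s false` is `I⁰ₛ` and `I s true` is `I¹ₛ`. -/
structure WallPartition (n p : ℕ) where
  I₀ : Finset (Fin n)
  I : Fin p → Bool → Finset (Fin n)
  nonempty : ∀ s e, (I s e).Nonempty
  disjoint : ∀ s e s' e', (s, e) ≠ (s', e') → Disjoint (I s e) (I s' e')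
  disjoint₀ : ∀ s e, Disjoint I₀ (I s e)
  cover : ∀ v, v ∈ I₀ ∨ ∃ s e, v ∈ I s e

namespace WallPartition

variable {n p : ℕ}

/-- The wall `∑_{I⁰ₛ} b = ∑_{I¹ₛ} b`, `s = 1, …, p`. -/
def wall (P : WallPartition n p) : Set (Fin n → ℝ) :=
  {b | ∀ s, wallForm (P.I s false) (P.I s true) b = 0}

/-- `b` lies on the wall and outside of the lower-dimensional walls: the only hyperplanes
`wallForm I J = 0` through `b` are those which contain the whole wall. -/
def IsGeneric (P : WallPartition n p) (b : Fin n → ℝ) : Prop :=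
  b ∈ P.wall ∧ ∀ I J : Finset (Fin n), Disjoint I J → wallForm I J b = 0 →
    ∀ x ∈ P.wall, wallForm I J x = 0

end WallPartition

/-! ### Degeneration data -/

/-- The numerical part of the degeneration data: the genera `g₀, …, gₘ`, the partition
`A₀ ⊔ … ⊔ Aₘ` of `{1, …, p}` (as the map `A` with `Aᵢ = A ⁻¹ {i}`; only `A₀` may be empty),
the signs `ε` and the attachment map `a`. -/
structure DegenIndex (p ℓ m : ℕ) where
  g : Fin (m + 1) → ℕ
  A : Fin p → Fin (m + 1)
  A_nonempty : ∀ j : Fin m, ∃ s, A s = j.succ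
  ε : Fin p → Bool
  a : Fin m → Fin ℓ

namespace DegenIndex

variable {n p ℓ m : ℕ}

/-- The black vertex labels of the `i`-th piece: the union of `I^{ε_s}_s`, `s ∈ Aᵢ`. -/
def black (D : DegenIndex p ℓ m) (P : WallPartition n p) (i : Fin (m + 1)) : Finset (Fin n) :=
  (Finset.univ.filter fun s => D.A s = i).biUnion fun s => P.I s (D.ε s)

/-- The white vertex labels of the `i`-th piece: the union of `I^{1 - ε_s}_s`, `s ∈ Aᵢ`. -/
def white (D : DegenIndex p ℓ m) (P : WallPartition n p) (i : Fin (m + 1)) : Finset (Fin n) :=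
  (Finset.univ.filter fun s => D.A s = i).biUnion fun s => P.I s (!D.ε s)

/-- `κ⁰ᵢ = κᵢ - ∑_{j ∈ a⁻¹(i)} (4 gⱼ + 2 n•ⱼ + 2 n∘ⱼ)`. -/
def kappa₀ (D : DegenIndex p ℓ m) (P : WallPartition n p) (κ : Fin ℓ → ℕ) (i : Fin ℓ) : ℤ :=
  (κ i : ℤ) - ∑ j ∈ Finset.univ.filter (fun j => D.a j = i),
    (4 * (D.g j.succ : ℤ) + 2 * ((D.black P j.succ).card : ℤ) + 2 * ((D.white P j.succ).card : ℤ))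

/-- The coefficient `C_{g, A, ε, a}`, that is the product over `i` of
`κ⁰ᵢ · ∏_{j ∈ a⁻¹(i)} (2 gⱼ - 1 + n•ⱼ + n∘ⱼ) · (κᵢ - 2)‼ / (κᵢ - 2 |a⁻¹(i)|)‼`.
The convention `(-1)‼ = 1` needed for `κᵢ = 1` agrees with `(1 - 2)‼ = 0‼ = 1` in `ℕ`. -/
def coeff (D : DegenIndex p ℓ m) (P : WallPartition n p) (κ : Fin ℓ → ℕ) : ℚ :=
  ∏ i, ((D.kappa₀ P κ i : ℚ)
    * (∏ j ∈ Finset.univ.filter (fun j => D.a j = i),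
        (2 * (D.g j.succ : ℚ) - 1 + ((D.black P j.succ).card : ℚ) + ((D.white P j.succ).card : ℚ)))
    * (((κ i - 2)‼ : ℕ) : ℚ)
    / (((κ i - 2 * (Finset.univ.filter fun j => D.a j = i).card)‼ : ℕ) : ℚ))

end DegenIndex

/-- The pieces `G₀, G₁, …, Gₘ` of the degeneration data: `G₀` has genus `g₀`, vertex labels
`I₀ ∪ ⋃_{s ∈ A₀} (I⁰ₛ ∪ I¹ₛ)` and faces labelled so that face `i` has degree `κ⁰ᵢ > 0`; for
`i = 1, …, m`, `Gᵢ` is bipartite of genus `gᵢ` with one face, and with the prescribed vertex labels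
in its two parts. -/
structure DegenPieces {n p ℓ m : ℕ} (P : WallPartition n p) (κ : Fin ℓ → ℕ)
    (D : DegenIndex p ℓ m) where
  H : Fin (m + 1) → Type
  finite : ∀ i, Finite (H i)
  G : ∀ i, RibbonGraph (Fin n) (H i)
  genus : ∀ i, (G i).HasGenus (D.g i)
  F₀ : H 0 → Fin ℓ
  labels₀ : Set.range (G 0).vert = ↑(P.I₀ ∪ D.black P 0 ∪ D.white P 0)
  isFaceLabelling₀ : (G 0).IsFaceLabelling F₀
  kappa₀_pos : ∀ i, 0 < D.kappa₀ P κ i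
  degree₀ : ∀ i, (Nat.card {h // F₀ h = i} : ℤ) = D.kappa₀ P κ i
  labels : ∀ j : Fin m, Set.range (G j.succ).vert = ↑(D.black P j.succ ∪ D.white P j.succ)
  bipartite : ∀ (j : Fin m) (h : H j.succ),
    (G j.succ).vert h ∈ D.black P j.succ ↔ (G j.succ).vert ((G j.succ).opp h) ∈ D.white P j.succ
  oneFace : ∀ (j : Fin m) (h k : H j.succ), (G j.succ).face.SameCycle h k

/-! ### Well-labelled degenerating ribbon graphs -/

/-- A ribbon graph with vertices labelled by `1, …, n`, together with a labelling of the faces by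
`1, …, ℓ` and a distribution of the vertices among pieces labelled by `0, …, m`. -/
structure WellLabelled (n ℓ m : ℕ) (H : Type*) where
  graph : RibbonGraph (Fin n) H
  face : H → Fin ℓ
  piece : Fin n → Fin (m + 1)

namespace WellLabelled

variable {n p ℓ m : ℕ} {H : Type*}

/-- Isomorphism of well-labelled ribbon graphs: all the labels are respected. -/
def isoSetoid (n ℓ m : ℕ) (H : Type*) : Setoid (WellLabelled n ℓ m H) where
  r X Y := ∃ f : H ≃ H, X.graph.IsIso Y.graph f ∧ (∀ h, Y.face (f h) = X.face h) ∧
    Y.piece = X.piece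
  iseqv :=
    { refl := fun _ => ⟨Equiv.refl H, fun _ => ⟨rfl, rfl, rfl⟩, fun _ => rfl, rfl⟩
      symm := by
        rintro X Y ⟨f, hf, hF, hp⟩
        refine ⟨f.symm, fun h => ?_, fun h => ?_, hp.symm⟩
        · obtain ⟨h1, h2, h3⟩ := hf (f.symm h)
          simp only [Equiv.apply_symm_apply] at h1 h2 h3
          refine ⟨?_, ?_, h3.symm⟩
          · rw [Equiv.symm_apply_eq, h1]
          · rw [Equiv.symm_apply_eq, h2]
        · have := hF (f.symm h)
          rw [Equiv.apply_symm_apply] at this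
          exact this.symm
      trans := by
        rintro X Y Z ⟨f, hf, hF, hp⟩ ⟨k, hk, hK, hq⟩
        refine ⟨f.trans k, fun h => ?_, fun h => ?_, hq.trans hp⟩
        · obtain ⟨h1, h2, h3⟩ := hf h
          obtain ⟨k1, k2, k3⟩ := hk (f h)
          simp only [Equiv.trans_apply]
          exact ⟨by rw [h1, k1], by rw [h2, k2], by rw [k3, h3]⟩
        · simp only [Equiv.trans_apply]
          rw [hK, hF] }

/-- `X` is a well-labelled ribbon graph of genus `g` with `n` vertices, with face degrees `κ`, which
degenerates along the path `γ` tending to `b`, and its degeneration data is `(D, Q)`. -/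
structure DegeneratesTo {P : WallPartition n p} {κ : Fin ℓ → ℕ} {D : DegenIndex p ℓ m}
    (X : WellLabelled n ℓ m H) (g : ℕ) (b : Fin n → ℝ) (γ : ℝ → Fin n → ℝ)
    (Q : DegenPieces P κ D) : Prop where
  genus : X.graph.HasGenus g
  labels : Function.Surjective X.graph.vert
  isFaceLabelling : X.graph.IsFaceLabelling X.face
  degree : ∀ i, Nat.card {h // X.face h = i} = κ i
  degenerates : (X.graph.degenerating b γ).Nonempty
  /-- The pieces are the connected components left after deleting the degenerating edges. -/
  piece_eq_iff : ∀ u v, X.piece u = X.piece v ↔ X.graph.Reach (X.graph.degenerating b γ) u v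
  piece_surjective : Function.Surjective X.piece
  /-- The piece `0` is `G₀`, each face of `G₀` being part of the face of `X` with the same label. -/
  piece_zero : ∃ ι : Q.H 0 → H,
    X.graph.IsPiece (X.graph.degenerating b γ) {v | X.piece v = 0} (Q.G 0) ι ∧
      ∀ x, X.face (ι x) = Q.F₀ x
  /-- The piece `j` is `Gⱼ`, and its face is part of the face of `X` with label `a(j)`. -/
  piece_succ : ∀ j : Fin m, ∃ ι : Q.H j.succ → H,
    X.graph.IsPiece (X.graph.degenerating b γ) {v | X.piece v = j.succ} (Q.G j.succ) ι ∧
      ∀ x, X.face (ι x) = D.a j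

end WellLabelled

/-- The number of isomorphism classes of well-labelled ribbon graphs that degenerate along `γ` with
the given degeneration data.  A ribbon graph with face degrees `κ` has `∑ κᵢ` half-edges, so every
isomorphism class is represented on `Fin (∑ i, κ i)`. -/
noncomputable def degenCount {n p ℓ m : ℕ} {P : WallPartition n p} {κ : Fin ℓ → ℕ}
    {D : DegenIndex p ℓ m} (g : ℕ) (b : Fin n → ℝ) (γ : ℝ → Fin n → ℝ)
    (Q : DegenPieces P κ D) : ℕ :=
  Nat.card {q : Quotient (WellLabelled.isoSetoid n ℓ m (Fin (∑ i, κ i))) //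
    ∃ X : WellLabelled n ℓ m (Fin (∑ i, κ i)), Quotient.mk _ X = q ∧ X.DegeneratesTo g b γ Q}

/-! A degenerating graph is a tree of pieces rooted at the core `G₀`. The faces of the core have odd
degree, so the core is not bipartite; hence the bipartite side of a degenerating edge misses the
core, and the edge is a bridge leading from its side towards the core. Two such edges cannot start
at the same piece, since their two sides together would be closed and miss the core
(`AvoidsCore.eq`). Counting half-edges then leaves exactly one such edge for each `G_j`, `j ≥ 1`:
its lower end is on `G_j`, its upper end on the rest of the graph.

Conversely, glue the pieces into such a tree. The side of a joining edge consists of whole coloured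
pieces, so its weight is a combination of the wall forms with coefficients 0, 1, -1
(`ColorsPieces.exists_sum`). It vanishes at `b`, and near `b` it has the sign of the coefficient of
the highest form involved, because the form `s` takes the value `2^s t`. So the edge degenerates
exactly if its lower end has the colour of `I⁰_s` for the highest `s` on its side. An edge inside a
piece has at `b` the same weight as in that piece, which is not zero by assumption.

It remains to count rotations on a fixed set of half-edges, those of the pieces and of `m` joining
edges. Symmetries of the pieces act freely on the admissible rotations, because the glued graph is
connected and joining edges are fixed, and the orbits are the isomorphism classes
(`card_isValid_eq`). This produces the denominator.

The admissible rotations are counted by placing one end at a time (`card_validSet`). Among the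
unattached pieces take `M` with the highest wall index. Whatever is attached to it later, the sign
rule fixes the colour of its lower end, which leaves `E_M` corners, where `E_M = 2g - 1 + n• + n∘`
is the number of edges of the piece. If the upper end goes to the core, the face `a(M)` of the core
grows and another piece is chosen. If it goes to one of the `2 E_i` corners of a piece `i`, the
merged piece inherits the highest index, so the colour of the upper end of `M` dictates that of the
lower end of `i`, which leaves `E_i` choices, and the process continues with `i`. Every piece
contributes a factor `E_j`. What remains for a face of final degree `κ` satisfies `y F(y + c, k) + 2
s F(y, k) = F(y, k + 1)` with `κ = y + c + 2 s + 2 k` (`faceFactor_succ`); the solution `y (κ - 2)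
(κ - 4) ⋯ (κ - 2(k - 1))` is the quotient of double factorials. -/

set_option linter.unusedSectionVars false

/-! ### Induced permutations, and insertion of one element into a cycle. -/

namespace Equiv.Perm

variable {Ω : Type*}

/-- `ν` is the permutation induced by `σ` on `K`: elements outside `K` are skipped. -/
structure Skips (σ : Equiv.Perm Ω) (K : Set Ω) (ν : Equiv.Perm Ω) : Prop where
  fix : ∀ x, x ∉ K → ν x = x
  ret : ∀ x ∈ K, ∃ k : ℕ, (σ ^ (k + 1)) x = ν x ∧ ∀ j < k, (σ ^ (j + 1)) x ∉ K

namespace Skips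

variable {σ ν ν' : Equiv.Perm Ω} {K : Set Ω}

theorem mem_of_fix (h : ∀ x, x ∉ K → ν x = x) {x : Ω} (hx : x ∈ K) : ν x ∈ K := by
  by_contra hn
  exact hn (by rw [ν.injective (h _ hn)]; exact hx)

theorem mem (h : Skips σ K ν) {x : Ω} (hx : x ∈ K) : ν x ∈ K := mem_of_fix h.fix hx

theorem unique (h : Skips σ K ν) (h' : Skips σ K ν') : ν = ν' := by
  ext x
  by_cases hx : x ∈ K
  · obtain ⟨k, hk, hk'⟩ := h.ret x hx
    obtain ⟨l, hl, hl'⟩ := h'.ret x hx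
    rcases lt_trichotomy k l with hlt | heq | hlt
    · exact absurd (hk ▸ h.mem hx) (hl' k hlt)
    · subst heq; rw [← hk, ← hl]
    · exact absurd (hl ▸ h'.mem hx) (hk' l hlt)
  · rw [h.fix x hx, h'.fix x hx]

theorem sameCycle_apply (h : Skips σ K ν) (x : Ω) : σ.SameCycle x (ν x) := by
  by_cases hx : x ∈ K
  · obtain ⟨k, hk, -⟩ := h.ret x hx
    exact ⟨(k + 1 : ℕ), by rw [← hk, zpow_natCast]⟩
  · rw [h.fix x hx]

theorem sameCycle [Finite Ω] (h : Skips σ K ν) {x y : Ω} (hx : x ∈ K) (hy : y ∈ K)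
    (hxy : σ.SameCycle x y) : ν.SameCycle x y := by
  obtain ⟨n, -, hn⟩ := hxy.exists_pow_eq'
  clear hxy
  induction n using Nat.strong_induction_on generalizing x with
  | _ n ih =>
    obtain ⟨k, hk, hk'⟩ := h.ret x hx
    rcases Nat.eq_zero_or_pos n with rfl | hpos
    · simp only [pow_zero, coe_one, id_eq] at hn
      rw [hn]
    · by_cases hlt : n - 1 < k
      · have := hk' (n - 1) hlt
        rw [Nat.sub_add_cancel hpos, hn] at this
        exact absurd hy this
      · have e : n = (n - (k + 1)) + (k + 1) := by omega
        rw [e, pow_add, mul_apply, hk] at hn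
        exact (sameCycle_apply_right.2 (SameCycle.refl _ _)).trans
          (ih (n - (k + 1)) (by omega) (h.mem hx) hn)

theorem pow_mem_of_closed {T : Set Ω} (hT : ∀ x ∈ T, σ x ∈ T) {x : Ω} (hx : x ∈ T) (n : ℕ) :
    (σ ^ n) x ∈ T := by
  induction n with
  | zero => simpa
  | succ n ih => rw [pow_succ', mul_apply]; exact hT _ ih

theorem mem_of_sameCycle [Finite Ω] {T : Set Ω} (hT : ∀ x ∈ T, σ x ∈ T) {x y : Ω}
    (hxy : σ.SameCycle x y) (hx : x ∈ T) : y ∈ T := by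
  obtain ⟨n, -, rfl⟩ := hxy.exists_pow_eq'
  exact pow_mem_of_closed hT hx n

theorem apply_eq_of_sameCycle [Finite Ω] {B : Type*} {f : Ω → B} (hf : ∀ x, f (σ x) = f x)
    {x y : Ω} (hxy : σ.SameCycle x y) : f y = f x :=
  mem_of_sameCycle (T := {z | f z = f x}) (fun z hz => (hf z).trans hz) hxy rfl

theorem closed (h : Skips σ K ν) {T : Set Ω} (hT : ∀ x ∈ T, σ x ∈ T) {x : Ω} (hx : x ∈ T) :
    ν x ∈ T := by
  by_cases hK : x ∈ K
  · obtain ⟨k, hk, -⟩ := h.ret x hK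
    rw [← hk]
    exact pow_mem_of_closed hT hx _
  · rwa [h.fix x hK]

theorem univ_iff : Skips σ _root_.Set.univ ν ↔ σ = ν := by
  constructor
  · intro h
    ext x
    obtain ⟨k, hk, hk'⟩ := h.ret x trivial
    rcases Nat.eq_zero_or_pos k with rfl | hpos
    · simpa using hk
    · exact absurd trivial (hk' 0 hpos)
  · rintro rfl
    exact ⟨fun x hx => absurd trivial hx, fun x _ => ⟨0, by simp, by simp⟩⟩

/-- If `f` is constant along `σ ∘ opp` and on the edges outside `K`, then it is constant along
`ν ∘ opp` on `K`. -/
theorem label_apply (h : Skips σ K ν) {B : Type*} {f : Ω → B} {opp : Ω → Ω}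
    (hf : ∀ x, f (σ x) = f (opp x)) (hK : ∀ x, x ∉ K → f (opp x) = f x) {x : Ω} (hx : x ∈ K) :
    f (ν x) = f (opp x) := by
  obtain ⟨k, hk, hk'⟩ := h.ret x hx
  rw [← hk]
  have : ∀ j ≤ k, f ((σ ^ (j + 1)) x) = f (opp x) := by
    intro j
    induction j with
    | zero => intro _; simpa using hf x
    | succ j ih =>
      intro hj
      rw [pow_succ', mul_apply, hf, hK _ (hk' j (by omega)), ih (by omega)]
  exact this k le_rfl

variable [DecidableEq Ω]

/-- Insert `e` after `x`. -/
def ins (ν : Equiv.Perm Ω) (x e : Ω) : Equiv.Perm Ω := swap e (ν x) * ν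

theorem ins_self (x e : Ω) : ins ν x e x = e := by simp [ins]

theorem ins_new {x e : Ω} (he : ν e = e) : ins ν x e e = ν x := by simp [ins, he]

theorem ins_of_ne {x e y : Ω} (he : ν e = e) (hy : y ≠ e) (hx : y ≠ x) : ins ν x e y = ν y := by
  rw [ins, mul_apply, swap_apply_of_ne_of_ne]
  · intro h; exact hy (ν.injective (h.trans he.symm))
  · intro h; exact hx (ν.injective h)

theorem ins_injective {x y e : Ω} (h : ins ν x e = ins ν y e) : x = y := by
  have := ins_self (ν := ν) y e
  rw [← h] at this
  exact (ins ν x e).injective ((ins_self x e).trans this.symm)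

/-- The predecessor of `e` is the element of `K` from which `σ` reaches `e` in the fewest steps. The
cycle of `e` has to meet `K`, as otherwise no such element exists. -/
theorem exists_ins [Finite Ω] (h : Skips σ K ν) {e : Ω} (he : e ∉ K)
    (hit : ∃ y ∈ K, σ.SameCycle e y) : ∃ x ∈ K, Skips σ (insert e K) (ins ν x e) := by
  classical
  have hex : ∃ n : ℕ, ∃ x ∈ K, (σ ^ n) x = e := by
    obtain ⟨y, hy, hc⟩ := hit
    obtain ⟨n, -, hn⟩ := hc.symm.exists_pow_eq'
    exact ⟨n, y, hy, hn⟩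
  obtain ⟨x, hx, hn⟩ := Nat.find_spec hex
  have hmin : ∀ m, m < Nat.find hex → ∀ z ∈ K, (σ ^ m) z ≠ e := fun m hm z hz hze =>
    Nat.find_min hex hm ⟨z, hz, hze⟩
  generalize Nat.find hex = n at hn hmin
  have hn0 : 0 < n := by
    rcases Nat.eq_zero_or_pos n with rfl | h0
    · exact absurd (by simpa using hn ▸ hx) he
    · exact h0
  have hfe : ν e = e := h.fix e he
  obtain ⟨k, hk, hk'⟩ := h.ret x hx
  -- If `x` returned to `K` before reaching `e`, its image `ν x` would be closer to `e`.
  have hnk : n ≤ k := by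
    by_contra hlt
    have e1 : n = (n - (k + 1)) + (k + 1) := by omega
    rw [e1, pow_add, mul_apply, hk] at hn
    exact hmin _ (by omega) _ (h.mem hx) hn
  refine ⟨x, hx, ⟨fun y hy => ?_, fun y hy => ?_⟩⟩
  · simp only [Set.mem_insert_iff, not_or] at hy
    rw [ins_of_ne hfe hy.1 (fun hh => hy.2 (hh ▸ hx)), h.fix y hy.2]
  · rcases hy with rfl | hy
    · refine ⟨k - n, ?_, fun j hj hmem => ?_⟩
      · rw [ins_new hfe, ← hk, ← hn, ← mul_apply, ← pow_add]
        congr 2; omega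
      · rcases hmem with hmem | hmem
        · rw [← hn, ← mul_apply, ← pow_add, add_comm, pow_add, mul_apply] at hmem
          have := (σ ^ n).injective hmem
          exact hk' j (by omega) (Set.mem_of_eq_of_mem this hx)
        · rw [← hn, ← mul_apply, ← pow_add, show j + 1 + n = (j + n) + 1 by ring] at hmem
          exact hk' (j + n) (by omega) hmem
    · by_cases hyx : y = x
      · subst hyx
        refine ⟨n - 1, ?_, fun j hj hmem => ?_⟩
        · rw [ins_self, Nat.sub_add_cancel hn0, hn]
        · rcases hmem with hmem | hmem
          · exact hmin (j + 1) (by omega) y hy hmem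
          · exact hk' j (by omega) hmem
      · obtain ⟨l, hl, hl'⟩ := h.ret y hy
        refine ⟨l, ?_, fun j hj hmem => ?_⟩
        · rw [hl, ins_of_ne hfe (fun hh => he (hh ▸ hy)) hyx]
        · rcases hmem with hmem | hmem
          · have hnj : n ≤ j + 1 := by
              by_contra hlt
              exact hmin (j + 1) (by omega) y hy hmem
            -- Both `x` and `y` reach `e`, after `n` and `j + 1` steps. Cancelling `n` steps shows
            -- that `y` passes through `x` before its first return, or equals it.
            have e1 : j + 1 = n + (j + 1 - n) := by omega
            rw [e1, pow_add, mul_apply, ← hn] at hmem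
            have h2 := (σ ^ n).injective hmem
            rcases Nat.eq_zero_or_pos (j + 1 - n) with h0 | h0
            · rw [h0] at h2; exact hyx (by simpa using h2)
            · refine hl' (j - n) (by omega) ?_
              rw [show j - n + 1 = j + 1 - n by omega]
              exact Set.mem_of_eq_of_mem h2 hx
          · exact hl' j hj hmem

theorem of_ins {x e : Ω} (he : e ∉ K) (hx : x ∈ K) (hfix : ∀ y, y ∉ K → ν y = y)
    (h : Skips σ (insert e K) (ins ν x e)) : Skips σ K ν := by
  have hfe : ν e = e := hfix e he
  refine ⟨hfix, fun y hy => ?_⟩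
  by_cases hyx : y = x
  · subst hyx
    obtain ⟨k, hk, hk'⟩ := h.ret y (Or.inr hy)
    obtain ⟨l, hl, hl'⟩ := h.ret e (Or.inl rfl)
    rw [ins_self] at hk
    rw [ins_new hfe] at hl
    -- The return of `y` to `K` is the return to `e`, of length `k + 1`, followed by that of `e`, of
    -- length `l + 1`.
    refine ⟨l + 1 + k, ?_, fun j hj => ?_⟩
    · rw [show l + 1 + k + 1 = (l + 1) + (k + 1) by ring, pow_add, mul_apply, hk, hl]
    · rcases lt_trichotomy j k with hlt | heq | hlt
      · exact fun hm => hk' j hlt (Or.inr hm)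
      · rw [heq, hk]; exact he
      · intro hm
        refine hl' (j - k - 1) (by omega) (Or.inr ?_)
        rw [← hk, ← mul_apply, ← pow_add, show j - k - 1 + 1 + (k + 1) = j + 1 by omega]
        exact hm
  · obtain ⟨k, hk, hk'⟩ := h.ret y (Or.inr hy)
    rw [ins_of_ne hfe (fun hh => he (hh ▸ hy)) hyx] at hk
    exact ⟨k, hk, fun j hj hm => hk' j hj (Or.inr hm)⟩

end Skips

end Equiv.Perm

/-! ### The abstract gluing problem and its partially glued states. -/

open Equiv.Perm

/-- Half-edges `Ω` with the involution `opp`, among which the halves `e j` and `opp (e j)` of the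
edges that join the piece `j` to the rest are distinguished; `L` is the intended face labelling,
`core` is a non-bipartite piece and `Z s` are marked half-edges. -/
structure Gluing (Ω ι S Lab : Type*) where
  opp : Ω → Ω
  e : ι → Ω
  L : Ω → Lab
  a : ι → Lab
  core : Set Ω
  Z : S → Set Ω
  opp_opp : ∀ x, opp (opp x) = x
  e_injective : Function.Injective e
  e_ne : ∀ i j, e i ≠ opp (e j)
  L_e : ∀ j, L (e j) = a j
  L_opp_e : ∀ j, L (opp (e j)) = a j
  core_nonempty : core.Nonempty
  Z_nonempty : ∀ s, (Z s).Nonempty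

namespace Gluing

variable {Ω ι S Lab : Type*} [LinearOrder S] (G : Gluing Ω ι S Lab)

/-- `T` is the connected component of `e j` after deletion of the edge of `e j`; it does not
contain the other end, is properly coloured by `χ`, avoids the core, and the marked half-edges of
highest index have the same colour as `e j`. -/
structure IsSide (σ : Equiv.Perm Ω) (j : ι) (T : Set Ω) (χ : Ω → Bool) : Prop where
  base_mem : G.e j ∈ T
  opp_notMem : G.opp (G.e j) ∉ T
  next_mem : ∀ x ∈ T, σ x ∈ T
  opp_mem : ∀ x ∈ T, x ≠ G.e j → G.opp x ∈ T
  minimal : ∀ T' : Set Ω, G.e j ∈ T' → (∀ x ∈ T', σ x ∈ T') →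
    (∀ x ∈ T', x ≠ G.e j → x ≠ G.opp (G.e j) → G.opp x ∈ T') → T ⊆ T'
  color_next : ∀ x ∈ T, χ (σ x) = χ x
  color_opp : ∀ x ∈ T, x ≠ G.e j → χ (G.opp x) = !χ x
  color_base : χ (G.e j) = true
  core : ∀ x ∈ G.core, x ∉ T
  sign : ∀ s, ∀ z ∈ G.Z s, z ∈ T → (∀ s', ∀ z' ∈ G.Z s', z' ∈ T → s' ≤ s) → χ z = true

/-- The half-edges that have been placed when the `e j`, `j ∈ U₀`, and the `opp (e j)`, `j ∈ U₁`,
are still to be placed. -/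
def placed (U₀ U₁ : Finset ι) : Set Ω :=
  {x | (∀ j ∈ U₀, x ≠ G.e j) ∧ ∀ j ∈ U₁, x ≠ G.opp (G.e j)}

variable {G}

theorem opp_injective : Function.Injective G.opp :=
  Function.Involutive.injective G.opp_opp

theorem opp_e_ne (i j : ι) : G.opp (G.e i) ≠ G.e j := fun h => G.e_ne j i h.symm

variable [DecidableEq ι]

theorem placed_insert {U : Finset ι} {M : ι} (hM : M ∉ U) :
    G.placed U U = insert (G.opp (G.e M)) (G.placed U (insert M U)) := by
  ext x
  simp only [placed, Set.mem_ofPred_eq, Set.mem_insert_iff, Finset.mem_insert, forall_eq_or_imp]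
  constructor
  · rintro ⟨h1, h2⟩
    by_cases hx : x = G.opp (G.e M)
    · exact Or.inl hx
    · exact Or.inr ⟨h1, hx, h2⟩
  · rintro (rfl | ⟨h1, -, h2⟩)
    · refine ⟨fun j _ => opp_e_ne _ _, fun j hj h => hM ?_⟩
      rwa [G.e_injective (opp_injective h)]
    · exact ⟨h1, h2⟩

theorem placed_erase {U₁ U : Finset ι} {M : ι} :
    G.placed (U.erase M) U₁ = insert (G.e M) (G.placed U U₁) := by
  ext x
  simp only [placed, Set.mem_ofPred_eq, Set.mem_insert_iff, Finset.mem_erase]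
  constructor
  · rintro ⟨h1, h2⟩
    by_cases hx : x = G.e M
    · exact Or.inl hx
    · refine Or.inr ⟨fun j hj h => ?_, h2⟩
      by_cases hjM : j = M
      · exact hx (hjM ▸ h)
      · exact h1 j ⟨hjM, hj⟩ h
  · rintro (rfl | ⟨h1, h2⟩)
    · exact ⟨fun j hj h => hj.1 (G.e_injective h).symm, fun j _ => G.e_ne _ _⟩
    · exact ⟨fun j hj => h1 j hj.2, h2⟩

variable (G) in
/-- A partially glued graph with rotation `ν` on the placed half-edges: `q` tells the piece of a
half-edge (`none` for the piece of the core), `β` colours the other pieces, `As s` is the piece of the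
marked half-edges `Z s`, and `mx j` is the highest index of the marked half-edges on the piece `j`. -/
structure State (U₀ U₁ : Finset ι) (ν : Equiv.Perm Ω) (q : Ω → Option ι) (β : Ω → Bool)
    (As : S → Option ι) (mx : ι → S) : Prop where
  sub : U₀ ⊆ U₁
  fix : ∀ x, x ∉ G.placed U₀ U₁ → ν x = x
  q_next : ∀ x, q (ν x) = q x
  q_opp : ∀ x, q (G.opp x) = q x
  q_e : ∀ j ∈ U₁, q (G.e j) = some j
  q_some : ∀ x j, q x = some j → j ∈ U₁ ∧ G.L x = G.a j
  q_core : ∀ x ∈ G.core, q x = none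
  core_sub : G.core ⊆ G.placed U₀ U₁
  conn : ∀ T : Set Ω, (∀ x ∈ G.placed U₀ U₁, x ∈ T → ν x ∈ T) →
    (∀ x ∈ G.placed U₀ U₁, G.opp x ∈ G.placed U₀ U₁ → x ∈ T → G.opp x ∈ T) →
    ∀ x ∈ G.placed U₀ U₁, ∀ y ∈ G.placed U₀ U₁, q x = q y → x ∈ T → y ∈ T
  β_next : ∀ x, q x ≠ none → β (ν x) = β x
  β_opp : ∀ x ∈ G.placed U₀ U₁, G.opp x ∈ G.placed U₀ U₁ → q x ≠ none →
    β (G.opp x) = !β x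
  Z_q : ∀ s, ∀ z ∈ G.Z s, z ∈ G.placed U₀ U₁ ∧ q z = As s
  As_mx : ∀ j ∈ U₁, As (mx j) = some j
  le_mx : ∀ j ∈ U₁, ∀ s, As s = some j → s ≤ mx j
  β_mx : ∀ j ∈ U₁, ∀ z ∈ G.Z (mx j), β z = true

variable (G) in
/-- `σ` completes the partially glued graph to one in which all the joining edges that are not yet
placed have a side. -/
structure Valid (U₀ U₁ : Finset ι) (ν : Equiv.Perm Ω) (q : Ω → Option ι) (σ : Equiv.Perm Ω) :
    Prop where
  skip : Skips σ (G.placed U₀ U₁) ν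
  lab : ∀ x, G.L (σ x) = G.L (G.opp x)
  hit₀ : ∀ j ∈ U₀, ∃ x ∈ G.placed U₀ U₁, q x = some j ∧ σ.SameCycle (G.e j) x
  hit₁ : ∀ j ∈ U₁, ∃ x ∈ G.placed U₀ U₁, σ.SameCycle (G.opp (G.e j)) x
  side : ∀ j ∈ U₁, ∃ T χ, G.IsSide σ j T χ

variable {U U₀ U₁ : Finset ι} {σ ν : Equiv.Perm Ω} {q : Ω → Option ι} {β : Ω → Bool}
  {As : S → Option ι} {mx : ι → S}

theorem opp_mem_placed_iff {x : Ω} :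
    G.opp x ∈ G.placed U U ↔ x ∈ G.placed U U := by
  have key : ∀ x, x ∈ G.placed U U → G.opp x ∈ G.placed U U := by
    rintro x ⟨h1, h2⟩
    exact ⟨fun j hj hx => h2 j hj (by rw [← hx, G.opp_opp]),
      fun j hj hx => h1 j hj (opp_injective hx)⟩
  exact ⟨fun hx => by simpa [G.opp_opp] using key _ hx, key x⟩

/-- A side contains the whole of every piece that it meets. -/
theorem State.mem_side (h : G.State U₀ U₁ ν q β As mx) (hs : Skips σ (G.placed U₀ U₁) ν) {j : ι}
    {T : Set Ω} {χ : Ω → Bool} (hj : j ∈ U₁) (hT : G.IsSide σ j T χ) {x y : Ω}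
    (hx : x ∈ G.placed U₀ U₁) (hy : y ∈ G.placed U₀ U₁) (hq : q x = q y) (hxT : x ∈ T) :
    y ∈ T := by
  refine h.conn T (fun z _ hzT => hs.closed hT.next_mem hzT) (fun z _ hz' hzT => ?_) x hx y hy
    hq hxT
  refine hT.opp_mem z hzT ?_
  rintro rfl
  exact hz'.2 j hj rfl

theorem State.q_ne_none_of_mem_side (h : G.State U₀ U₁ ν q β As mx)
    (hs : Skips σ (G.placed U₀ U₁) ν) {j : ι}
    {T : Set Ω} {χ : Ω → Bool} (hj : j ∈ U₁) (hT : G.IsSide σ j T χ) {x : Ω}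
    (hx : x ∈ G.placed U₀ U₁) (hxT : x ∈ T) : q x ≠ none := by
  intro hq
  obtain ⟨c, hc⟩ := G.core_nonempty
  exact hT.core c hc (h.mem_side hs hj hT hx (h.core_sub hc) (hq.trans (h.q_core c hc).symm) hxT)

theorem State.q_eq_of_sameCycle [Finite Ω] (h : G.State U₀ U₁ ν q β As mx)
    (hs : Skips σ (G.placed U₀ U₁) ν) {x y : Ω}
    (hx : x ∈ G.placed U₀ U₁) (hy : y ∈ G.placed U₀ U₁) (hxy : σ.SameCycle x y) : q x = q y :=
  (Skips.apply_eq_of_sameCycle h.q_next (hs.sameCycle hx hy hxy)).symm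

theorem State.β_eq_of_sameCycle [Finite Ω] (h : G.State U₀ U₁ ν q β As mx)
    (hs : Skips σ (G.placed U₀ U₁) ν) {x y : Ω} (hq : q x ≠ none)
    (hx : x ∈ G.placed U₀ U₁) (hy : y ∈ G.placed U₀ U₁) (hxy : σ.SameCycle x y) : β x = β y := by
  have := Skips.mem_of_sameCycle (T := {z | q z = q x ∧ β z = β x})
    (fun z hz => ⟨(h.q_next z).trans hz.1, (h.β_next z (hz.1 ▸ hq)).trans hz.2⟩)
    (hs.sameCycle hx hy hxy) ⟨rfl, rfl⟩
  exact this.2.symm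

/-- The colouring of a side agrees with the given one, up to a global change, on every piece. -/
theorem State.color_side (h : G.State U₀ U₁ ν q β As mx) (hs : Skips σ (G.placed U₀ U₁) ν) {j : ι}
    {T : Set Ω} {χ : Ω → Bool} (hj : j ∈ U₁) (hT : G.IsSide σ j T χ) {x y : Ω}
    (hx : x ∈ G.placed U₀ U₁) (hy : y ∈ G.placed U₀ U₁) (hq : q x = q y) (hxT : x ∈ T) :
    xor (χ x) (β x) = xor (χ y) (β y) := by
  have hn := h.q_ne_none_of_mem_side hs hj hT hx hxT
  have key := h.conn {z | z ∈ T ∧ q z = q x ∧ xor (χ z) (β z) = xor (χ x) (β x)} ?_ ?_ x hx y hy hq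
    ⟨hxT, rfl, rfl⟩
  · exact key.2.2.symm
  · rintro z hz ⟨hzT, hzq, hzc⟩
    refine ⟨hs.closed hT.next_mem hzT, (h.q_next z).trans hzq, ?_⟩
    rw [h.β_next z (hzq ▸ hn)]
    have : ν z ∈ {w | w ∈ T ∧ χ w = χ z} :=
      hs.closed (T := {w | w ∈ T ∧ χ w = χ z})
        (fun w hw => ⟨hT.next_mem w hw.1, (hT.color_next w hw.1).trans hw.2⟩) ⟨hzT, rfl⟩
    rw [this.2, hzc]
  · rintro z hz hz' ⟨hzT, hzq, hzc⟩
    have hne : z ≠ G.e j := by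
      rintro rfl
      exact hz'.2 j hj rfl
    refine ⟨hT.opp_mem z hzT hne, (h.q_opp z).trans hzq, ?_⟩
    rw [h.β_opp z hz hz' (hzq ▸ hn), hT.color_opp z hzT hne, ← hzc]
    cases χ z <;> cases β z <;> rfl

end Gluing

/-! ### The two moves: attaching an upper end and placing a lower end. -/

namespace Gluing

variable {Ω ι S Lab : Type*} [LinearOrder S] {G : Gluing Ω ι S Lab} [DecidableEq ι]
  [DecidableEq Ω]
variable {U U₀ U₁ : Finset ι} {σ ν : Equiv.Perm Ω} {q : Ω → Option ι} {β : Ω → Bool}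
  {As : S → Option ι} {mx : ι → S} {M : ι} {x u : Ω}

/-- The colouring after the piece `M` is glued at the corner of `x`. -/
def mergeColor (q : Ω → Option ι) (β : Ω → Bool) (x e : Ω) (y : Ω) : Bool :=
  if y = e then false else if q y = q x then xor (β y) (β x) else β y

/-- The pieces after the piece `M` is glued to the piece `t`. -/
def mergePiece {A : Type*} (q : A → Option ι) (M : ι) (t : Option ι) (y : A) : Option ι :=
  if q y = some M then t else q y

theorem mergePiece_eq_some {A : Type*} {q : A → Option ι} {t : Option ι} {y : A} {j : ι}
    (hj : t ≠ some j) (h : mergePiece q M t y = some j) : q y = some j := by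
  unfold mergePiece at h
  split_ifs at h with h1
  · exact absurd h hj
  · exact h

theorem mergePiece_of_ne {A : Type*} {q : A → Option ι} {t : Option ι} {y : A}
    (h : q y ≠ some M) : mergePiece q M t y = q y := if_neg h

theorem mergePiece_of_eq {A : Type*} {q : A → Option ι} {t : Option ι} {y : A}
    (h : q y = some M) : mergePiece q M t y = t := if_pos h

theorem closed_of_ins {K T : Set Ω} {e : Ω} (hfix : ∀ x, x ∉ K → ν x = x) (he : e ∉ K)
    (hT : ∀ y ∈ insert e K, y ∈ T → Skips.ins ν x e y ∈ T) : ∀ y ∈ K, y ∈ T → ν y ∈ T := by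
  intro y hy hyT
  by_cases hyx : y = x
  · subst hyx
    have h1 := hT y (Or.inr hy) hyT
    rw [Skips.ins_self] at h1
    have h2 := hT e (Or.inl rfl) h1
    rwa [Skips.ins_new (hfix e he)] at h2
  · have h1 := hT y (Or.inr hy) hyT
    rwa [Skips.ins_of_ne (hfix e he) (fun h => he (h ▸ hy)) hyx] at h1

theorem opp_e_notMem (hM : M ∈ U₁) : G.opp (G.e M) ∉ G.placed U₀ U₁ := fun h => h.2 M hM rfl

theorem e_notMem (hM : M ∈ U₀) : G.e M ∉ G.placed U₀ U₁ := fun h => h.1 M hM rfl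

theorem e_mem (hM : M ∉ U₀) : G.e M ∈ G.placed U₀ U₁ :=
  ⟨fun _ hj h => hM (G.e_injective h ▸ hj), fun _ _ => G.e_ne _ _⟩

/-- The piece `M` has the highest index, so its colours are kept and its index passes to the merged
piece. The receiving piece is recoloured so that the corner of `x` becomes `false`, opposite to `e
M`. On the piece of the core, colours carry no information. -/
theorem State.merge (h : G.State U (insert M U) ν q β As mx) (hM : M ∉ U)
    (hmx : ∀ j ∈ U, mx j ≤ mx M) (hβ : β (G.e M) = true)
    (hx : x ∈ G.placed U (insert M U)) (hxM : q x ≠ some M) (hL : G.L (G.opp x) = G.a M) :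
    G.State U U (Skips.ins ν x (G.opp (G.e M))) (mergePiece q M (q x))
      (mergeColor q β x (G.opp (G.e M))) (mergePiece As M (q x))
      (fun j => if q x = some j then mx M else mx j) := by
  have hMU : M ∈ insert M U := Finset.mem_insert_self _ _
  have hK := placed_insert (G := G) hM
  have he : G.opp (G.e M) ∉ G.placed U (insert M U) := opp_e_notMem hMU
  have hfe : ν (G.opp (G.e M)) = G.opp (G.e M) := h.fix _ he
  have hqe : q (G.opp (G.e M)) = some M := (h.q_opp _).trans (h.q_e M hMU)
  have hxe : x ≠ G.opp (G.e M) := fun hh => he (hh ▸ hx)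
  have hνmem : ∀ y ∈ G.placed U (insert M U), ν y ∈ G.placed U (insert M U) :=
    fun y hy => Skips.mem_of_fix h.fix hy
  have hqx : ∀ j, q x = some j → j ∈ U := fun j hj => by
    rcases Finset.mem_insert.1 (h.q_some x j hj).1 with rfl | hjU
    · exact absurd hj hxM
    · exact hjU
  have hins : ∀ y, y ≠ G.opp (G.e M) → y ≠ x → Skips.ins ν x (G.opp (G.e M)) y = ν y :=
    fun y h1 h2 => Skips.ins_of_ne hfe h1 h2
  constructor
  · exact subset_rfl
  · intro y hy
    rw [hK, Set.mem_insert_iff, not_or] at hy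
    rw [hins y hy.1 (fun hh => hy.2 (hh ▸ hx)), h.fix y hy.2]
  · intro y
    by_cases hy : y = G.opp (G.e M)
    · subst hy
      rw [Skips.ins_new hfe, mergePiece_of_eq hqe, mergePiece_of_ne, h.q_next]
      rwa [h.q_next]
    by_cases hyx : y = x
    · subst hyx
      rw [Skips.ins_self, mergePiece_of_eq hqe, mergePiece_of_ne hxM]
    · rw [hins y hy hyx]
      simp only [mergePiece, h.q_next]
  · intro y
    simp only [mergePiece, h.q_opp]
  · intro j hj
    rw [mergePiece_of_ne, h.q_e j (Finset.mem_insert_of_mem hj)]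
    rw [h.q_e j (Finset.mem_insert_of_mem hj)]
    intro hh
    exact hM (Option.some.inj hh ▸ hj)
  · intro y j hy
    by_cases hyM : q y = some M
    · rw [mergePiece_of_eq hyM] at hy
      refine ⟨hqx j hy, ?_⟩
      rw [(h.q_some y M hyM).2, ← hL]
      exact (h.q_some _ j ((h.q_opp x).trans hy)).2
    · rw [mergePiece_of_ne hyM] at hy
      refine ⟨?_, (h.q_some y j hy).2⟩
      rcases Finset.mem_insert.1 (h.q_some y j hy).1 with rfl | hjU
      · exact absurd hy hyM
      · exact hjU
  · intro y hy
    rw [mergePiece_of_ne, h.q_core y hy]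
    rw [h.q_core y hy]
    exact Option.some_ne_none _ |>.symm
  · rw [hK]
    exact h.core_sub.trans (Set.subset_insert _ _)
  · rw [hK]
    intro T hT1 hT2
    have hTν := closed_of_ins h.fix he hT1
    have hconn := h.conn T hTν
      (fun y hy hy' hyT => hT2 y (Or.inr hy) (Or.inr hy') hyT)
    -- Connectedness of the merged piece: `T` passes from `x` to the upper end through the rotation,
    -- and from there through the joining edge to the piece `M`.
    have hex : G.opp (G.e M) ∈ T ↔ x ∈ T := by
      constructor
      · intro hh
        have h1 := hT1 _ (Or.inl rfl) hh
        rw [Skips.ins_new hfe] at h1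
        exact hconn _ (hνmem x hx) x hx (h.q_next x) h1
      · intro hh
        have h1 := hT1 _ (Or.inr hx) hh
        rwa [Skips.ins_self] at h1
    have hee : G.e M ∈ T ↔ G.opp (G.e M) ∈ T := by
      constructor
      · exact fun hh => hT2 _ (Or.inr (e_mem hM)) (Or.inl rfl) hh
      · intro hh
        have := hT2 _ (Or.inl rfl) (Or.inr (by rw [G.opp_opp]; exact e_mem hM)) hh
        rwa [G.opp_opp] at this
    have claim : ∀ y ∈ insert (G.opp (G.e M)) (G.placed U (insert M U)),
        mergePiece q M (q x) y = q x → (y ∈ T ↔ x ∈ T) := by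
      rintro y (rfl | hy) hqy
      · exact hex
      · by_cases hyM : q y = some M
        · have h1 : q y = q (G.e M) := hyM.trans (h.q_e M hMU).symm
          rw [← hex, ← hee]
          exact ⟨hconn y hy _ (e_mem hM) h1, hconn _ (e_mem hM) y hy h1.symm⟩
        · rw [mergePiece_of_ne hyM] at hqy
          exact ⟨hconn y hy x hx hqy, hconn x hx y hy hqy.symm⟩
    intro y hy z hz hyz hyT
    by_cases hqy : mergePiece q M (q x) y = q x
    · exact (claim z hz (hyz ▸ hqy)).2 ((claim y hy hqy).1 hyT)
    · have aux : ∀ w ∈ insert (G.opp (G.e M)) (G.placed U (insert M U)),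
          mergePiece q M (q x) w ≠ q x → w ∈ G.placed U (insert M U) ∧
            mergePiece q M (q x) w = q w := by
        rintro w hw hqw
        have h1 : q w ≠ some M := fun hh => hqw (mergePiece_of_eq hh)
        rcases hw with rfl | hw
        · exact absurd hqe h1
        · exact ⟨hw, mergePiece_of_ne h1⟩
      obtain ⟨hy1, hy2⟩ := aux y hy hqy
      obtain ⟨hz1, hz2⟩ := aux z hz (hyz ▸ hqy)
      exact hconn y hy1 z hz1 (by rw [← hy2, ← hz2, hyz]) hyT
  · intro y hy
    by_cases hye : y = G.opp (G.e M)
    · subst hye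
      rw [mergePiece_of_eq hqe] at hy
      rw [Skips.ins_new hfe]
      have : ν x ≠ G.opp (G.e M) := fun hh => he (hh ▸ hνmem x hx)
      simp only [mergeColor, this, if_false, h.q_next, if_true, h.β_next x hy, Bool.xor_self]
    by_cases hyx : y = x
    · subst hyx
      rw [Skips.ins_self]
      simp [mergeColor, hye]
    · rw [hins y hye hyx]
      have h1 : ν y ≠ G.opp (G.e M) := fun hh => hye (ν.injective (hh.trans hfe.symm))
      have h2 : q y ≠ none := by
        intro hh
        rw [mergePiece_of_ne (by rw [hh]; exact (Option.some_ne_none _).symm)] at hy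
        exact hy hh
      simp only [mergeColor, h1, hye, if_false, h.q_next, h.β_next y h2]
  · rw [hK]
    have heM : mergeColor q β x (G.opp (G.e M)) (G.e M) = true := by
      rw [mergeColor, if_neg (G.e_ne M M), if_neg, hβ]
      rw [h.q_e M hMU]; exact fun hh => hxM hh.symm
    have heM' : mergeColor q β x (G.opp (G.e M)) (G.opp (G.e M)) = false := if_pos rfl
    intro y hy hy' hqy
    by_cases hye : y = G.opp (G.e M)
    · rw [hye, G.opp_opp, heM, heM']; rfl
    by_cases hye' : y = G.e M
    · rw [hye', heM, heM']; rfl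
    · have h1 : G.opp y ≠ G.opp (G.e M) := fun hh => hye' (opp_injective hh)
      have h2 : q y ≠ none := by
        intro hh
        rw [mergePiece_of_ne (by rw [hh]; exact (Option.some_ne_none _).symm)] at hqy
        exact hqy hh
      have h3 := h.β_opp y (hy.resolve_left hye) (hy'.resolve_left h1) h2
      simp only [mergeColor, h1, hye, if_false, h.q_opp, h3]
      split_ifs
      · cases β y <;> cases β x <;> rfl
      · rfl
  · intro s z hz
    obtain ⟨h1, h2⟩ := h.Z_q s z hz
    rw [hK]
    exact ⟨Or.inr h1, by simp only [mergePiece, h2]⟩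
  · intro j hj
    have hjM : j ≠ M := fun hh => hM (hh ▸ hj)
    split_ifs with hh
    · rw [mergePiece_of_eq (h.As_mx M hMU), hh]
    · have := h.As_mx j (Finset.mem_insert_of_mem hj)
      rw [mergePiece_of_ne, this]
      rw [this]; exact fun h' => hjM (Option.some.inj h')
  · intro j hj s hs
    by_cases hsM : As s = some M
    · rw [mergePiece_of_eq hsM] at hs
      simp only [hs, if_true]
      exact h.le_mx M hMU s hsM
    · rw [mergePiece_of_ne hsM] at hs
      have h1 := h.le_mx j (Finset.mem_insert_of_mem hj) s hs
      split_ifs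
      · exact h1.trans (hmx j hj)
      · exact h1
  · intro j hj z hz
    have hjM : j ≠ M := fun hh => hM (hh ▸ hj)
    by_cases hh : q x = some j
    · simp only [hh, if_true] at hz
      obtain ⟨h1, h2⟩ := h.Z_q _ z hz
      rw [h.As_mx M hMU] at h2
      rw [mergeColor, if_neg (ne_of_mem_of_not_mem h1 he), if_neg, h.β_mx M hMU z hz]
      rw [h2]; exact fun hh => hxM hh.symm
    · simp only [hh, if_false] at hz
      obtain ⟨h1, h2⟩ := h.Z_q _ z hz
      rw [h.As_mx j (Finset.mem_insert_of_mem hj)] at h2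
      rw [mergeColor, if_neg (ne_of_mem_of_not_mem h1 he), if_neg,
        h.β_mx j (Finset.mem_insert_of_mem hj) z hz]
      rw [h2]; exact fun h' => hh h'.symm

/-- The new half-edge takes the colour of the vertex it is inserted at. Its partner is still
unplaced, so no colour condition on a new edge arises. -/
theorem State.start (h : G.State U U ν q β As mx) (hM : M ∈ U) (hu : u ∈ G.placed U U)
    (hqu : q u = some M) (hβu : β u = true) :
    G.State (U.erase M) U (Skips.ins ν u (G.e M)) q (Function.update β (G.e M) true) As mx := by
  have hK := placed_erase (G := G) (U₁ := U) (U := U) (M := M)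
  have he : G.e M ∉ G.placed U U := e_notMem hM
  have he' : G.opp (G.e M) ∉ G.placed U U := opp_e_notMem hM
  have hfe : ν (G.e M) = G.e M := h.fix _ he
  have hqe : q (G.e M) = some M := h.q_e M hM
  have hνmem : ∀ y ∈ G.placed U U, ν y ∈ G.placed U U :=
    fun y hy => Skips.mem_of_fix h.fix hy
  have hins : ∀ y, y ≠ G.e M → y ≠ u → Skips.ins ν u (G.e M) y = ν y :=
    fun y h1 h2 => Skips.ins_of_ne hfe h1 h2
  have hupd : ∀ y ∈ G.placed U U, Function.update β (G.e M) true y = β y := fun y hy =>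
    Function.update_of_ne (ne_of_mem_of_not_mem hy he) _ _
  have hopp : ∀ y ∈ insert (G.e M) (G.placed U U), G.opp y ∈ insert (G.e M) (G.placed U U) →
      y ∈ G.placed U U ∧ G.opp y ∈ G.placed U U := by
    intro y hy hy'
    have h1 : y ≠ G.e M := by
      rintro rfl
      rcases hy' with hy' | hy'
      · exact opp_e_ne _ _ hy'
      · exact he' hy'
    have h2 := hy.resolve_left h1
    exact ⟨h2, opp_mem_placed_iff.2 h2⟩
  constructor
  · exact Finset.erase_subset _ _
  · intro y hy
    rw [hK, Set.mem_insert_iff, not_or] at hy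
    rw [hins y hy.1 (fun hh => hy.2 (hh ▸ hu)), h.fix y hy.2]
  · intro y
    by_cases hy : y = G.e M
    · subst hy
      rw [Skips.ins_new hfe, h.q_next, hqu, hqe]
    by_cases hyx : y = u
    · subst hyx
      rw [Skips.ins_self, hqu, hqe]
    · rw [hins y hy hyx, h.q_next]
  · exact h.q_opp
  · exact h.q_e
  · exact h.q_some
  · exact h.q_core
  · rw [hK]
    exact h.core_sub.trans (Set.subset_insert _ _)
  · rw [hK]
    intro T hT1 hT2
    have hTν := closed_of_ins h.fix he hT1
    have hconn := h.conn T hTν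
      (fun y hy hy' hyT => hT2 y (Or.inr hy) (Or.inr hy') hyT)
    have hex : G.e M ∈ T ↔ u ∈ T := by
      constructor
      · intro hh
        have h1 := hT1 _ (Or.inl rfl) hh
        rw [Skips.ins_new hfe] at h1
        exact hconn _ (hνmem u hu) u hu (h.q_next u) h1
      · intro hh
        have h1 := hT1 _ (Or.inr hu) hh
        rwa [Skips.ins_self] at h1
    have hrep : ∀ y ∈ insert (G.e M) (G.placed U U), ∃ y' ∈ G.placed U U, q y' = q y ∧
        (y ∈ T ↔ y' ∈ T) := by
      rintro y (rfl | hy)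
      · exact ⟨u, hu, hqu.trans hqe.symm, hex⟩
      · exact ⟨y, hy, rfl, Iff.rfl⟩
    intro y hy z hz hyz hyT
    obtain ⟨y', hy1, hy2, hy3⟩ := hrep y hy
    obtain ⟨z', hz1, hz2, hz3⟩ := hrep z hz
    exact hz3.2 (hconn y' hy1 z' hz1 (by rw [hy2, hz2, hyz]) (hy3.1 hyT))
  · intro y hy
    by_cases hye : y = G.e M
    · subst hye
      rw [Skips.ins_new hfe, hupd _ (hνmem u hu), Function.update_self, h.β_next, hβu]
      rw [hqu]; exact Option.some_ne_none _
    by_cases hyx : y = u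
    · subst hyx
      rw [Skips.ins_self, hupd _ hu, Function.update_self, hβu]
    · have h1 : ν y ≠ G.e M := fun hh => hye (ν.injective (hh.trans hfe.symm))
      rw [hins y hye hyx, Function.update_of_ne h1, Function.update_of_ne hye, h.β_next y hy]
  · rw [hK]
    intro y hy hy' hqy
    obtain ⟨h1, h2⟩ := hopp y hy hy'
    rw [hupd _ h1, hupd _ h2, h.β_opp y h1 h2 hqy]
  · intro s z hz
    obtain ⟨h1, h2⟩ := h.Z_q s z hz
    rw [hK]
    exact ⟨Or.inr h1, h2⟩
  · exact h.As_mx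
  · exact h.le_mx
  · intro j hj z hz
    rw [hupd _ (h.Z_q _ z hz).1, h.β_mx j hj z hz]

end Gluing

/-! ### Rebuilding the side of the edge with the highest index. -/

namespace Gluing

variable {Ω ι S Lab : Type*} [LinearOrder S] {G : Gluing Ω ι S Lab} [DecidableEq ι]
  [DecidableEq Ω] [Finite Ω]
variable {U U₀ U₁ : Finset ι} {σ ν : Equiv.Perm Ω} {q : Ω → Option ι} {β : Ω → Bool}
  {As : S → Option ι} {mx : ι → S} {M : ι} {x u : Ω}

theorem mem_placed_or (x : Ω) : x ∈ G.placed U₀ U₁ ∨ (∃ j ∈ U₀, x = G.e j) ∨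
    ∃ j ∈ U₁, x = G.opp (G.e j) := by
  by_contra! hh
  exact hh.1 ⟨hh.2.1, hh.2.2⟩

theorem IsSide.mem_of_sameCycle {j : ι} {T : Set Ω} {χ : Ω → Bool} (hT : G.IsSide σ j T χ)
    {x y : Ω} (hxy : σ.SameCycle x y) (hx : x ∈ T) : y ∈ T :=
  Skips.mem_of_sameCycle hT.next_mem hxy hx

/-- If all the edges attached to the pieces above `M` have a side, then so does the edge that attaches
the piece `M`. -/
theorem State.exists_isSide (h : G.State U (insert M U) ν q β As mx) (hM : M ∉ U)
    (hmx : ∀ j ∈ U, mx j ≤ mx M) (hβ : β (G.e M) = true)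
    (hs : Skips σ (G.placed U (insert M U)) ν)
    (hit₀ : ∀ j ∈ U, ∃ y ∈ G.placed U (insert M U), q y = some j ∧ σ.SameCycle (G.e j) y)
    (hit₁ : ∀ j ∈ U, ∃ y ∈ G.placed U (insert M U), σ.SameCycle (G.opp (G.e j)) y)
    (hx : x ∈ G.placed U (insert M U)) (hxM : q x ≠ some M)
    (hxe : σ.SameCycle (G.opp (G.e M)) x)
    (side : ∀ j ∈ U, ∃ T χ, G.IsSide σ j T χ) : ∃ T χ, G.IsSide σ M T χ := by
  classical
  have hMU : M ∈ insert M U := Finset.mem_insert_self _ _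
  have hUM : ∀ {j}, j ∈ U → j ∈ insert M U := Finset.mem_insert_of_mem
  have hbase : ∀ y, ∃ z ∈ G.placed U (insert M U), σ.SameCycle y z := by
    intro y
    rcases mem_placed_or (G := G) (U₀ := U) (U₁ := insert M U) y with hy | ⟨j, hj, rfl⟩ |
      ⟨j, hj, rfl⟩
    · exact ⟨y, hy, SameCycle.refl _ _⟩
    · obtain ⟨z, hz, -, hz'⟩ := hit₀ j hj
      exact ⟨z, hz, hz'⟩
    · rcases Finset.mem_insert.1 hj with rfl | hj
      · exact ⟨x, hx, hxe⟩
      · exact hit₁ j hj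
  -- `c y` is a placed half-edge at the vertex of `y`. The piece and the colour at which an unplaced
  -- half-edge sits are read off there.
  choose c hcK hc using hbase
  have qc : ∀ {y z}, z ∈ G.placed U (insert M U) → σ.SameCycle y z → q (c y) = q z :=
    fun hz hyz => h.q_eq_of_sameCycle hs (hcK _) hz ((hc _).symm.trans hyz)
  have βc : ∀ {y z}, q z ≠ none → z ∈ G.placed U (insert M U) → σ.SameCycle y z →
      β (c y) = β z :=
    fun hn hz hyz => (h.β_eq_of_sameCycle hs hn hz (hcK _) (hyz.symm.trans (hc _))).symm
  have qcK : ∀ {y}, y ∈ G.placed U (insert M U) → q (c y) = q y :=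
    fun hy => qc hy (SameCycle.refl _ _)
  have βcK : ∀ {y}, q y ≠ none → y ∈ G.placed U (insert M U) → β (c y) = β y :=
    fun hn hy => βc hn hy (SameCycle.refl _ _)
  have step : ∀ y, σ.SameCycle (σ y) (c y) := fun y => sameCycle_apply_left.2 (hc y)
  have qcσ : ∀ y, q (c (σ y)) = q (c y) := fun y => qc (hcK y) (step y)
  have βcσ : ∀ y, q (c y) ≠ none → β (c (σ y)) = β (c y) := fun y hn => βc hn (hcK y) (step y)
  choose! T χ hT using side
  have hsM : ∀ {j : ι}, (some j : Option ι) ≠ none := fun {j} => Option.some_ne_none j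
  -- the children of `M`
  have hdisj : ∀ j ∈ U, q (c (G.opp (G.e j))) = some M → ∀ y ∈ T j, q (c y) ≠ some M := by
    intro j hj hjM y hy hyM
    have h1 : c y ∈ T j := (hT j hj).mem_of_sameCycle (hc y) hy
    have h2 := h.mem_side hs (hUM hj) (hT j hj) (hcK y) (hcK (G.opp (G.e j)))
      (hyM.trans hjM.symm) h1
    exact (hT j hj).opp_notMem ((hT j hj).mem_of_sameCycle (hc _).symm h2)
  -- For two different children, `T j` without `T k` is still closed and contains `e j`, so
  -- minimality makes it all of `T j`.
  have hdisj' : ∀ j ∈ U, q (c (G.opp (G.e j))) = some M → ∀ k ∈ U,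
      q (c (G.opp (G.e k))) = some M → ∀ y, y ∈ T j → y ∈ T k → j = k := by
    intro j hj hjM k hk hkM y hyj hyk
    by_contra hjk
    have h1 : G.e j ∉ T k := by
      intro hh
      exact hdisj k hk hkM _ ((hT k hk).opp_mem _ hh (fun h' => hjk (G.e_injective h'))) hjM
    have h2 := (hT j hj).minimal {z | z ∈ T j ∧ z ∉ T k} ⟨(hT j hj).base_mem, h1⟩ ?_ ?_ hyj
    · exact h2.2 hyk
    · rintro z ⟨hz1, hz2⟩
      refine ⟨(hT j hj).next_mem z hz1, fun hh => hz2 ?_⟩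
      exact (hT k hk).mem_of_sameCycle (sameCycle_apply_left.2 (SameCycle.refl _ _)) hh
    · rintro z ⟨hz1, hz2⟩ hz3 -
      refine ⟨(hT j hj).opp_mem z hz1 hz3, fun hh => hz2 ?_⟩
      have h3 : G.opp z ≠ G.e k := by
        intro h4
        have h5 : z = G.opp (G.e k) := by rw [← h4, G.opp_opp]
        exact hdisj j hj hjM z hz1 (h5 ▸ hkM)
      simpa [G.opp_opp] using (hT k hk).opp_mem _ hh h3
  let J : ι → Prop := fun j => j ∈ U ∧ q (c (G.opp (G.e j))) = some M
  let T₀ : Set Ω := {y | q (c y) = some M ∨ ∃ j, J j ∧ y ∈ T j}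
  -- On the side of a child the lower end has colour `true` under `χ`. The shift by the colour of
  -- the upper end makes the two ends of the child's edge differ.
  let ψ : Ω → Bool := fun y => if q (c y) = some M then β (c y) else
    if hh : ∃ j, J j ∧ y ∈ T j then xor (χ hh.choose y) (β (c (G.opp (G.e hh.choose)))) else false
  have ψM : ∀ y, q (c y) = some M → ψ y = β (c y) := fun y hy => if_pos hy
  have ψT : ∀ j y, J j → y ∈ T j → ψ y = xor (χ j y) (β (c (G.opp (G.e j)))) := by
    intro j y hj hy
    have hh : ∃ j, J j ∧ y ∈ T j := ⟨j, hj, hy⟩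
    have h1 : hh.choose = j :=
      hdisj' _ hh.choose_spec.1.1 hh.choose_spec.1.2 j hj.1 hj.2 y hh.choose_spec.2 hy
    simp only [ψ]
    rw [if_neg (hdisj j hj.1 hj.2 y hy), dif_pos hh, h1]
  have heM : q (c (G.e M)) = some M := (qcK (e_mem hM)).trans (h.q_e M hMU)
  have T₀next : ∀ y ∈ T₀, σ y ∈ T₀ := by
    rintro y (hy | ⟨j, hj, hy⟩)
    · exact Or.inl ((qcσ y).trans hy)
    · exact Or.inr ⟨j, hj, (hT j hj.1).next_mem y hy⟩
  have ψnext : ∀ y ∈ T₀, ψ (σ y) = ψ y := by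
    rintro y (hy | ⟨j, hj, hy⟩)
    · rw [ψM y hy, ψM _ ((qcσ y).trans hy), βcσ y (by rw [hy]; exact hsM)]
    · rw [ψT j y hj hy, ψT j _ hj ((hT j hj.1).next_mem y hy), (hT j hj.1).color_next y hy]
  have T₀opp : ∀ y ∈ T₀, y ≠ G.e M → y ≠ G.opp (G.e M) → G.opp y ∈ T₀ ∧ ψ (G.opp y) = !ψ y := by
    rintro y (hy | ⟨j, hj, hy⟩) hyM hyM'
    · rcases mem_placed_or (G := G) (U₀ := U) (U₁ := insert M U) y with hyK | ⟨j, hj, rfl⟩ |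
        ⟨j, hj, rfl⟩
      · have hyK' : G.opp y ∈ G.placed U (insert M U) := by
          refine ⟨fun j hj hh => hyK.2 j (hUM hj) (by rw [← hh, G.opp_opp]), fun j hj hh => ?_⟩
          have h1 := opp_injective hh
          rcases Finset.mem_insert.1 hj with rfl | hj
          · exact hyM h1
          · exact hyK.1 j hj h1
        rw [qcK hyK] at hy
        have hy' : q (c (G.opp y)) = some M := by rw [qcK hyK', h.q_opp, hy]
        have hn : q y ≠ none := by rw [hy]; exact hsM
        refine ⟨Or.inl hy', ?_⟩
        rw [ψM _ hy', ψM _ ((qcK hyK).trans hy), βcK hn hyK, βcK _ hyK', h.β_opp y hyK hyK' hn]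
        rw [h.q_opp]; exact hn
      · obtain ⟨z, hz, hz1, hz2⟩ := hit₀ j hj
        rw [qc hz hz2, hz1] at hy
        exact absurd hj (Option.some.inj hy ▸ hM)
      · rcases Finset.mem_insert.1 hj with rfl | hj
        · exact absurd rfl hyM'
        · rw [G.opp_opp]
          refine ⟨Or.inr ⟨j, ⟨hj, hy⟩, (hT j hj).base_mem⟩, ?_⟩
          rw [ψT j _ ⟨hj, hy⟩ (hT j hj).base_mem, ψM _ hy, (hT j hj).color_base]
          simp
    · by_cases hye : y = G.e j
      · subst hye
        refine ⟨Or.inl hj.2, ?_⟩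
        rw [ψT j _ hj (hT j hj.1).base_mem, ψM _ hj.2, (hT j hj.1).color_base]
        simp
      · have h1 := (hT j hj.1).opp_mem y hy hye
        refine ⟨Or.inr ⟨j, hj, h1⟩, ?_⟩
        rw [ψT j _ hj h1, ψT j _ hj hy, (hT j hj.1).color_opp y hy hye]
        simp
  have T₀M : G.opp (G.e M) ∉ T₀ := by
    rintro (hy | ⟨j, hj, hy⟩)
    · exact hxM ((qc hx hxe).symm.trans hy)
    · have h1 := (hT j hj.1).opp_mem _ hy (opp_e_ne _ _)
      rw [G.opp_opp] at h1
      exact hdisj j hj.1 hj.2 _ h1 heM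
  -- The smallest closed set is taken as the side, so that minimality is automatic. `T₀` serves to
  -- bound it and to carry the colouring.
  let C : Set Ω := {y | ∀ T' : Set Ω, G.e M ∈ T' → (∀ z ∈ T', σ z ∈ T') →
    (∀ z ∈ T', z ≠ G.e M → z ≠ G.opp (G.e M) → G.opp z ∈ T') → y ∈ T'}
  have hCT : C ⊆ T₀ := fun y hy => hy T₀ (Or.inl heM) T₀next fun z hz h1 h2 => (T₀opp z hz h1 h2).1
  have Cne : ∀ y ∈ C, y ≠ G.opp (G.e M) := fun y hy hh => T₀M (hh ▸ hCT hy)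
  have Cnext : ∀ y ∈ C, σ y ∈ C := fun y hy T' h1 h2 h3 => h2 y (hy T' h1 h2 h3)
  have Copp : ∀ y ∈ C, y ≠ G.e M → G.opp y ∈ C := fun y hy hyM T' h1 h2 h3 =>
    h3 y (hy T' h1 h2 h3) hyM (Cne y hy)
  have CM : G.e M ∈ C := fun T' h1 _ _ => h1
  have hcoreq : ∀ y ∈ T₀, y ∈ G.placed U (insert M U) → q y ≠ none := by
    rintro y (hy | ⟨j, hj, hy⟩) hyK
    · rw [← qcK hyK, hy]; exact hsM
    · exact h.q_ne_none_of_mem_side hs (hUM hj.1) (hT j hj.1) hyK hy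
  refine ⟨C, ψ, CM, fun hh => Cne _ hh rfl, Cnext, Copp, fun T' h1 h2 h3 y hy => hy T' h1 h2 h3,
    fun y hy => ψnext y (hCT hy), fun y hy hyM => (T₀opp y (hCT hy) hyM (Cne y hy)).2, ?_, ?_, ?_⟩
  · rw [ψM _ heM, βcK _ (e_mem hM), hβ]
    rw [h.q_e M hMU]; exact hsM
  · intro y hy hyC
    exact hcoreq y (hCT hyC) (h.core_sub hy) (h.q_core y hy)
  · intro s z hz hzC hmax
    obtain ⟨hzK, hzq⟩ := h.Z_q s z hz
    obtain ⟨w, hw⟩ := G.Z_nonempty (mx M)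
    obtain ⟨hwK, hwq⟩ := h.Z_q _ w hw
    rw [h.As_mx M hMU] at hwq
    have hwC : w ∈ C := by
      refine h.conn C (fun y _ hyC => hs.closed Cnext hyC) (fun y _ hy' hyC => Copp y hyC ?_)
        _ (e_mem hM) w hwK ((h.q_e M hMU).trans hwq.symm) CM
      rintro rfl
      exact hy'.2 M hMU rfl
    -- The side contains marks of index `mx M`, and every index on it is at most some `mx j ≤ mx M`.
    -- So the highest index on the side is `mx M`, and its marks lie on the piece `M`.
    have h1 := hmax (mx M) w hw hwC
    obtain ⟨j, hj⟩ := Option.ne_none_iff_exists'.1 (hcoreq z (hCT hzC) hzK)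
    have hjU := (h.q_some z j hj).1
    have h2 := h.le_mx j hjU s (hzq.symm.trans hj)
    have h3 : mx j ≤ mx M := by
      rcases Finset.mem_insert.1 hjU with rfl | hjU
      · exact le_rfl
      · exact hmx j hjU
    have h4 : s = mx M := le_antisymm (h2.trans h3) h1
    subst h4
    rw [h.As_mx M hMU] at hzq
    have hn : q z ≠ none := by rw [hzq]; exact hsM
    rw [ψM z ((qcK hzK).trans hzq), βcK hn hzK, h.β_mx M hMU z hz]

end Gluing

/-! ### Comparison of the completions before and after a move. -/

namespace Gluing

variable {Ω ι S Lab : Type*} [LinearOrder S] {G : Gluing Ω ι S Lab} [DecidableEq ι]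
  [DecidableEq Ω] [Finite Ω]
variable {U U₀ U₁ : Finset ι} {σ ν : Equiv.Perm Ω} {q : Ω → Option ι} {β : Ω → Bool}
  {As : S → Option ι} {mx : ι → S} {M i : ι} {x u : Ω}

theorem L_opp_of_notMem {x : Ω} (hx : x ∉ G.placed U₀ U₁) : G.L (G.opp x) = G.L x := by
  rcases mem_placed_or (G := G) (U₀ := U₀) (U₁ := U₁) x with h | ⟨j, -, rfl⟩ | ⟨j, -, rfl⟩
  · exact absurd h hx
  · rw [G.L_opp_e, G.L_e]
  · rw [G.opp_opp, G.L_opp_e, G.L_e]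

theorem ins_sameCycle {K : Set Ω} {e : Ω} (hs : Skips σ K (Skips.ins ν x e)) :
    σ.SameCycle e x := by
  have := hs.sameCycle_apply x
  rw [Skips.ins_self] at this
  exact this.symm

/-- The corner at which the upper end of the edge of `M` is attached. -/
theorem Valid.exists_upper (h : G.State U (insert M U) ν q β As mx) (hM : M ∉ U)
    (hv : G.Valid U (insert M U) ν q σ) :
    ∃ x ∈ G.placed U (insert M U), q x ≠ some M ∧ G.L (G.opp x) = G.a M ∧
      Skips σ (G.placed U U) (Skips.ins ν x (G.opp (G.e M))) := by
  have hMU : M ∈ insert M U := Finset.mem_insert_self _ _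
  obtain ⟨x, hx, hsx⟩ := hv.skip.exists_ins (opp_e_notMem hMU) (hv.hit₁ M hMU)
  rw [← placed_insert hM] at hsx
  refine ⟨x, hx, fun hq => ?_, ?_, hsx⟩
  · obtain ⟨T, χ, hT⟩ := hv.side M hMU
    have h1 := h.mem_side hv.skip hMU hT (e_mem hM) hx ((h.q_e M hMU).trans hq.symm) hT.base_mem
    exact hT.opp_notMem (hT.mem_of_sameCycle (ins_sameCycle hsx).symm h1)
  · have h1 : x ∈ G.placed U U := by
      rw [placed_insert hM]; exact Or.inr hx
    have := hsx.label_apply hv.lab (fun y hy => L_opp_of_notMem hy) h1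
    rw [Skips.ins_self, G.L_opp_e] at this
    exact this.symm

/-- After attachment to the core a side for `M` is no longer demanded. Nothing is lost, since
`State.exists_isSide` recovers it from the sides of the other edges. -/
theorem valid_root_iff (h : G.State U (insert M U) ν q β As mx) (hM : M ∉ U)
    (hmx : ∀ j ∈ U, mx j ≤ mx M) (hβ : β (G.e M) = true)
    (hx : x ∈ G.placed U (insert M U)) (hq : q x = none) :
    G.Valid U U (Skips.ins ν x (G.opp (G.e M))) (mergePiece q M (q x)) σ ↔
      G.Valid U (insert M U) ν q σ ∧
        Skips σ (G.placed U U) (Skips.ins ν x (G.opp (G.e M))) := by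
  have hMU : M ∈ insert M U := Finset.mem_insert_self _ _
  have hK := placed_insert (G := G) hM
  have hqe : q (G.opp (G.e M)) = some M := (h.q_opp _).trans (h.q_e M hMU)
  constructor
  · intro hv
    have hs : Skips σ (G.placed U (insert M U)) ν :=
      Skips.of_ins (opp_e_notMem hMU) hx h.fix (hK ▸ hv.skip)
    have hxe := ins_sameCycle hv.skip
    have hit₀ : ∀ j ∈ U, ∃ y ∈ G.placed U (insert M U), q y = some j ∧
        σ.SameCycle (G.e j) y := by
      intro j hj
      obtain ⟨y, hy, hyq, hyc⟩ := hv.hit₀ j hj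
      have h1 := mergePiece_eq_some (by rw [hq]; exact (Option.some_ne_none _).symm) hyq
      rw [hK] at hy
      rcases hy with rfl | hy
      · rw [hqe] at h1
        exact absurd hj (Option.some.inj h1 ▸ hM)
      · exact ⟨y, hy, h1, hyc⟩
    have hit₁ : ∀ j ∈ U, ∃ y ∈ G.placed U (insert M U), σ.SameCycle (G.opp (G.e j)) y := by
      intro j hj
      obtain ⟨y, hy, hyc⟩ := hv.hit₁ j hj
      rw [hK] at hy
      rcases hy with rfl | hy
      · exact ⟨x, hx, hyc.trans hxe⟩
      · exact ⟨y, hy, hyc⟩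
    refine ⟨⟨hs, hv.lab, hit₀, ?_, ?_⟩, hv.skip⟩
    · intro j hj
      rcases Finset.mem_insert.1 hj with rfl | hj
      · exact ⟨x, hx, hxe⟩
      · exact hit₁ j hj
    · intro j hj
      rcases Finset.mem_insert.1 hj with rfl | hj
      · exact h.exists_isSide hM hmx hβ hs hit₀ hit₁ hx
          (by rw [hq]; exact (Option.some_ne_none _).symm) hxe hv.side
      · exact hv.side j hj
  · rintro ⟨hv, hs⟩
    refine ⟨hs, hv.lab, fun j hj => ?_, fun j hj => ?_,
      fun j hj => hv.side j (Finset.mem_insert_of_mem hj)⟩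
    · obtain ⟨y, hy, hyq, hyc⟩ := hv.hit₀ j hj
      refine ⟨y, hK ▸ Or.inr hy, ?_, hyc⟩
      rw [mergePiece_of_ne, hyq]
      rw [hyq]
      exact fun hh => hM (Option.some.inj hh ▸ hj)
    · obtain ⟨y, hy, hyc⟩ := hv.hit₁ j (Finset.mem_insert_of_mem hj)
      exact ⟨y, hK ▸ Or.inr hy, hyc⟩

/-- The lower end of the edge of the piece with the highest marked half-edges has the colour of
these. -/
theorem State.color_lower (h : G.State U U ν q β As mx) (hM : M ∈ U)
    (hmx : ∀ j ∈ U, mx j ≤ mx M) (hs : Skips σ (G.placed U U) ν)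
    (hside : ∃ T χ, G.IsSide σ M T χ) (hu : u ∈ G.placed U U) (hq : q u = some M)
    (hue : σ.SameCycle (G.e M) u) : β u = true := by
  obtain ⟨T, χ, hT⟩ := hside
  have huT := hT.mem_of_sameCycle hue hT.base_mem
  obtain ⟨z, hz⟩ := G.Z_nonempty (mx M)
  obtain ⟨hzK, hzq⟩ := h.Z_q _ z hz
  rw [h.As_mx M hM] at hzq
  have hzT := h.mem_side hs hM hT hu hzK (hq.trans hzq.symm) huT
  have hχz : χ z = true := by
    refine hT.sign _ z hz hzT fun s' z' hz' hzT' => ?_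
    obtain ⟨h1, h2⟩ := h.Z_q s' z' hz'
    obtain ⟨j, hj⟩ := Option.ne_none_iff_exists'.1 (h.q_ne_none_of_mem_side hs hM hT h1 hzT')
    have hjU := (h.q_some z' j hj).1
    exact (h.le_mx j hjU s' (h2.symm.trans hj)).trans (hmx j hjU)
  have hχu : χ u = true := by
    have := Skips.mem_of_sameCycle (T := {w | w ∈ T ∧ χ w = χ (G.e M)})
      (fun w hw => ⟨hT.next_mem w hw.1, (hT.color_next w hw.1).trans hw.2⟩) hue
      ⟨hT.base_mem, rfl⟩
    rw [this.2, hT.color_base]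
  -- `χ` and `β` differ by a constant on a piece, and both are `true` at the mark `z`.
  have := h.color_side hs hM hT hu hzK (hq.trans hzq.symm) huT
  rw [hχu, hχz, h.β_mx M hM z hz] at this
  simpa using this

theorem Valid.exists_lower (h : G.State U U ν q β As mx) (hM : M ∈ U)
    (hmx : ∀ j ∈ U, mx j ≤ mx M) (hv : G.Valid U U ν q σ) :
    ∃ u ∈ G.placed U U, q u = some M ∧ β u = true ∧
      Skips σ (G.placed (U.erase M) U) (Skips.ins ν u (G.e M)) := by
  obtain ⟨y, hy, hyq, hyc⟩ := hv.hit₀ M hM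
  obtain ⟨u, hu, hsu⟩ := hv.skip.exists_ins (e_notMem hM) ⟨y, hy, hyc⟩
  have hue := ins_sameCycle hsu
  have hqu : q u = some M :=
    (h.q_eq_of_sameCycle hv.skip hu hy (hue.symm.trans hyc)).trans hyq
  rw [← placed_erase] at hsu
  exact ⟨u, hu, hqu, h.color_lower hM hmx hv.skip (hv.side M hM) hu hqu hue, hsu⟩

theorem valid_start_iff (h : G.State U U ν q β As mx) (hM : M ∈ U)
    (hu : u ∈ G.placed U U) (hq : q u = some M) :
    G.Valid (U.erase M) U (Skips.ins ν u (G.e M)) q σ ↔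
      G.Valid U U ν q σ ∧ Skips σ (G.placed (U.erase M) U) (Skips.ins ν u (G.e M)) := by
  have hK := placed_erase (G := G) (U₁ := U) (U := U) (M := M)
  constructor
  · intro hv
    have hue := ins_sameCycle hv.skip
    refine ⟨⟨Skips.of_ins (e_notMem hM) hu h.fix (hK ▸ hv.skip), hv.lab, fun j hj => ?_,
      fun j hj => ?_, hv.side⟩, hv.skip⟩
    · by_cases hjM : j = M
      · subst hjM
        exact ⟨u, hu, hq, hue⟩
      · obtain ⟨y, hy, hyq, hyc⟩ := hv.hit₀ j (Finset.mem_erase.2 ⟨hjM, hj⟩)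
        rw [hK] at hy
        rcases hy with rfl | hy
        · rw [h.q_e M hM] at hyq
          exact absurd (Option.some.inj hyq).symm hjM
        · exact ⟨y, hy, hyq, hyc⟩
    · obtain ⟨y, hy, hyc⟩ := hv.hit₁ j hj
      rw [hK] at hy
      rcases hy with rfl | hy
      · exact ⟨u, hu, hyc.trans hue⟩
      · exact ⟨y, hy, hyc⟩
  · rintro ⟨hv, hs⟩
    refine ⟨hs, hv.lab, fun j hj => ?_, fun j hj => ?_, hv.side⟩
    · obtain ⟨y, hy, hyq, hyc⟩ := hv.hit₀ j (Finset.mem_of_mem_erase hj)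
      exact ⟨y, hK ▸ Or.inr hy, hyq, hyc⟩
    · obtain ⟨y, hy, hyc⟩ := hv.hit₁ j hj
      exact ⟨y, hK ▸ Or.inr hy, hyc⟩

/-- The merged piece carries the highest index, so `State.color_lower` forces the colour `true` on
the lower end of `i`. In the recoloured piece this means a colour opposite to that of `x`; in
particular the new corner behind the upper end of `M`, coloured `false`, is excluded. -/
theorem Valid.exists_lower_of_upper (h : G.State U (insert M U) ν q β As mx) (hM : M ∉ U)
    (hmx : ∀ j ∈ U, mx j ≤ mx M) (hβ : β (G.e M) = true)
    (hx : x ∈ G.placed U (insert M U)) (hL : G.L (G.opp x) = G.a M)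
    (hi : i ∈ U) (hq : q x = some i)
    (hv : G.Valid U (insert M U) ν q σ)
    (hs : Skips σ (G.placed U U) (Skips.ins ν x (G.opp (G.e M)))) :
    ∃ u ∈ G.placed U (insert M U), q u = some i ∧ β u ≠ β x ∧
      Skips σ (G.placed (U.erase i) U)
        (Skips.ins (Skips.ins ν x (G.opp (G.e M))) u (G.e i)) := by
  have hiM : i ≠ M := fun hh => hM (hh ▸ hi)
  have hxM : q x ≠ some M := by
    rw [hq]; exact fun hh => hiM (Option.some.inj hh)
  have h' := h.merge hM hmx hβ hx hxM hL
  obtain ⟨y, hy, hyq, hyc⟩ := hv.hit₀ i hi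
  have hyK : y ∈ G.placed U U := by rw [placed_insert hM]; exact Or.inr hy
  obtain ⟨u, hu, hsu⟩ := hs.exists_ins (e_notMem hi) ⟨y, hyK, hyc⟩
  have hue := ins_sameCycle hsu
  have hyq' : mergePiece q M (q x) y = some i := by
    rw [mergePiece_of_ne, hyq]
    rw [hyq]; exact fun hh => hiM (Option.some.inj hh)
  have hqu : mergePiece q M (q x) u = some i :=
    (h'.q_eq_of_sameCycle hs hu hyK (hue.symm.trans hyc)).trans hyq'
  have hcol := h'.color_lower hi ?_ hs (hv.side i (Finset.mem_insert_of_mem hi)) hu hqu hue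
  · have hne : u ≠ G.opp (G.e M) := by
      rintro rfl
      simp [mergeColor] at hcol
    have huK : u ∈ G.placed U (insert M U) := by
      rw [placed_insert hM] at hu
      exact hu.resolve_left hne
    have hqu' : q u = some i :=
      (h.q_eq_of_sameCycle hv.skip huK hy (hue.symm.trans hyc)).trans hyq
    rw [← placed_erase] at hsu
    refine ⟨u, huK, hqu', ?_, hsu⟩
    rw [mergeColor, if_neg hne, if_pos (hqu'.trans hq.symm)] at hcol
    intro hh
    rw [hh] at hcol
    simp at hcol
  · intro j hj
    simp only [hq, if_true]
    split_ifs
    · exact le_rfl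
    · exact hmx j hj

theorem valid_piece_iff (h : G.State U (insert M U) ν q β As mx) (hM : M ∉ U)
    (hmx : ∀ j ∈ U, mx j ≤ mx M) (hβ : β (G.e M) = true)
    (hx : x ∈ G.placed U (insert M U)) (hi : i ∈ U) (hq : q x = some i)
    (hu : u ∈ G.placed U (insert M U)) (hqu : q u = some i) :
    G.Valid (U.erase i) U (Skips.ins (Skips.ins ν x (G.opp (G.e M))) u (G.e i))
        (mergePiece q M (q x)) σ ↔
      G.Valid U (insert M U) ν q σ ∧
        Skips σ (G.placed U U) (Skips.ins ν x (G.opp (G.e M))) ∧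
        Skips σ (G.placed (U.erase i) U)
          (Skips.ins (Skips.ins ν x (G.opp (G.e M))) u (G.e i)) := by
  have hMU : M ∈ insert M U := Finset.mem_insert_self _ _
  have hiM : i ≠ M := fun hh => hM (hh ▸ hi)
  have hK := placed_insert (G := G) hM
  have hK' := placed_erase (G := G) (U₁ := U) (U := U) (M := i)
  have hqe : q (G.opp (G.e M)) = some M := (h.q_opp _).trans (h.q_e M hMU)
  have hxM : q x ≠ some M := by
    rw [hq]; exact fun hh => hiM (Option.some.inj hh)
  have huK : u ∈ G.placed U U := by rw [hK]; exact Or.inr hu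
  constructor
  · intro hv
    have hfix : ∀ y, y ∉ G.placed U U → Skips.ins ν x (G.opp (G.e M)) y = y := by
      intro y hy
      rw [hK, Set.mem_insert_iff, not_or] at hy
      rw [Skips.ins_of_ne (h.fix _ (opp_e_notMem hMU)) hy.1
        (ne_of_mem_of_not_mem hx hy.2).symm, h.fix y hy.2]
    have hs' : Skips σ (G.placed U U) (Skips.ins ν x (G.opp (G.e M))) :=
      Skips.of_ins (e_notMem hi) huK hfix (hK' ▸ hv.skip)
    have hs : Skips σ (G.placed U (insert M U)) ν :=
      Skips.of_ins (opp_e_notMem hMU) hx h.fix (hK ▸ hs')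
    have hxe := ins_sameCycle hs'
    have hue := ins_sameCycle hv.skip
    have hit₀ : ∀ j ∈ U, ∃ y ∈ G.placed U (insert M U), q y = some j ∧
        σ.SameCycle (G.e j) y := by
      intro j hj
      by_cases hji : j = i
      · subst hji
        exact ⟨u, hu, hqu, hue⟩
      obtain ⟨y, hy, hyq, hyc⟩ := hv.hit₀ j (Finset.mem_erase.2 ⟨hji, hj⟩)
      have h1 := mergePiece_eq_some
        (by rw [hq]; exact fun hh => hji (Option.some.inj hh).symm) hyq
      rw [hK', hK] at hy
      rcases hy with rfl | rfl | hy
      · rw [h.q_e i (Finset.mem_insert_of_mem hi)] at h1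
        exact absurd (Option.some.inj h1).symm hji
      · rw [hqe] at h1
        exact absurd hj (Option.some.inj h1 ▸ hM)
      · exact ⟨y, hy, h1, hyc⟩
    have hit₁ : ∀ j ∈ U, ∃ y ∈ G.placed U (insert M U), σ.SameCycle (G.opp (G.e j)) y := by
      intro j hj
      obtain ⟨y, hy, hyc⟩ := hv.hit₁ j hj
      rw [hK', hK] at hy
      rcases hy with rfl | rfl | hy
      · exact ⟨u, hu, hyc.trans hue⟩
      · exact ⟨x, hx, hyc.trans hxe⟩
      · exact ⟨y, hy, hyc⟩
    refine ⟨⟨hs, hv.lab, hit₀, ?_, ?_⟩, hs', hv.skip⟩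
    · intro j hj
      rcases Finset.mem_insert.1 hj with rfl | hj
      · exact ⟨x, hx, hxe⟩
      · exact hit₁ j hj
    · intro j hj
      rcases Finset.mem_insert.1 hj with rfl | hj
      · exact h.exists_isSide hM hmx hβ hs hit₀ hit₁ hx hxM hxe hv.side
      · exact hv.side j hj
  · rintro ⟨hv, -, hs⟩
    refine ⟨hs, hv.lab, fun j hj => ?_, fun j hj => ?_,
      fun j hj => hv.side j (Finset.mem_insert_of_mem hj)⟩
    · have hjU := Finset.mem_of_mem_erase hj
      obtain ⟨y, hy, hyq, hyc⟩ := hv.hit₀ j hjU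
      refine ⟨y, by rw [hK', hK]; exact Or.inr (Or.inr hy), ?_, hyc⟩
      rw [mergePiece_of_ne, hyq]
      rw [hyq]
      exact fun hh => hM (Option.some.inj hh ▸ hjU)
    · obtain ⟨y, hy, hyc⟩ := hv.hit₁ j (Finset.mem_insert_of_mem hj)
      exact ⟨y, by rw [hK', hK]; exact Or.inr (Or.inr hy), hyc⟩

end Gluing

/-! ### Counting corners and half-edges; the factor of a face. -/

namespace Gluing

/-- The factor of a face of degree `κ` that arises by gluing `k` one-faced pieces into a face of
degree `y`. -/
def faceFactor (κ y : ℤ) : ℕ → ℤ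
  | 0 => 1
  | k + 1 => y * ∏ r ∈ Finset.range k, (κ - 2 * ((r : ℤ) + 1))

/-- For `k ≥ 1` the common factor is `y ∏ (κ - 2 r)`, and it is multiplied by `y + c + 2 s = κ - 2
k`. For `k = 0` the value of `faceFactor` is 1 instead of `y`, and no piece is left to attach to, so
`s = 0`. -/
theorem faceFactor_succ (κ y c s : ℤ) (k : ℕ) (h : κ = y + c + (2 * s + 2 * k))
    (hs : k = 0 → s = 0) :
    y * faceFactor κ (y + c) k + 2 * s * faceFactor κ y k = faceFactor κ y (k + 1) := by
  cases k with
  | zero => simp [faceFactor, hs rfl]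
  | succ k =>
    simp only [faceFactor, Finset.prod_range_succ]
    rw [h]; push_cast; ring

variable {Ω ι S Lab : Type*} [LinearOrder S] {G : Gluing Ω ι S Lab} [DecidableEq ι]
  [DecidableEq Ω] [Fintype Ω] [Fintype ι] [Fintype Lab] [DecidableEq Lab]
variable {U U₀ U₁ : Finset ι} {σ ν : Equiv.Perm Ω} {q : Ω → Option ι} {β : Ω → Bool}
  {As : S → Option ι} {mx : ι → S} {M i : ι} {x u : Ω}

open Classical in
variable (G) in
/-- The valid completions. -/
noncomputable def validSet (U₀ U₁ : Finset ι) (ν : Equiv.Perm Ω) (q : Ω → Option ι) :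
    Finset (Equiv.Perm Ω) :=
  Finset.univ.filter fun σ => G.Valid U₀ U₁ ν q σ

open Classical in
variable (G) in
/-- The number of placed half-edges of the piece `j` of given colour. -/
noncomputable def colorCard (U₀ U₁ : Finset ι) (q : Ω → Option ι) (β : Ω → Bool) (j : ι)
    (c : Bool) : ℕ :=
  (Finset.univ.filter fun y => y ∈ G.placed U₀ U₁ ∧ q y = some j ∧ β y = c).card

variable (G) in
/-- The number of half-edges with label `f` of the piece of the core. -/
def rootCard (q : Ω → Option ι) (f : Lab) : ℕ :=
  (Finset.univ.filter fun y => q y = none ∧ G.L y = f).card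

variable (G) in
/-- The number of all half-edges with label `f`. -/
def labCard (f : Lab) : ℕ := (Finset.univ.filter fun y => G.L y = f).card

theorem rootCard_merge_root (h : G.State U (insert M U) ν q β As mx) (f : Lab) :
    rootCard G (mergePiece q M none) f = rootCard G q f +
      if G.a M = f then (Finset.univ.filter fun y => q y = some M).card else 0 := by
  have : (if G.a M = f then (Finset.univ.filter fun y => q y = some M).card else 0) =
      (Finset.univ.filter fun y => q y = some M ∧ G.L y = f).card := by
    split_ifs with hf
    · congr 1
      ext y
      simp only [Finset.mem_filter, Finset.mem_univ, true_and]
      exact ⟨fun hy => ⟨hy, (h.q_some y M hy).2.trans hf⟩, fun hy => hy.1⟩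
    · symm
      rw [Finset.card_eq_zero, Finset.filter_eq_empty_iff]
      rintro y - ⟨hy, hy'⟩
      exact hf ((h.q_some y M hy).2.symm.trans hy')
  rw [this, rootCard, rootCard, ← Finset.card_union_of_disjoint]
  · congr 1
    ext y
    simp only [mergePiece, Finset.mem_filter, Finset.mem_univ, true_and, Finset.mem_union]
    by_cases hy : q y = some M <;> simp [hy]
  · rw [Finset.disjoint_filter]
    rintro y - ⟨hy, -⟩ ⟨hy', -⟩
    rw [hy] at hy'
    exact Option.some_ne_none _ hy'.symm

theorem rootCard_merge_piece (f : Lab) :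
    rootCard G (mergePiece q M (some i)) f = rootCard G q f := by
  rw [rootCard, rootCard]
  congr 1
  ext y
  simp only [Finset.mem_filter, Finset.mem_univ, true_and]
  by_cases hy : q y = some M
  · simp [mergePiece_of_eq hy, hy]
  · rw [mergePiece_of_ne hy]

/-- The corner behind `y` lies in the face of `opp y`, since faces are cycles of the involution
followed by the rotation. The involution turns corners of a face into its half-edges. -/
theorem card_root_corners (h : G.State U₀ U₁ ν q β As mx) (f : Lab) :
    (Finset.univ.filter fun y => q y = none ∧ G.L (G.opp y) = f).card = rootCard G q f := by
  refine Finset.card_bij (fun y _ => G.opp y) ?_ (fun y _ z _ hh => opp_injective hh) ?_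
  · intro y hy
    simpa [h.q_opp] using hy
  · intro y hy
    refine ⟨G.opp y, ?_, G.opp_opp y⟩
    simpa [h.q_opp, G.opp_opp] using hy

theorem State.placed_of_q_eq_none (h : G.State U₀ U₁ ν q β As mx) {y : Ω} (hy : q y = none) :
    y ∈ G.placed U₀ U₁ := by
  refine ⟨fun j hj hh => ?_, fun j hj hh => ?_⟩
  · rw [hh, h.q_e j (h.sub hj)] at hy
    exact Option.some_ne_none _ hy
  · rw [hh, h.q_opp, h.q_e j hj] at hy
    exact Option.some_ne_none _ hy

/-- The 2 accounts for the unplaced halves of the joining edge of the piece. -/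
theorem State.card_piece (h : G.State U₀ U₁ ν q β As mx) {j : ι} (hj : j ∈ U₀) :
    (Finset.univ.filter fun y => q y = some j).card =
      colorCard G U₀ U₁ q β j true + colorCard G U₀ U₁ q β j false + 2 := by
  classical
  have hjU := h.sub hj
  have e1 : (Finset.univ.filter fun y => q y = some j) =
      ((Finset.univ.filter fun y => y ∈ G.placed U₀ U₁ ∧ q y = some j ∧ β y = true) ∪
      (Finset.univ.filter fun y => y ∈ G.placed U₀ U₁ ∧ q y = some j ∧ β y = false)) ∪
      {G.e j, G.opp (G.e j)} := by
    ext y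
    simp only [Finset.mem_filter, Finset.mem_univ, true_and, Finset.mem_union,
      Finset.mem_insert, Finset.mem_singleton]
    constructor
    · intro hy
      rcases mem_placed_or (G := G) (U₀ := U₀) (U₁ := U₁) y with hK | ⟨k, hk, rfl⟩ | ⟨k, hk, rfl⟩
      · left
        cases hb : β y
        · exact Or.inr ⟨hK, hy, rfl⟩
        · exact Or.inl ⟨hK, hy, rfl⟩
      · rw [h.q_e k (h.sub hk)] at hy
        rw [Option.some.inj hy]; exact Or.inr (Or.inl rfl)
      · rw [h.q_opp, h.q_e k hk] at hy
        rw [Option.some.inj hy]; exact Or.inr (Or.inr rfl)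
    · rintro ((⟨-, hy, -⟩ | ⟨-, hy, -⟩) | rfl | rfl)
      · exact hy
      · exact hy
      · exact h.q_e j hjU
      · rw [h.q_opp, h.q_e j hjU]
  rw [e1, Finset.card_union_of_disjoint, Finset.card_union_of_disjoint,
    Finset.card_pair (G.e_ne j j)]
  · rfl
  · rw [Finset.disjoint_filter]
    rintro y - ⟨-, -, h1⟩ ⟨-, -, h2⟩
    rw [h1] at h2; exact Bool.noConfusion h2
  · rw [Finset.disjoint_right]
    intro y hy
    have hnot : y ∉ G.placed U₀ U₁ := by
      simp only [Finset.mem_insert, Finset.mem_singleton] at hy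
      rcases hy with rfl | rfl
      · exact e_notMem hj
      · exact opp_e_notMem hjU
    simp [hnot]

theorem State.labCard_eq (h : G.State U (insert M U) ν q β As mx) (hM : M ∉ U) (E : ι → ℕ)
    (hE : ∀ j ∈ U, ∀ c, colorCard G U (insert M U) q β j c = E j) :
    labCard G (G.a M) = rootCard G q (G.a M) + (Finset.univ.filter fun y => q y = some M).card +
      ∑ j ∈ U with G.a j = G.a M, (2 * E j + 2) := by
  classical
  have e1 := Finset.card_eq_sum_card_fiberwise (f := q)
    (s := Finset.univ.filter fun y => G.L y = G.a M) (t := Finset.univ) (fun _ _ => by simp)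
  rw [labCard, e1, Fintype.sum_option]
  have hfil : ∀ j, j ∈ insert M U → G.a j = G.a M →
      ((Finset.univ.filter fun y => G.L y = G.a M).filter fun y => q y = some j) =
        Finset.univ.filter fun y => q y = some j := by
    intro j hj hja
    ext y
    simp only [Finset.mem_filter, Finset.mem_univ, true_and, and_iff_right_iff_imp]
    exact fun hy => (h.q_some y j hy).2.trans hja
  rw [add_assoc]
  congr 1
  · rw [rootCard]; congr 1; ext y
    simp [and_comm]
  · have hzero : ∀ j, j ∉ insert M (U.filter fun j => G.a j = G.a M) →
        ((Finset.univ.filter fun y => G.L y = G.a M).filter fun y => q y = some j).card = 0 := by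
      intro j hj
      rw [Finset.card_eq_zero, Finset.filter_eq_empty_iff]
      intro y hy hyq
      apply hj
      simp only [Finset.mem_filter, Finset.mem_univ, true_and] at hy
      obtain ⟨h1, h2⟩ := h.q_some y j hyq
      rcases Finset.mem_insert.1 h1 with rfl | h1
      · exact Finset.mem_insert_self _ _
      · exact Finset.mem_insert_of_mem (Finset.mem_filter.2 ⟨h1, h2.symm.trans hy⟩)
    rw [← Finset.sum_subset (Finset.subset_univ (insert M (U.filter fun j => G.a j = G.a M)))
      (fun j _ hj => hzero j hj), Finset.sum_insert (by simp [hM])]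
    congr 1
    · rw [hfil M (Finset.mem_insert_self _ _) rfl]
    · refine Finset.sum_congr rfl fun j hj => ?_
      rw [Finset.mem_filter] at hj
      rw [hfil j (Finset.mem_insert_of_mem hj.1) hj.2, h.card_piece hj.1, hE j hj.1, hE j hj.1]
      ring

end Gluing

/-! ### The recursion for the number of completions. -/

namespace Gluing

variable {Ω ι S Lab : Type*} [LinearOrder S] {G : Gluing Ω ι S Lab} [DecidableEq ι]
  [DecidableEq Ω] [Fintype Ω] [Fintype ι] [Fintype Lab] [DecidableEq Lab]
variable {U U₀ U₁ : Finset ι} {σ ν : Equiv.Perm Ω} {q : Ω → Option ι} {β : Ω → Bool}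
  {As : S → Option ι} {mx : ι → S} {M i : ι} {x u : Ω} {E : ι → ℕ}

theorem mem_validSet : σ ∈ validSet G U₀ U₁ ν q ↔ G.Valid U₀ U₁ ν q σ := by
  simp [validSet]

theorem lab_ins {K : Set Ω} {e : Ω} (hfix : ∀ y, y ∉ K → ν y = y) (he : e ∉ K)
    (hl : ∀ y ∈ K, G.L (ν y) = G.L (G.opp y)) (hx : x ∈ K) (hxe : G.L (G.opp x) = G.L e)
    (hee : G.L (G.opp e) = G.L e) :
    ∀ y ∈ insert e K, G.L (Skips.ins ν x e y) = G.L (G.opp y) := by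
  rintro y (rfl | hy)
  · rw [Skips.ins_new (hfix _ he), hl x hx, hxe, hee]
  · by_cases hyx : y = x
    · subst hyx; rw [Skips.ins_self, hxe]
    · rw [Skips.ins_of_ne (hfix _ he) (ne_of_mem_of_not_mem hy he) hyx, hl y hy]

-- Each completion has exactly one corner for the upper end: it exists by `Valid.exists_upper`, and
-- it is unique because induced permutations are unique and the result of an insertion determines
-- its corner.
open Classical in
theorem card_upper (h : G.State U (insert M U) ν q β As mx) (hM : M ∉ U) :
    (validSet G U (insert M U) ν q).card =
      ∑ x with x ∈ G.placed U (insert M U) ∧ q x ≠ some M ∧ G.L (G.opp x) = G.a M,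
        Nat.card {σ // G.Valid U (insert M U) ν q σ ∧
          Skips σ (G.placed U U) (Skips.ins ν x (G.opp (G.e M)))} := by
  have e1 : validSet G U (insert M U) ν q = (Finset.univ.filter fun x =>
      x ∈ G.placed U (insert M U) ∧ q x ≠ some M ∧ G.L (G.opp x) = G.a M).biUnion
      fun x => Finset.univ.filter fun σ => G.Valid U (insert M U) ν q σ ∧
          Skips σ (G.placed U U) (Skips.ins ν x (G.opp (G.e M))) := by
    ext σ
    simp only [mem_validSet, Finset.mem_biUnion, Finset.mem_univ, true_and, Finset.mem_filter]
    constructor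
    · intro hv
      obtain ⟨x, h1, h2, h3, h4⟩ := hv.exists_upper h hM
      exact ⟨x, ⟨h1, h2, h3⟩, hv, h4⟩
    · rintro ⟨-, -, hv, -⟩
      exact hv
  rw [e1, Finset.card_biUnion]
  · refine Finset.sum_congr rfl fun x _ => ?_
    rw [Nat.card_eq_fintype_card, Fintype.card_subtype]
  · rintro x - y - hxy
    rw [Function.onFun, Finset.disjoint_filter]
    rintro σ - ⟨-, h1⟩ ⟨-, h2⟩
    exact hxy (Skips.ins_injective (h1.unique h2))

theorem card_upper_root (h : G.State U (insert M U) ν q β As mx) (hM : M ∉ U)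
    (hmx : ∀ j ∈ U, mx j ≤ mx M) (hβ : β (G.e M) = true)
    (hx : x ∈ G.placed U (insert M U)) (hq : q x = none) :
    Nat.card {σ // G.Valid U (insert M U) ν q σ ∧
        Skips σ (G.placed U U) (Skips.ins ν x (G.opp (G.e M)))} =
      (validSet G U U (Skips.ins ν x (G.opp (G.e M))) (mergePiece q M (q x))).card := by
  classical
  rw [Nat.card_eq_fintype_card, Fintype.card_subtype]
  congr 1
  ext σ
  simp only [mem_validSet, Finset.mem_univ, true_and, Finset.mem_filter]
  rw [valid_root_iff h hM hmx hβ hx hq]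

-- With the upper end of `M` on the piece `i`, the completions split according to the corner `u` of
-- the lower end of `i`, whose colour is already forced.
open Classical in
theorem card_upper_piece (h : G.State U (insert M U) ν q β As mx) (hM : M ∉ U)
    (hmx : ∀ j ∈ U, mx j ≤ mx M) (hβ : β (G.e M) = true)
    (hx : x ∈ G.placed U (insert M U)) (hL : G.L (G.opp x) = G.a M)
    (hi : i ∈ U) (hq : q x = some i) :
    Nat.card {σ // G.Valid U (insert M U) ν q σ ∧
        Skips σ (G.placed U U) (Skips.ins ν x (G.opp (G.e M)))} =
      ∑ u with u ∈ G.placed U (insert M U) ∧ q u = some i ∧ β u = !β x,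
        (validSet G (U.erase i) U (Skips.ins (Skips.ins ν x (G.opp (G.e M))) u (G.e i))
          (mergePiece q M (q x))).card := by
  classical
  rw [Nat.card_eq_fintype_card, Fintype.card_subtype]
  have e1 : (Finset.univ.filter fun σ => G.Valid U (insert M U) ν q σ ∧
        Skips σ (G.placed U U) (Skips.ins ν x (G.opp (G.e M)))) = (Finset.univ.filter
      fun u => u ∈ G.placed U (insert M U) ∧ q u = some i ∧ β u = !β x).biUnion fun u =>
        (validSet G (U.erase i) U (Skips.ins (Skips.ins ν x (G.opp (G.e M))) u (G.e i))
          (mergePiece q M (q x))) := by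
    ext σ
    simp only [mem_validSet, Finset.mem_biUnion, Finset.mem_univ, true_and, Finset.mem_filter]
    constructor
    · rintro ⟨hv, hs⟩
      obtain ⟨u, h1, h2, h3, h4⟩ := hv.exists_lower_of_upper h hM hmx hβ hx hL hi hq hs
      refine ⟨u, ⟨h1, h2, ?_⟩, (valid_piece_iff h hM hmx hβ hx hi hq h1 h2).2 ⟨hv, hs, h4⟩⟩
      revert h3; cases β u <;> cases β x <;> simp
    · rintro ⟨u, ⟨h1, h2, h3⟩, hv⟩
      obtain ⟨h4, h5, -⟩ := (valid_piece_iff h hM hmx hβ hx hi hq h1 h2).1 hv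
      exact ⟨h4, h5⟩
  rw [e1, Finset.card_biUnion]
  rintro u - v - huv
  rw [Function.onFun, Finset.disjoint_left]
  intro σ h1 h2
  rw [mem_validSet] at h1 h2
  exact huv (Skips.ins_injective (h1.skip.unique h2.skip))

open Classical in
theorem card_lower (h : G.State U U ν q β As mx) (hM : M ∈ U)
    (hmx : ∀ j ∈ U, mx j ≤ mx M) :
    (validSet G U U ν q).card =
      ∑ u with u ∈ G.placed U U ∧ q u = some M ∧ β u = true,
        (validSet G (U.erase M) U (Skips.ins ν u (G.e M)) q).card := by
  classical
  have e1 : validSet G U U ν q = (Finset.univ.filter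
      fun u => u ∈ G.placed U U ∧ q u = some M ∧ β u = true).biUnion fun u =>
        (validSet G (U.erase M) U (Skips.ins ν u (G.e M)) q) := by
    ext σ
    simp only [mem_validSet, Finset.mem_biUnion, Finset.mem_filter, Finset.mem_univ, true_and]
    constructor
    · intro hv
      obtain ⟨u, h1, h2, h3, h4⟩ := hv.exists_lower h hM hmx
      exact ⟨u, ⟨h1, h2, h3⟩, (valid_start_iff h hM h1 h2).2 ⟨hv, h4⟩⟩
    · rintro ⟨u, ⟨h1, h2, h3⟩, hv⟩
      exact ((valid_start_iff h hM h1 h2).1 hv).1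
  rw [e1, Finset.card_biUnion]
  rintro u - v - huv
  rw [Function.onFun, Finset.disjoint_left]
  intro σ h1 h2
  rw [mem_validSet] at h1 h2
  exact huv (Skips.ins_injective (h1.skip.unique h2.skip))

theorem validSet_empty (h : G.State ∅ ∅ ν q β As mx)
    (hl : ∀ y ∈ G.placed ∅ (∅ : Finset ι), G.L (ν y) = G.L (G.opp y)) :
    validSet G ∅ ∅ ν q = {ν} := by
  have hK : G.placed ∅ (∅ : Finset ι) = _root_.Set.univ := by
    ext x; simp [placed]
  ext σ
  rw [mem_validSet, Finset.mem_singleton]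
  constructor
  · intro hv
    have := hv.skip
    rwa [hK, Skips.univ_iff] at this
  · rintro rfl
    refine ⟨?_, fun x => hl x (by rw [hK]; trivial), by simp, by simp, by simp⟩
    rw [hK, Skips.univ_iff]

/-- Only the receiving piece changes. If this is a piece `i`, its lower end is placed at once, so
its number of corners is not needed again and the numbers `E` stay valid through the recursion. -/
theorem colorCard_merge (h : G.State U (insert M U) ν q β As mx) (hM : M ∉ U) {j : ι}
    (hj : j ∈ U) (hjx : q x ≠ some j) (c : Bool) :
    colorCard G U U (mergePiece q M (q x)) (mergeColor q β x (G.opp (G.e M))) j c =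
      colorCard G U (insert M U) q β j c := by
  classical
  have hjM : j ≠ M := fun hh => hM (hh ▸ hj)
  have hMU : M ∈ insert M U := Finset.mem_insert_self _ _
  have hqe : q (G.opp (G.e M)) = some M := (h.q_opp _).trans (h.q_e M hMU)
  unfold colorCard
  congr 1
  ext y
  simp only [Finset.mem_filter, Finset.mem_univ, true_and]
  rw [placed_insert hM]
  by_cases hye : y = G.opp (G.e M)
  · subst hye
    rw [mergePiece_of_eq hqe, hqe]
    simp [hjx, hjM.symm]
  · simp only [Set.mem_insert_iff, hye, false_or]
    refine and_congr_right fun hy => ?_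
    by_cases hq : q y = some j
    · rw [mergePiece_of_ne (by rw [hq]; exact fun hh => hjM (Option.some.inj hh)), mergeColor,
        if_neg hye, if_neg (by rw [hq]; exact hjx.symm)]
    · simp only [hq, false_and, iff_false, not_and]
      exact fun hh => absurd (mergePiece_eq_some hjx hh) hq

theorem colorCard_start (h : G.State U U ν q β As mx) (hM : M ∈ U) {j : ι}
    (hj : j ∈ U.erase M) (c : Bool) :
    colorCard G (U.erase M) U q (Function.update β (G.e M) true) j c =
      colorCard G U U q β j c := by
  classical
  have hjM : j ≠ M := (Finset.mem_erase.1 hj).1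
  unfold colorCard
  congr 1
  ext y
  simp only [Finset.mem_filter, Finset.mem_univ, true_and]
  rw [placed_erase]
  by_cases hye : y = G.e M
  · subst hye
    rw [h.q_e M hM]
    simp [hjM.symm]
  · simp only [Set.mem_insert_iff, hye, false_or]
    rw [Function.update_of_ne hye]

variable (G) in
/-- The expected number of completions. -/
def expected (E : ι → ℕ) (U U₁ : Finset ι) (q : Ω → Option ι) : ℤ :=
  (∏ j ∈ U, (E j : ℤ)) *
    ∏ f, faceFactor (labCard G f) (rootCard G q f) (U₁.filter fun j => G.a j = f).card

/-- A corner of the core enlarges the face `a M` by the piece `M` and its joining edge. A corner of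
a piece `i` leaves the core alone, and there are `2 E i` of these. Only the factor of the face `a M`
is affected, so `faceFactor_succ` applies to it. -/
theorem expected_step (h : G.State U (insert M U) ν q β As mx) (hM : M ∉ U)
    (hE : ∀ j ∈ U, ∀ c, colorCard G U (insert M U) q β j c = E j) :
    (rootCard G q (G.a M) : ℤ) * expected G E U U (mergePiece q M none) +
      2 * (∑ j ∈ U with G.a j = G.a M, (E j : ℤ)) * expected G E U U q =
      expected G E U (insert M U) q := by
  classical
  set f₀ := G.a M
  have hκ := h.labCard_eq hM E hE
  have hk : ((insert M U).filter fun j => G.a j = f₀).card =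
      (U.filter fun j => G.a j = f₀).card + 1 := by
    rw [Finset.filter_insert, if_pos rfl, Finset.card_insert_of_notMem (by simp [hM])]
  have hk' : ∀ f, f ≠ f₀ → ((insert M U).filter fun j => G.a j = f) =
      U.filter fun j => G.a j = f := by
    intro f hf
    rw [Finset.filter_insert, if_neg (fun hh => hf hh.symm)]
  have hy : (rootCard G (mergePiece q M none) f₀ : ℤ) = rootCard G q f₀ +
      (Finset.univ.filter fun y => q y = some M).card := by
    rw [rootCard_merge_root h, if_pos rfl]; push_cast; rfl
  have hy' : ∀ f, f ≠ f₀ → rootCard G (mergePiece q M none) f = rootCard G q f := by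
    intro f hf
    rw [rootCard_merge_root h, if_neg (fun hh => hf hh.symm), add_zero]
  have key := faceFactor_succ (labCard G f₀) (rootCard G q f₀)
    (Finset.univ.filter fun y => q y = some M).card (∑ j ∈ U with G.a j = f₀, (E j : ℤ))
    (U.filter fun j => G.a j = f₀).card ?_ ?_
  · simp only [expected]
    rw [← Finset.mul_prod_erase Finset.univ _ (Finset.mem_univ f₀),
      ← Finset.mul_prod_erase Finset.univ
        (fun f => faceFactor (labCard G f) (rootCard G q f) _) (Finset.mem_univ f₀),
      ← Finset.mul_prod_erase Finset.univ
        (fun f => faceFactor (labCard G f) (rootCard G q f)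
          (Finset.card (Finset.filter (fun j => G.a j = f) (insert M U)))) (Finset.mem_univ f₀),
      hk, ← key, hy]
    have e1 : ∏ f ∈ Finset.univ.erase f₀, faceFactor (labCard G f)
        (rootCard G (mergePiece q M none) f) (U.filter fun j => G.a j = f).card =
        ∏ f ∈ Finset.univ.erase f₀, faceFactor (labCard G f) (rootCard G q f)
          (U.filter fun j => G.a j = f).card :=
      Finset.prod_congr rfl fun f hf => by rw [hy' f (Finset.ne_of_mem_erase hf)]
    have e2 : ∏ f ∈ Finset.univ.erase f₀, faceFactor (labCard G f)
        (rootCard G q f) ((insert M U).filter fun j => G.a j = f).card =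
        ∏ f ∈ Finset.univ.erase f₀, faceFactor (labCard G f) (rootCard G q f)
          (U.filter fun j => G.a j = f).card :=
      Finset.prod_congr rfl fun f hf => by rw [hk' f (Finset.ne_of_mem_erase hf)]
    rw [e1, e2]
    ring
  · rw [hκ, Finset.sum_add_distrib, ← Finset.mul_sum]
    push_cast
    simp
    ring
  · intro hh
    rw [Finset.card_eq_zero] at hh
    rw [hh, Finset.sum_empty]

theorem card_validSet_upper (hM : M ∉ U) (h : G.State U (insert M U) ν q β As mx)
    (hmx : ∀ j ∈ U, mx j ≤ mx M) (hβ : β (G.e M) = true)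
    (hl : ∀ y ∈ G.placed U (insert M U), G.L (ν y) = G.L (G.opp y))
    (hE : ∀ j ∈ U, ∀ c, colorCard G U (insert M U) q β j c = E j)
    (ihroot : ∀ ν q β As mx, G.State U U ν q β As mx →
      (∀ y ∈ G.placed U U, G.L (ν y) = G.L (G.opp y)) →
      (∀ j ∈ U, ∀ c, colorCard G U U q β j c = E j) →
      ((validSet G U U ν q).card : ℤ) = expected G E U U q)
    (ihpiece : ∀ i ∈ U, ∀ ν q β As mx, G.State (U.erase i) U ν q β As mx →
      (∀ j ∈ U.erase i, mx j ≤ mx i) → β (G.e i) = true →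
      (∀ y ∈ G.placed (U.erase i) U, G.L (ν y) = G.L (G.opp y)) →
      (∀ j ∈ U.erase i, ∀ c, colorCard G (U.erase i) U q β j c = E j) →
      ((validSet G (U.erase i) U ν q).card : ℤ) = expected G E (U.erase i) U q) :
    ((validSet G U (insert M U) ν q).card : ℤ) = expected G E U (insert M U) q := by
  classical
  have hMU : M ∈ insert M U := Finset.mem_insert_self _ _
  have he := opp_e_notMem (G := G) (U₀ := U) hMU
  have hee : G.L (G.opp (G.opp (G.e M))) = G.L (G.opp (G.e M)) := by
    rw [G.opp_opp, G.L_opp_e, G.L_e]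
  rw [card_upper h hM, Nat.cast_sum]
  have hterm : ∀ x ∈ Finset.univ.filter (fun x => x ∈ G.placed U (insert M U) ∧ q x ≠ some M ∧
      G.L (G.opp x) = G.a M), ((Nat.card {σ // G.Valid U (insert M U) ν q σ ∧
          Skips σ (G.placed U U) (Skips.ins ν x (G.opp (G.e M)))} : ℕ) : ℤ) =
      if q x = none then expected G E U U (mergePiece q M none) else expected G E U U q := by
    intro x hx
    simp only [Finset.mem_filter, Finset.mem_univ, true_and] at hx
    obtain ⟨hx, hxM, hL⟩ := hx
    have hst := h.merge hM hmx hβ hx hxM hL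
    have hl' : ∀ y ∈ G.placed U U, G.L (Skips.ins ν x (G.opp (G.e M)) y) = G.L (G.opp y) := by
      have := lab_ins h.fix he hl hx (hL.trans (G.L_opp_e M).symm) hee
      rwa [← placed_insert hM] at this
    split_ifs with hq
    · rw [card_upper_root h hM hmx hβ hx hq, ihroot _ _ _ _ _ hst hl', hq]
      intro j hj c
      rw [colorCard_merge h hM hj (by rw [hq]; exact (Option.some_ne_none _).symm), hE j hj]
    · obtain ⟨i, hi⟩ := Option.ne_none_iff_exists'.1 hq
      have hiU : i ∈ U := by
        rcases Finset.mem_insert.1 (h.q_some x i hi).1 with rfl | hiU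
        · exact absurd hi hxM
        · exact hiU
      rw [card_upper_piece h hM hmx hβ hx hL hiU hi, Nat.cast_sum]
      rw [Finset.sum_congr rfl (g := fun _ => expected G E (U.erase i) U (mergePiece q M (q x)))]
      · rw [Finset.sum_const]
        -- The `E i` choices of `u` restore the factor missing from the product over `U.erase i`.
        -- Hence the contribution of `x` is independent of the piece it lies on.
        have : (Finset.univ.filter fun u => u ∈ G.placed U (insert M U) ∧ q u = some i ∧
            β u = !β x).card = E i := by
          rw [← hE i hiU (!β x), colorCard]
        rw [this, expected, expected, ← Finset.mul_prod_erase U _ hiU, hi]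
        simp only [rootCard_merge_piece]
        rw [nsmul_eq_mul, mul_assoc]
      · intro u hu
        simp only [Finset.mem_filter, Finset.mem_univ, true_and] at hu
        obtain ⟨hu, hqu, hβu⟩ := hu
        have hue : u ≠ G.opp (G.e M) := ne_of_mem_of_not_mem hu he
        have huU : u ∈ G.placed U U := by rw [placed_insert hM]; exact Or.inr hu
        have hiM : i ≠ M := fun hh => hM (hh ▸ hiU)
        have hqu' : mergePiece q M (q x) u = some i := by
          rw [mergePiece_of_ne (by rw [hqu]; exact fun hh => hiM (Option.some.inj hh)), hqu]
        have hcu : mergeColor q β x (G.opp (G.e M)) u = true := by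
          rw [mergeColor, if_neg hue, if_pos (hqu.trans hi.symm), hβu]
          cases β x <;> rfl
        have hst' := hst.start hiU huU hqu' hcu
        refine ihpiece i hiU _ _ _ _ _ hst' ?_ (Function.update_self _ _ _) ?_ ?_
        · intro j hj
          simp only [hi, if_true]
          split_ifs
          · exact le_rfl
          · exact hmx j (Finset.mem_of_mem_erase hj)
        · have := lab_ins (x := u) hst.fix (e_notMem hiU) hl' huU ?_ ?_
          · rwa [← placed_erase] at this
          · rw [G.L_e]
            exact (h.q_some _ i ((h.q_opp u).trans hqu)).2
          · rw [G.L_opp_e, G.L_e]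
        · intro j hj c
          have hj' := Finset.mem_of_mem_erase hj
          rw [colorCard_start hst hiU hj, colorCard_merge h hM hj', hE j hj']
          rw [hi]
          exact fun hh => (Finset.mem_erase.1 hj).1 (Option.some.inj hh).symm
  rw [Finset.sum_congr rfl hterm, Finset.sum_ite, Finset.sum_const, Finset.sum_const,
    ← expected_step h hM hE, nsmul_eq_mul, nsmul_eq_mul]
  congr 2
  · rw [← card_root_corners h]
    congr 2
    ext y
    simp only [Finset.mem_filter, Finset.mem_univ, true_and]
    constructor
    · rintro ⟨⟨-, -, h1⟩, h2⟩; exact ⟨h2, h1⟩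
    · rintro ⟨h1, h2⟩
      exact ⟨⟨h.placed_of_q_eq_none h1, by rw [h1]; exact (Option.some_ne_none _).symm, h2⟩, h1⟩
  · rw [Finset.card_eq_sum_card_fiberwise (f := q)
      (t := (U.filter fun j => G.a j = G.a M).map Function.Embedding.some)]
    · rw [Finset.sum_map, Nat.cast_sum, Finset.mul_sum]
      refine Finset.sum_congr rfl fun j hj => ?_
      rw [Finset.mem_filter] at hj
      have hjM : j ≠ M := fun hh => hM (hh ▸ hj.1)
      -- An upper end may be attached to vertices of either colour.
      have e1 : (2 * E j : ℤ) = ((colorCard G U (insert M U) q β j true +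
          colorCard G U (insert M U) q β j false : ℕ) : ℤ) := by
        rw [hE j hj.1, hE j hj.1]; push_cast; ring
      rw [e1, colorCard, colorCard, ← Finset.card_union_of_disjoint]
      · congr 2
        ext y
        simp only [Finset.mem_filter, Finset.mem_univ, true_and, Finset.mem_union,
          Function.Embedding.some_apply]
        constructor
        · rintro ⟨⟨⟨h1, -, -⟩, -⟩, h2⟩
          cases hb : β y
          · exact Or.inr ⟨h1, h2, rfl⟩
          · exact Or.inl ⟨h1, h2, rfl⟩
        · have aux : y ∈ G.placed U (insert M U) → q y = some j →
              ((y ∈ G.placed U (insert M U) ∧ q y ≠ some M ∧ G.L (G.opp y) = G.a M) ∧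
                ¬ q y = none) ∧ q y = some j := by
            intro h1 h2
            refine ⟨⟨⟨h1, ?_, ?_⟩, ?_⟩, h2⟩
            · rw [h2]; exact fun hh => hjM (Option.some.inj hh)
            · rw [(h.q_some _ j ((h.q_opp y).trans h2)).2, hj.2]
            · rw [h2]; exact Option.some_ne_none _
          rintro (⟨h1, h2, -⟩ | ⟨h1, h2, -⟩)
          · exact aux h1 h2
          · exact aux h1 h2
      · rw [Finset.disjoint_filter]
        rintro y - ⟨-, -, h1⟩ ⟨-, -, h2⟩
        rw [h1] at h2; exact Bool.noConfusion h2
    · intro y hy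
      simp only [Finset.coe_filter, Finset.mem_filter, Finset.mem_univ, true_and,
        Set.mem_ofPred_eq] at hy
      obtain ⟨⟨h1, h2, h3⟩, h4⟩ := hy
      obtain ⟨i, hi⟩ := Option.ne_none_iff_exists'.1 h4
      obtain ⟨h5, h6⟩ := h.q_some _ i ((h.q_opp y).trans hi)
      simp only [Finset.coe_map, Set.mem_image, Finset.mem_coe, Finset.mem_filter]
      refine ⟨i, ⟨?_, h6.symm.trans h3⟩, hi.symm⟩
      rcases Finset.mem_insert.1 h5 with rfl | h5
      · exact absurd hi h2
      · exact h5

/-- The sign rule leaves the `E M` corners of colour `true`, and the expected count after the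
placement depends on none of them. -/
theorem card_validSet_lower (h : G.State U U ν q β As mx) (hM : M ∈ U)
    (hmx : ∀ j ∈ U, mx j ≤ mx M)
    (hl : ∀ y ∈ G.placed U U, G.L (ν y) = G.L (G.opp y))
    (hE : ∀ j ∈ U, ∀ c, colorCard G U U q β j c = E j)
    (ih : ∀ ν q β As mx, G.State (U.erase M) U ν q β As mx →
      (∀ j ∈ U.erase M, mx j ≤ mx M) → β (G.e M) = true →
      (∀ y ∈ G.placed (U.erase M) U, G.L (ν y) = G.L (G.opp y)) →
      (∀ j ∈ U.erase M, ∀ c, colorCard G (U.erase M) U q β j c = E j) →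
      ((validSet G (U.erase M) U ν q).card : ℤ) = expected G E (U.erase M) U q) :
    ((validSet G U U ν q).card : ℤ) = expected G E U U q := by
  classical
  rw [card_lower h hM hmx, Nat.cast_sum,
    Finset.sum_congr rfl (g := fun _ => expected G E (U.erase M) U q)]
  · rw [Finset.sum_const]
    have : (Finset.univ.filter fun u => u ∈ G.placed U U ∧ q u = some M ∧
        β u = true).card = E M := by
      rw [← hE M hM true, colorCard]
    rw [this, expected, expected, ← Finset.mul_prod_erase U _ hM, nsmul_eq_mul, mul_assoc]
  · intro u hu
    simp only [Finset.mem_filter, Finset.mem_univ, true_and] at hu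
    obtain ⟨hu, hqu, hβu⟩ := hu
    refine ih _ _ _ _ _ (h.start hM hu hqu hβu)
      (fun j hj => hmx j (Finset.mem_of_mem_erase hj)) (Function.update_self _ _ _) ?_ ?_
    · have := lab_ins (x := u) h.fix (e_notMem hM) hl hu ?_ ?_
      · rwa [← placed_erase] at this
      · rw [G.L_e]
        exact (h.q_some _ M ((h.q_opp u).trans hqu)).2
      · rw [G.L_opp_e, G.L_e]
    · intro j hj c
      rw [colorCard_start h hM hj, hE j (Finset.mem_of_mem_erase hj)]

/-- The number of ways to glue the pieces. -/
theorem card_validSet (h : G.State U U ν q β As mx)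
    (hl : ∀ y ∈ G.placed U U, G.L (ν y) = G.L (G.opp y))
    (hE : ∀ j ∈ U, ∀ c, colorCard G U U q β j c = E j) :
    ((validSet G U U ν q).card : ℤ) = expected G E U U q := by
  classical
  -- Two statements in one induction: either all remaining edges are untouched, or the lower end of
  -- `M` is placed and its upper end is pending. For `n + 1` the first follows from the second for
  -- `n`; the second for `n + 1` follows from the first for `n + 1` (attachment to the core) and the
  -- second for `n` (attachment to a piece).
  have main : ∀ n : ℕ, (∀ U ν q β As mx, U.card = n → G.State U U ν q β As mx →
      (∀ y ∈ G.placed U U, G.L (ν y) = G.L (G.opp y)) →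
      (∀ j ∈ U, ∀ c, colorCard G U U q β j c = E j) →
      ((validSet G U U ν q).card : ℤ) = expected G E U U q) ∧
    (∀ U U₁ M ν q β As mx, U₁ = insert M U → U.card = n → M ∉ U → G.State U U₁ ν q β As mx →
      (∀ j ∈ U, mx j ≤ mx M) → β (G.e M) = true →
      (∀ y ∈ G.placed U U₁, G.L (ν y) = G.L (G.opp y)) →
      (∀ j ∈ U, ∀ c, colorCard G U U₁ q β j c = E j) →
      ((validSet G U U₁ ν q).card : ℤ) = expected G E U U₁ q) := by
    intro n
    induction n with
    | zero =>
      have h0 : ∀ U ν q β As mx, U.card = 0 → G.State U U ν q β As mx →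
          (∀ y ∈ G.placed U U, G.L (ν y) = G.L (G.opp y)) →
          (∀ j ∈ U, ∀ c, colorCard G U U q β j c = E j) →
          ((validSet G U U ν q).card : ℤ) = expected G E U U q := by
        intro U ν q β As mx hU h hl hE
        obtain rfl := Finset.card_eq_zero.1 hU
        rw [validSet_empty h hl]
        simp [expected, faceFactor]
      refine ⟨h0, ?_⟩
      rintro U _ M ν q β As mx rfl hU hM h hmx hβ hl hE
      refine card_validSet_upper hM h hmx hβ hl hE
        (fun ν q β As mx h1 h2 h3 => h0 U ν q β As mx hU h1 h2 h3) ?_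
      obtain rfl := Finset.card_eq_zero.1 hU
      simp
    | succ n ih =>
      have h1 : ∀ U i, U.card = n + 1 → i ∈ U → ∀ ν q β As mx, G.State (U.erase i) U ν q β As mx →
          (∀ j ∈ U.erase i, mx j ≤ mx i) → β (G.e i) = true →
          (∀ y ∈ G.placed (U.erase i) U, G.L (ν y) = G.L (G.opp y)) →
          (∀ j ∈ U.erase i, ∀ c, colorCard G (U.erase i) U q β j c = E j) →
          ((validSet G (U.erase i) U ν q).card : ℤ) = expected G E (U.erase i) U q := by
        intro U i hU hi ν q β As mx h hmx hβ hl hE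
        exact ih.2 _ _ i _ _ _ _ _ (Finset.insert_erase hi).symm
          (by rw [Finset.card_erase_of_mem hi, hU]; rfl) (Finset.notMem_erase i U) h hmx hβ hl hE
      have h2 : ∀ U ν q β As mx, U.card = n + 1 → G.State U U ν q β As mx →
          (∀ y ∈ G.placed U U, G.L (ν y) = G.L (G.opp y)) →
          (∀ j ∈ U, ∀ c, colorCard G U U q β j c = E j) →
          ((validSet G U U ν q).card : ℤ) = expected G E U U q := by
        intro U ν q β As mx hU h hl hE
        obtain ⟨M, hM, hmx⟩ := Finset.exists_max_image U mx
          (Finset.card_pos.1 (by omega))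
        exact card_validSet_lower h hM hmx hl hE (h1 U M hU hM)
      refine ⟨h2, ?_⟩
      rintro U _ M ν q β As mx rfl hU hM h hmx hβ hl hE
      exact card_validSet_upper hM h hmx hβ hl hE
        (fun ν q β As mx h3 h4 h5 => h2 U ν q β As mx hU h3 h4 h5)
        (fun i hi => h1 U i hU hi)
  exact (main U.card).1 U ν q β As mx rfl h hl hE

end Gluing

/-! ### The gluing problem of the degeneration data. -/

theorem RibbonGraph.vert_next {V H : Type*} (G : RibbonGraph V H) (h : H) :
    G.vert (G.next h) = G.vert h :=
  (G.vert_eq_iff _ _).2 (sameCycle_apply_left.2 (SameCycle.refl _ _))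

/-- A closed set of half-edges is everything. -/
theorem RibbonGraph.mem_of_closed {V H : Type*} (G : RibbonGraph V H) {T : Set H}
    (h1 : ∀ x ∈ T, G.next x ∈ T) (h2 : ∀ x ∈ T, G.opp x ∈ T) {x : H} (hx : x ∈ T) (y : H) :
    y ∈ T := by
  have := G.connected x y
  induction this with
  | refl => exact hx
  | tail _ hbc ih =>
    rcases hbc with rfl | rfl
    · exact h1 _ ih
    · exact h2 _ ih

namespace DegenPieces

variable {n p ℓ m : ℕ} {P : WallPartition n p} {κ : Fin ℓ → ℕ} {D : DegenIndex p ℓ m}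

/-- The index of a non-core piece. -/
def toOpt : Fin (m + 1) → Option (Fin m) := Fin.cases none some

@[simp] theorem toOpt_zero : toOpt (0 : Fin (m + 1)) = none := rfl

@[simp] theorem toOpt_succ (j : Fin m) : toOpt j.succ = some j := rfl

theorem toOpt_injective : Function.Injective (toOpt : Fin (m + 1) → Option (Fin m)) := by
  intro i k
  cases i using Fin.cases <;> cases k using Fin.cases <;> simp

theorem toOpt_eq_none {i : Fin (m + 1)} : toOpt i = none ↔ i = 0 :=
  ⟨fun h => toOpt_injective (h.trans toOpt_zero.symm), fun h => h ▸ rfl⟩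

theorem toOpt_eq_some {i : Fin (m + 1)} {j : Fin m} : toOpt i = some j ↔ i = j.succ :=
  ⟨fun h => toOpt_injective (h.trans (toOpt_succ j).symm), fun h => h ▸ rfl⟩

open Classical in
variable (P D) in
/-- The piece of a vertex label. -/
noncomputable def labelPiece (v : Fin n) : Fin (m + 1) :=
  if h : ∃ s e, v ∈ P.I s e then D.A h.choose else 0

theorem wall_index_unique {v : Fin n} {s s' : Fin p} {e e' : Bool} (h : v ∈ P.I s e)
    (h' : v ∈ P.I s' e') : s = s' ∧ e = e' := by
  by_contra hne
  refine (Finset.disjoint_left.1 (P.disjoint s e s' e' fun hh => hne ?_)) h h'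
  exact ⟨congrArg Prod.fst hh, congrArg Prod.snd hh⟩

theorem labelPiece_of_mem {v : Fin n} {s : Fin p} {e : Bool} (h : v ∈ P.I s e) :
    labelPiece P D v = D.A s := by
  have hh : ∃ s e, v ∈ P.I s e := ⟨s, e, h⟩
  rw [labelPiece, dif_pos hh]
  obtain ⟨e', he'⟩ := hh.choose_spec
  rw [(wall_index_unique he' h).1]

theorem labelPiece_of_mem_zero {v : Fin n} (h : v ∈ P.I₀) : labelPiece P D v = 0 := by
  rw [labelPiece, dif_neg]
  rintro ⟨s, e, hs⟩
  exact Finset.disjoint_left.1 (P.disjoint₀ s e) h hs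

theorem mem_black {v : Fin n} {i : Fin (m + 1)} :
    v ∈ D.black P i ↔ ∃ s, D.A s = i ∧ v ∈ P.I s (D.ε s) := by
  simp [DegenIndex.black]

theorem mem_white {v : Fin n} {i : Fin (m + 1)} :
    v ∈ D.white P i ↔ ∃ s, D.A s = i ∧ v ∈ P.I s (!D.ε s) := by
  simp [DegenIndex.white]

theorem mem_black_or_white {v : Fin n} {i : Fin (m + 1)} :
    (v ∈ D.black P i ∨ v ∈ D.white P i) ↔ ∃ s e, D.A s = i ∧ v ∈ P.I s e := by
  rw [mem_black, mem_white]
  constructor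
  · rintro (⟨s, h1, h2⟩ | ⟨s, h1, h2⟩)
    · exact ⟨s, _, h1, h2⟩
    · exact ⟨s, _, h1, h2⟩
  · rintro ⟨s, e, h1, h2⟩
    by_cases he : e = D.ε s
    · exact Or.inl ⟨s, h1, he ▸ h2⟩
    · exact Or.inr ⟨s, h1, (Bool.eq_not_of_ne he) ▸ h2⟩

theorem disjoint_black_white (i : Fin (m + 1)) : Disjoint (D.black P i) (D.white P i) := by
  rw [Finset.disjoint_left]
  intro v h1 h2
  obtain ⟨s, -, hs⟩ := mem_black.1 h1
  obtain ⟨s', -, hs'⟩ := mem_white.1 h2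
  obtain ⟨rfl, h⟩ := wall_index_unique hs hs'
  simp at h

variable (Q : DegenPieces P κ D)

theorem mem_range_vert {i : Fin (m + 1)} {v : Fin n} :
    v ∈ Set.range (Q.G i).vert ↔ labelPiece P D v = i := by
  have key : labelPiece P D v = i ↔
      ((i = 0 ∧ v ∈ P.I₀) ∨ v ∈ D.black P i ∨ v ∈ D.white P i) := by
    constructor
    · rintro rfl
      rcases P.cover v with h | ⟨s, e, h⟩
      · exact Or.inl ⟨labelPiece_of_mem_zero h, h⟩
      · exact Or.inr (mem_black_or_white.2 ⟨s, e, (labelPiece_of_mem h).symm, h⟩)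
    · rintro (⟨rfl, h⟩ | h)
      · exact labelPiece_of_mem_zero h
      · obtain ⟨s, e, h1, h2⟩ := mem_black_or_white.1 h
        rw [labelPiece_of_mem h2, h1]
  rw [key]
  cases i using Fin.cases with
  | zero =>
    rw [Q.labels₀]
    simp
  | succ j =>
    rw [Q.labels]
    simp [Fin.succ_ne_zero]

theorem labelPiece_vert {i : Fin (m + 1)} (h : Q.H i) : labelPiece P D ((Q.G i).vert h) = i :=
  Q.mem_range_vert.1 ⟨h, rfl⟩

theorem exists_vert (v : Fin n) : ∃ h : Q.H (labelPiece P D v), (Q.G _).vert h = v :=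
  Q.mem_range_vert.2 rfl

/-- The half-edges of the pieces, and those of the edges that join them: `(j, false)` is the
end of the `j`-th joining edge at the piece `j`, and `(j, true)` is its other end. -/
abbrev Om : Type := (Σ i, Q.H i) ⊕ (Fin m × Bool)

/-- The involution. -/
def oppFun : Q.Om → Q.Om :=
  Sum.map (fun x => ⟨x.1, (Q.G x.1).opp x.2⟩) (fun x => (x.1, !x.2))

/-- The rotation of the disjoint union of the pieces. -/
def nextOld : Equiv.Perm Q.Om :=
  Equiv.sumCongr (Equiv.sigmaCongrRight fun i => (Q.G i).next) (Equiv.refl _)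

/-- The face label of a half-edge of a piece. -/
def faceOld : (i : Fin (m + 1)) → Q.H i → Fin ℓ := Fin.cases Q.F₀ (fun j _ => D.a j)

/-- The face labels. -/
def faceFun : Q.Om → Fin ℓ := Sum.elim (fun x => Q.faceOld x.1 x.2) (fun x => D.a x.1)

/-- The piece of a half-edge; joining edges are attributed to their lower piece. -/
def pieceFun : Q.Om → Option (Fin m) := Sum.elim (fun x => toOpt x.1) (fun x => some x.1)

theorem oppFun_oppFun (x : Q.Om) : Q.oppFun (Q.oppFun x) = x := by
  rcases x with ⟨i, h⟩ | ⟨j, b⟩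
  · simp [oppFun, (Q.G i).opp_opp]
  · simp [oppFun]

/-- The gluing problem of the degeneration data. -/
def gluing : Gluing Q.Om (Fin m) (Fin p) (Fin ℓ) where
  opp := Q.oppFun
  e j := Sum.inr (j, false)
  L := Q.faceFun
  a := D.a
  core := {x | ∃ h, x = Sum.inl ⟨0, h⟩}
  Z s := {x | ∃ i h, x = Sum.inl ⟨i, h⟩ ∧ (Q.G i).vert h ∈ P.I s false}
  opp_opp := Q.oppFun_oppFun
  e_injective i j h := by simpa using h
  e_ne i j h := by simp [oppFun] at h
  L_e j := rfl
  L_opp_e j := rfl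
  core_nonempty := by
    obtain ⟨h⟩ := (Q.G 0).nonempty
    exact ⟨_, h, rfl⟩
  Z_nonempty s := by
    obtain ⟨v, hv⟩ := P.nonempty s false
    obtain ⟨h, hh⟩ := Q.exists_vert v
    exact ⟨_, _, h, rfl, hh.symm ▸ hv⟩

theorem mem_placed {x : Q.Om} :
    x ∈ Q.gluing.placed Finset.univ Finset.univ ↔ ∃ i h, x = Sum.inl ⟨i, h⟩ := by
  rcases x with ⟨i, h⟩ | ⟨j, b⟩
  · simp [Gluing.placed, gluing, oppFun]
  · cases b <;> simp [Gluing.placed, gluing, oppFun]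

theorem exists_max_index (j : Fin m) : ∃ s, D.A s = j.succ ∧ ∀ s', D.A s' = j.succ → s' ≤ s := by
  obtain ⟨s, hs⟩ := D.A_nonempty j
  obtain ⟨t, ht, hmax⟩ := Finset.exists_max_image (Finset.univ.filter fun s => D.A s = j.succ) id
    ⟨s, by simpa using hs⟩
  exact ⟨t, by simpa using ht, fun s' hs' => hmax s' (by simpa using hs')⟩

variable (D) in
/-- The highest index of a wall equation of the piece `j`. -/
noncomputable def maxIndex (j : Fin m) : Fin p := (exists_max_index (D := D) j).choose

theorem A_maxIndex (j : Fin m) : D.A (maxIndex D j) = j.succ :=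
  (exists_max_index (D := D) j).choose_spec.1

theorem le_maxIndex (j : Fin m) (s : Fin p) (hs : D.A s = j.succ) : s ≤ maxIndex D j :=
  (exists_max_index (D := D) j).choose_spec.2 s hs

/-- The colouring of the bipartite pieces. -/
noncomputable def colorOld : (i : Fin (m + 1)) → Q.H i → Bool :=
  Fin.cases (fun _ => false) fun j h =>
    xor (decide ((Q.G j.succ).vert h ∈ D.black P j.succ)) (D.ε (maxIndex D j))

theorem mem_black_opp {j : Fin m} (h : Q.H j.succ) :
    (Q.G j.succ).vert ((Q.G j.succ).opp h) ∈ D.black P j.succ ↔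
      ¬ (Q.G j.succ).vert h ∈ D.black P j.succ := by
  rw [Q.bipartite j h]
  have h1 : (Q.G j.succ).vert ((Q.G j.succ).opp h) ∈ Set.range (Q.G j.succ).vert := ⟨_, rfl⟩
  rw [Q.labels] at h1
  simp only [Finset.coe_union, Set.mem_union, Finset.mem_coe] at h1
  have h2 : (Q.G j.succ).vert ((Q.G j.succ).opp h) ∈ D.black P j.succ →
      (Q.G j.succ).vert ((Q.G j.succ).opp h) ∉ D.white P j.succ :=
    fun hh => Finset.disjoint_left.1 (disjoint_black_white j.succ) hh
  tauto

theorem initialState : Q.gluing.State Finset.univ Finset.univ Q.nextOld Q.pieceFun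
    (Sum.elim (fun x => Q.colorOld x.1 x.2) fun _ => false) (fun s => toOpt (D.A s))
    (maxIndex D) := by
  constructor
  · exact subset_rfl
  · intro x hx
    rw [mem_placed] at hx
    rcases x with ⟨i, h⟩ | x
    · exact absurd ⟨i, h, rfl⟩ hx
    · rfl
  · rintro (x | x) <;> rfl
  · rintro (x | x) <;> rfl
  · intro j _; rfl
  · rintro (⟨i, h⟩ | ⟨k, b⟩) j hj
    · have : i = j.succ := toOpt_eq_some.1 hj
      subst this
      exact ⟨Finset.mem_univ _, rfl⟩
    · have : k = j := Option.some.inj hj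
      subst this
      exact ⟨Finset.mem_univ _, rfl⟩
  · rintro x ⟨h, rfl⟩; rfl
  · rintro x ⟨h, rfl⟩
    exact Q.mem_placed.2 ⟨0, h, rfl⟩
  · intro T h1 h2 x hx y hy hxy hxT
    obtain ⟨i, h, rfl⟩ := Q.mem_placed.1 hx
    obtain ⟨k, h', rfl⟩ := Q.mem_placed.1 hy
    have : i = k := toOpt_injective hxy
    subst this
    refine (Q.G i).mem_of_closed (T := {z | (Sum.inl ⟨i, z⟩ : Q.Om) ∈ T}) ?_ ?_ hxT h'
    · intro z hz
      exact h1 _ (Q.mem_placed.2 ⟨_, _, rfl⟩) hz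
    · intro z hz
      exact h2 _ (Q.mem_placed.2 ⟨_, _, rfl⟩) (Q.mem_placed.2 ⟨_, _, rfl⟩) hz
  · rintro (⟨i, h⟩ | x) hx
    · cases i using Fin.cases with
      | zero => exact absurd rfl hx
      | succ j =>
        change xor (decide ((Q.G j.succ).vert ((Q.G j.succ).next h) ∈ D.black P j.succ)) _ =
          xor (decide ((Q.G j.succ).vert h ∈ D.black P j.succ)) _
        rw [RibbonGraph.vert_next]
    · rfl
  · rintro x hx - hq
    obtain ⟨i, h, rfl⟩ := Q.mem_placed.1 hx
    cases i using Fin.cases with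
    | zero => exact absurd rfl hq
    | succ j =>
      change xor (decide ((Q.G j.succ).vert ((Q.G j.succ).opp h) ∈ D.black P j.succ)) _ =
          !xor (decide ((Q.G j.succ).vert h ∈ D.black P j.succ)) _
      simp only [Q.mem_black_opp h, decide_not]
      simp
  · rintro s z ⟨i, h, rfl, hv⟩
    refine ⟨Q.mem_placed.2 ⟨_, _, rfl⟩, ?_⟩
    change toOpt i = toOpt (D.A s)
    rw [← Q.labelPiece_vert h, labelPiece_of_mem hv]
  · intro j _
    rw [A_maxIndex]; rfl
  · intro j _ s hs
    exact le_maxIndex j s (toOpt_eq_some.1 hs)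
  · rintro j - z ⟨i, h, rfl, hv⟩
    have : i = j.succ := by
      rw [← Q.labelPiece_vert h, labelPiece_of_mem hv, A_maxIndex]
    subst this
    change xor (decide ((Q.G j.succ).vert h ∈ D.black P j.succ)) (D.ε (maxIndex D j)) = true
    -- The labels in `I⁰` of the highest equation are black exactly if `ε` is 0 there. The twist by
    -- `ε` in `colorOld` thus gives them the colour `true` in all cases.
    have h1 : (Q.G j.succ).vert h ∈ D.black P j.succ ↔ D.ε (maxIndex D j) = false := by
      rw [mem_black]
      constructor
      · rintro ⟨s, -, hs⟩
        obtain ⟨rfl, h2⟩ := wall_index_unique hv hs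
        exact h2.symm
      · intro hh
        exact ⟨_, A_maxIndex j, hh.symm ▸ hv⟩
    simp only [h1]
    cases D.ε (maxIndex D j) <;> rfl

theorem initial_lab (x : Q.Om) (hx : x ∈ Q.gluing.placed Finset.univ Finset.univ) :
    Q.gluing.L (Q.nextOld x) = Q.gluing.L (Q.gluing.opp x) := by
  obtain ⟨i, h, rfl⟩ := Q.mem_placed.1 hx
  cases i using Fin.cases with
  | zero =>
    change Q.F₀ ((Q.G 0).next h) = Q.F₀ ((Q.G 0).opp h)
    refine ((Q.isFaceLabelling₀ _ _).2 ?_).symm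
    refine ⟨1, ?_⟩
    simp [RibbonGraph.face, (Q.G 0).opp_opp]
  | succ j => rfl

end DegenPieces

/-! ### The number of valid rotations is the coefficient `C`. -/

theorem doubleFactorial_eq_mul_prod (κ k : ℕ) (hk : 2 * (k + 1) + 1 ≤ κ) :
    ((κ - 2)‼ : ℕ) = (κ - 2 * (k + 1))‼ * ∏ r ∈ Finset.range k, (κ - 2 * (r + 1)) := by
  induction k with
  | zero => simp
  | succ k ih =>
    rw [ih (by omega), Finset.prod_range_succ]
    have : κ - 2 * (k + 1) = (κ - 2 * (k + 1 + 1)) + 2 := by omega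
    rw [this, Nat.doubleFactorial_add_two]
    ring

/-- For `k = 0` nothing is glued into the face, and `κ (κ - 2)‼ = κ‼`; if `κ = 1`, truncated
subtraction supplies `0‼ = 1`. For `k ≥ 1` the product telescopes. -/
theorem faceFactor_eq_doubleFactorial (κ y k : ℕ) (hκ : Odd κ) (h0 : k = 0 → κ = y)
    (hk : 2 * k + 1 ≤ κ) :
    ((Gluing.faceFactor κ y k : ℤ) : ℚ) = (y : ℚ) * ((κ - 2)‼ : ℕ) / ((κ - 2 * k)‼ : ℕ) := by
  have hne : ∀ a : ℕ, ((a‼ : ℕ) : ℚ) ≠ 0 := fun a => by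
    exact_mod_cast (Nat.doubleFactorial_pos a).ne'
  cases k with
  | zero =>
    rw [← h0 rfl]
    simp only [Gluing.faceFactor, Int.cast_one, mul_zero, Nat.sub_zero]
    rw [eq_comm, div_eq_one_iff_eq (hne _)]
    obtain ⟨c, rfl⟩ := hκ
    cases c with
    | zero => simp
    | succ c =>
      rw [show 2 * (c + 1) + 1 = (2 * c + 1) + 2 by ring, Nat.doubleFactorial_add_two]
      simp
  | succ k =>
    rw [doubleFactorial_eq_mul_prod κ k (by omega), eq_div_iff (hne _)]
    simp only [Gluing.faceFactor]
    push_cast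
    have : ∀ r ∈ Finset.range k, ((κ - 2 * (r + 1) : ℕ) : ℚ) = (κ : ℚ) - 2 * ((r : ℚ) + 1) := by
      intro r hr
      rw [Finset.mem_range] at hr
      rw [Nat.cast_sub (by omega)]
      push_cast; ring
    rw [Finset.prod_congr rfl this]
    ring

namespace DegenPieces

variable {n p ℓ m : ℕ} {P : WallPartition n p} {κ : Fin ℓ → ℕ} {D : DegenIndex p ℓ m}
variable (Q : DegenPieces P κ D)

instance (i : Fin (m + 1)) : Finite (Q.H i) := Q.finite i

noncomputable instance (i : Fin (m + 1)) : Fintype (Q.H i) := Fintype.ofFinite _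

/-- The number of edges of the one-faced pieces. -/
noncomputable def edges (j : Fin m) : ℕ := Nat.card {h : Q.H j.succ // Q.colorOld j.succ h = true}

theorem colorOld_opp {j : Fin m} (h : Q.H j.succ) :
    Q.colorOld j.succ ((Q.G j.succ).opp h) = !Q.colorOld j.succ h := by
  change xor (decide ((Q.G j.succ).vert ((Q.G j.succ).opp h) ∈ D.black P j.succ)) _ =
    !xor (decide ((Q.G j.succ).vert h ∈ D.black P j.succ)) _
  simp only [Q.mem_black_opp h, decide_not]
  simp

/-- Each edge of a bipartite piece has one half of each colour. -/
theorem card_colorOld (j : Fin m) (c : Bool) :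
    Nat.card {h : Q.H j.succ // Q.colorOld j.succ h = c} = Q.edges j := by
  cases c with
  | true => rfl
  | false =>
    refine Nat.card_congr (Equiv.subtypeEquiv (Q.G j.succ).opp fun h => ?_)
    rw [colorOld_opp]
    cases Q.colorOld j.succ h <;> simp

theorem card_H_succ (j : Fin m) : Nat.card (Q.H j.succ) = 2 * Q.edges j := by
  classical
  have e := Nat.card_congr (Equiv.sumCompl fun h : Q.H j.succ => Q.colorOld j.succ h = true)
  rw [Nat.card_sum, Q.card_colorOld j true] at e
  have : Nat.card {h : Q.H j.succ // ¬ Q.colorOld j.succ h = true} = Q.edges j := by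
    simp only [Bool.not_eq_true]
    exact Q.card_colorOld j false
  rw [← e, this]; ring

/-- Euler's relation with a single face. -/
theorem edges_eq (j : Fin m) : (Q.edges j : ℤ) =
    2 * (D.g j.succ : ℤ) - 1 + ((D.black P j.succ).card : ℤ) + ((D.white P j.succ).card : ℤ) := by
  have h := Q.genus j.succ
  unfold RibbonGraph.HasGenus at h
  rw [Q.labels, Set.ncard_coe_finset, Finset.card_union_of_disjoint (disjoint_black_white _),
    Q.card_H_succ, Nat.mul_div_cancel_left _ two_pos] at h
  have h1 : Nat.card (Quotient (Equiv.Perm.SameCycle.setoid (Q.G j.succ).face)) = 1 := by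
    rw [Nat.card_eq_one_iff_unique]
    refine ⟨⟨fun a b => ?_⟩, ?_⟩
    · induction a, b using Quotient.inductionOn₂ with
      | _ a b => exact Quotient.sound (Q.oneFace j a b)
    · obtain ⟨x⟩ := (Q.G j.succ).nonempty
      exact ⟨Quotient.mk _ x⟩
  rw [h1] at h
  push_cast at h
  linarith

theorem colorCard_eq (j : Fin m) (c : Bool) :
    Gluing.colorCard Q.gluing Finset.univ Finset.univ Q.pieceFun
      (Sum.elim (fun x => Q.colorOld x.1 x.2) fun _ => false) j c = Q.edges j := by
  classical
  rw [Gluing.colorCard, ← Q.card_colorOld j c, Nat.card_eq_fintype_card, Fintype.card_subtype]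
  symm
  refine Finset.card_bij (fun h _ => Sum.inl ⟨j.succ, h⟩) ?_ ?_ ?_
  · intro h hh
    simp only [Finset.mem_filter, Finset.mem_univ, true_and] at hh ⊢
    exact ⟨Q.mem_placed.2 ⟨_, _, rfl⟩, rfl, hh⟩
  · intro h _ h' _ hh
    simpa using hh
  · intro x hx
    simp only [Finset.mem_filter, Finset.mem_univ, true_and] at hx
    obtain ⟨h1, h2, h3⟩ := hx
    obtain ⟨i, h, rfl⟩ := Q.mem_placed.1 h1
    have : i = j.succ := toOpt_eq_some.1 h2
    subst this
    exact ⟨h, by simpa using h3, rfl⟩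

/-- The degree of a face of the core. -/
noncomputable def degOld (f : Fin ℓ) : ℕ := Nat.card {h // Q.F₀ h = f}

theorem rootCard_eq (f : Fin ℓ) : Gluing.rootCard Q.gluing Q.pieceFun f = Q.degOld f := by
  classical
  rw [Gluing.rootCard, degOld, Nat.card_eq_fintype_card, Fintype.card_subtype]
  symm
  refine Finset.card_bij (fun h _ => Sum.inl ⟨0, h⟩) ?_ ?_ ?_
  · intro h hh
    simp only [Finset.mem_filter, Finset.mem_univ, true_and] at hh ⊢
    exact ⟨rfl, hh⟩
  · intro h _ h' _ hh
    simpa using hh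
  · rintro (⟨i, h⟩ | x) hx
    · simp only [Finset.mem_filter, Finset.mem_univ, true_and] at hx
      have : i = 0 := toOpt_eq_none.1 hx.1
      subst this
      exact ⟨h, Finset.mem_filter.2 ⟨Finset.mem_univ _, hx.2⟩, rfl⟩
    · simp only [Finset.mem_filter, Finset.mem_univ, true_and] at hx
      exact absurd hx.1 (Option.some_ne_none _)

theorem labCard_eq_add (f : Fin ℓ) : Gluing.labCard Q.gluing f =
    Q.degOld f + ∑ j with D.a j = f, (2 * Q.edges j + 2) := by
  classical
  rw [Gluing.labCard, Finset.card_filter, Fintype.sum_sum_type, Fintype.sum_sigma,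
    Fin.sum_univ_succ, Fintype.sum_prod_type, add_assoc, ← Finset.sum_add_distrib]
  congr 1
  · rw [degOld, Nat.card_eq_fintype_card, Fintype.card_subtype, Finset.card_filter]
    rfl
  · rw [Finset.sum_filter]
    refine Finset.sum_congr rfl fun j _ => ?_
    have h1 : ∀ h : Q.H j.succ, Q.gluing.L (Sum.inl ⟨j.succ, h⟩) = D.a j := fun _ => rfl
    have h2 : ∀ b, Q.gluing.L (Sum.inr (j, b)) = D.a j := fun _ => rfl
    simp only [h1, h2]
    split_ifs
    · simp only [Finset.sum_const, smul_eq_mul, mul_one, Finset.card_univ]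
      rw [← Nat.card_eq_fintype_card, Q.card_H_succ]
      rfl
    · simp

theorem degOld_eq (f : Fin ℓ) : (Q.degOld f : ℤ) = D.kappa₀ P κ f := Q.degree₀ f

/-- By `edges_eq`, the amount `4 g + 2 n• + 2 n∘` subtracted in `κ⁰` is `2 E + 2`, the number of
half-edges of the piece and of its joining edge. -/
theorem labCard_eq (f : Fin ℓ) : Gluing.labCard Q.gluing f = κ f := by
  have h := Q.labCard_eq_add f
  zify at h ⊢
  rw [h, Q.degOld_eq, DegenIndex.kappa₀]
  have : ∀ j ∈ Finset.univ.filter fun j => D.a j = f,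
      (4 * (D.g j.succ : ℤ) + 2 * ((D.black P j.succ).card : ℤ) +
        2 * ((D.white P j.succ).card : ℤ)) = 2 * Q.edges j + 2 := by
    intro j _
    rw [Q.edges_eq]; ring
  rw [Finset.sum_congr rfl this]
  ring

theorem card_Om : Nat.card Q.Om = ∑ f, κ f := by
  classical
  rw [Nat.card_eq_fintype_card, ← Finset.card_univ,
    Finset.card_eq_sum_card_fiberwise (f := Q.gluing.L) (t := Finset.univ) (fun _ _ => by simp)]
  exact Finset.sum_congr rfl fun f _ => Q.labCard_eq f

/-- The valid rotations. -/
def IsValid (σ : Equiv.Perm Q.Om) : Prop :=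
  Q.gluing.Valid Finset.univ Finset.univ Q.nextOld Q.pieceFun σ

theorem card_isValid (hκ : ∀ i, Odd (κ i)) :
    (Nat.card {σ // Q.IsValid σ} : ℚ) = D.coeff P κ := by
  classical
  have h := Gluing.card_validSet Q.initialState Q.initial_lab (E := Q.edges)
    (fun j _ c => Q.colorCard_eq j c)
  have h1 : (Nat.card {σ // Q.IsValid σ} : ℚ) =
      (((Gluing.validSet Q.gluing Finset.univ Finset.univ Q.nextOld Q.pieceFun).card : ℤ) : ℚ) := by
    rw [Nat.card_eq_fintype_card, Fintype.card_subtype, Gluing.validSet, Int.cast_natCast]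
    congr!
  rw [h1, h, Gluing.expected, DegenIndex.coeff]
  push_cast
  rw [← Finset.prod_fiberwise Finset.univ D.a, ← Finset.prod_mul_distrib]
  refine Finset.prod_congr rfl fun f _ => ?_
  have hk : (Finset.univ.filter fun j => Q.gluing.a j = f) = Finset.univ.filter fun j => D.a j = f :=
    rfl
  rw [hk, Q.labCard_eq, Q.rootCard_eq, faceFactor_eq_doubleFactorial _ _ _ (hκ f)]
  · have h2 : (Q.degOld f : ℚ) = (D.kappa₀ P κ f : ℚ) := by exact_mod_cast Q.degOld_eq f
    rw [h2]
    have h3 : ∏ j with D.a j = f, (Q.edges j : ℚ) = ∏ j with D.a j = f,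
        (2 * (D.g j.succ : ℚ) - 1 + ((D.black P j.succ).card : ℚ) +
          ((D.white P j.succ).card : ℚ)) :=
      Finset.prod_congr rfl fun j _ => by exact_mod_cast Q.edges_eq j
    rw [h3]
    ring
  · intro h0
    have := Q.labCard_eq_add f
    rw [Finset.card_eq_zero] at h0
    rw [h0, Q.labCard_eq, Finset.sum_empty, add_zero] at this
    exact this
  · have := Q.labCard_eq_add f
    rw [Q.labCard_eq, Finset.sum_add_distrib, Finset.sum_const, smul_eq_mul] at this
    -- The core keeps a part of each face. Therefore `2 k + 1 ≤ κ`, and `κ - 2 k` is not truncated.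
    have hpos : 0 < Q.degOld f := by
      have := Q.kappa₀_pos f
      rw [← Q.degOld_eq] at this
      exact_mod_cast this
    omega

end DegenPieces

/-! ### Connectedness and faces of a glued graph. -/

namespace Gluing

variable {Ω ι S Lab : Type*} [LinearOrder S] {G : Gluing Ω ι S Lab} [DecidableEq ι]
  [DecidableEq Ω] [Finite Ω] [Fintype ι]
variable {σ ν : Equiv.Perm Ω} {q : Ω → Option ι} {β : Ω → Bool}
  {As : S → Option ι} {mx : ι → S}

variable (G) in
/-- The half-edges other than those of the joining edges. -/
abbrev old : Set Ω := G.placed Finset.univ Finset.univ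

variable (G) in
/-- All the pieces are glued together in `σ`; there is no condition on the faces. -/
structure Glued (ν : Equiv.Perm Ω) (q : Ω → Option ι) (σ : Equiv.Perm Ω) : Prop where
  skip : Skips σ G.old ν
  hit₀ : ∀ j, ∃ x ∈ G.old, q x = some j ∧ σ.SameCycle (G.e j) x
  hit₁ : ∀ j, ∃ x ∈ G.old, σ.SameCycle (G.opp (G.e j)) x
  side : ∀ j, ∃ T χ, G.IsSide σ j T χ

theorem Valid.glued (h : G.Valid Finset.univ Finset.univ ν q σ) : G.Glued ν q σ :=
  ⟨h.skip, fun j => h.hit₀ j (Finset.mem_univ _), fun j => h.hit₁ j (Finset.mem_univ _),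
    fun j => h.side j (Finset.mem_univ _)⟩

theorem Glued.valid (h : G.Glued ν q σ) (hl : ∀ x, G.L (σ x) = G.L (G.opp x)) :
    G.Valid Finset.univ Finset.univ ν q σ :=
  ⟨h.skip, hl, fun j _ => h.hit₀ j, fun j _ => h.hit₁ j, fun j _ => h.side j⟩

theorem notMem_old {x : Ω} : x ∉ G.old ↔ ∃ j, x = G.e j ∨ x = G.opp (G.e j) := by
  constructor
  · intro hx
    rcases mem_placed_or (G := G) (U₀ := Finset.univ) (U₁ := Finset.univ) x with h | ⟨j, -, h⟩ |
      ⟨j, -, h⟩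
    · exact absurd h hx
    · exact ⟨j, Or.inl h⟩
    · exact ⟨j, Or.inr h⟩
  · rintro ⟨j, rfl | rfl⟩
    · exact e_notMem (Finset.mem_univ j)
    · exact opp_e_notMem (Finset.mem_univ j)

namespace Glued

variable (h : G.State Finset.univ Finset.univ ν q β As mx) (hg : G.Glued ν q σ)
include h hg

theorem hit (x : Ω) : ∃ y ∈ G.old, σ.SameCycle x y := by
  by_cases hx : x ∈ G.old
  · exact ⟨x, hx, SameCycle.refl _ _⟩
  · obtain ⟨j, rfl | rfl⟩ := notMem_old.1 hx
    · obtain ⟨y, h1, -, h2⟩ := hg.hit₀ j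
      exact ⟨y, h1, h2⟩
    · exact hg.hit₁ j

/-- A side contains a piece if it contains the lower end of the joining edge of the piece. -/
theorem piece_subset {j k : ι} {T : Set Ω} {χ : Ω → Bool} (hT : G.IsSide σ k T χ)
    (hj : G.e j ∈ T) {y : Ω} (hy : y ∈ G.old) (hq : q y = some j) : y ∈ T := by
  obtain ⟨x, h1, h2, h3⟩ := hg.hit₀ j
  exact h.mem_side hg.skip (Finset.mem_univ _) hT h1 hy (h2.trans hq.symm)
    (hT.mem_of_sameCycle h3 hj)

/-- This makes the pieces a tree: following an edge upwards strictly enlarges the side. As `e k` is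
not in `T`, the intersection of the two sides is closed, and minimality of `T` gives the inclusion.
-/
theorem side_ssubset {j k : ι} {T T' : Set Ω} {χ χ' : Ω → Bool} (hT : G.IsSide σ j T χ)
    (hT' : G.IsSide σ k T' χ') {y : Ω} (hy : y ∈ G.old) (hq : q y = some k)
    (hjy : σ.SameCycle (G.opp (G.e j)) y) : T ⊂ T' := by
  have h0 : G.e k ∉ T := fun hh => hT.opp_notMem
    (hT.mem_of_sameCycle hjy.symm (piece_subset h hg hT hh hy hq))
  have h1 : G.opp (G.e j) ∈ T' :=
    hT'.mem_of_sameCycle hjy.symm (piece_subset h hg hT' hT'.base_mem hy hq)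
  have h2 : G.e j ∈ T' := by
    have := hT'.opp_mem _ h1 (opp_e_ne _ _)
    rwa [G.opp_opp] at this
  refine ⟨fun z hz => (hT.minimal (T ∩ T') ⟨hT.base_mem, h2⟩ ?_ ?_ hz).2, fun hh =>
    hT.opp_notMem (hh h1)⟩
  · rintro z ⟨hz1, hz2⟩
    exact ⟨hT.next_mem z hz1, hT'.next_mem z hz2⟩
  · rintro z ⟨hz1, hz2⟩ hz3 -
    refine ⟨hT.opp_mem z hz1 hz3, hT'.opp_mem z hz2 ?_⟩
    rintro rfl
    exact h0 hz1

/-- A nonempty closed set of half-edges meets the core. -/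
theorem exists_core_of_closed {T : Set Ω} (h1 : ∀ x ∈ T, σ x ∈ T) (h2 : ∀ x ∈ T, G.opp x ∈ T)
    (hT : T.Nonempty) : ∃ x ∈ T, x ∈ G.old ∧ q x = none := by
  classical
  by_contra hcon
  push Not at hcon
  have hcl : ∀ {x y}, σ.SameCycle x y → x ∈ T → y ∈ T := fun hxy => Skips.mem_of_sameCycle h1 hxy
  choose T' χ' hT' using hg.side
  have hpiece : ∀ x ∈ T, x ∈ G.old → ∃ k, q x = some k ∧ G.e k ∈ T := by
    intro x hxT hx
    obtain ⟨k, hk⟩ := Option.ne_none_iff_exists'.1 (hcon x hxT hx)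
    obtain ⟨y, hy, hyq, hyc⟩ := hg.hit₀ k
    refine ⟨k, hk, hcl hyc.symm ?_⟩
    exact h.conn T (fun z _ hz => hg.skip.closed h1 hz) (fun z _ _ hz => h2 z hz) x hx y hy
      (hk.trans hyq.symm) hxT
  have hne : (Finset.univ.filter fun j => G.e j ∈ T).Nonempty := by
    obtain ⟨x, hx⟩ := hT
    obtain ⟨y, hy, hxy⟩ := hit h hg x
    obtain ⟨k, -, hk⟩ := hpiece y (hcl hxy hx) hy
    exact ⟨k, by simpa using hk⟩
  -- The upper end of the edge with the largest side lies in the closed set too, hence on a non-core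
  -- piece, whose own edge has a still larger side.
  obtain ⟨j, hj, hmax⟩ := Finset.exists_max_image _ (fun j => (T' j).ncard) hne
  simp only [Finset.mem_filter, Finset.mem_univ, true_and] at hj hmax
  obtain ⟨y, hy, hjy⟩ := hg.hit₁ j
  obtain ⟨k, hk, hkT⟩ := hpiece y (hcl hjy (h2 _ hj)) hy
  have := Set.ncard_lt_ncard (side_ssubset h hg (hT' j) (hT' k) hy hk hjy) (Set.toFinite _)
  exact absurd (hmax k hkT) (not_le.2 this)

/-- If the set were proper, it and its complement would both meet the core piece, which is
connected. -/
theorem closed_eq_univ {T : Set Ω} (h1 : ∀ x ∈ T, σ x ∈ T) (h2 : ∀ x ∈ T, G.opp x ∈ T)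
    (hT : T.Nonempty) (y : Ω) : y ∈ T := by
  by_contra hy
  obtain ⟨c, hcT, hc, hcq⟩ := exists_core_of_closed h hg h1 h2 hT
  obtain ⟨d, hdT, hd, hdq⟩ := exists_core_of_closed h hg (T := Tᶜ)
    (fun x hx hh => hx (Skips.mem_of_sameCycle h1
      (sameCycle_apply_left.2 (SameCycle.refl _ _)) hh))
    (fun x hx hh => hx (by simpa [G.opp_opp] using h2 _ hh)) ⟨y, hy⟩
  exact hdT (h.conn T (fun z _ hz => hg.skip.closed h1 hz) (fun z _ _ hz => h2 z hz) c hc d hd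
    (hcq.trans hdq.symm) hcT)

variable {B : Type*} {f : Ω → B} (hf : ∀ x, f (σ x) = f (G.opp x))
  (hface : ∀ j, ∀ T : Set Ω, (∀ x ∈ G.old, q x = some j → x ∈ T → ν (G.opp x) ∈ T) →
    ∀ x ∈ G.old, ∀ y ∈ G.old, q x = some j → q y = some j → x ∈ T → y ∈ T)
include hf hface

/-- The two halves of a joining edge belong to the same face. -/
theorem face_opp_e (j : ι) : f (G.opp (G.e j)) = f (G.e j) := by
  classical
  choose T χ hT using hg.side
  induction hN : (T j).ncard using Nat.strong_induction_on generalizing j with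
  | _ N ih =>
    subst hN
    -- Besides `e j`, the new half-edges at vertices of the piece `j` are upper ends of edges with
    -- smaller sides, so the induction hypothesis covers them: the walk around the piece `j` may
    -- skip its children.
    have hchild : ∀ x ∈ G.old, q x = some j → ∀ z, z ∉ G.old → σ.SameCycle z x → z ≠ G.e j →
        f (G.opp z) = f z := by
      intro x hx hq z hz hzx hzj
      obtain ⟨k, rfl | rfl⟩ := notMem_old.1 hz
      · obtain ⟨y, h1, h2, h3⟩ := hg.hit₀ k
        have := h.q_eq_of_sameCycle hg.skip hx h1 (hzx.symm.trans h3)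
        rw [h2, hq] at this
        exact absurd (congrArg G.e (Option.some.inj this).symm) hzj
      · rw [G.opp_opp, ih _ (Set.ncard_lt_ncard
          (side_ssubset h hg (hT k) (hT j) hx hq hzx) (Set.toFinite _)) k rfl]
    obtain ⟨y, hy, hyq, hyc⟩ := hg.hit₀ j
    obtain ⟨x, hx, hxs⟩ := hg.skip.exists_ins (e_notMem (Finset.mem_univ j)) ⟨y, hy, hyc⟩
    have hxc := ins_sameCycle hxs
    have hxq : q x = some j := (h.q_eq_of_sameCycle hg.skip hx hy (hxc.symm.trans hyc)).trans hyq
    have hfix := hg.skip.fix _ (e_notMem (Finset.mem_univ j))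
    have hpass : ∀ w ∈ insert (G.e j) G.old, q w = some j → σ.SameCycle w w →
        f (Skips.ins ν x (G.e j) w) = f (G.opp w) := by
      intro w hw hwq _
      obtain ⟨k, hk, hk'⟩ := hxs.ret w hw
      rw [← hk]
      have hwc : ∃ x' ∈ G.old, q x' = some j ∧ σ.SameCycle w x' := by
        rcases hw with rfl | hw
        · exact ⟨y, hy, hyq, hyc⟩
        · exact ⟨w, hw, hwq, SameCycle.refl _ _⟩
      obtain ⟨x', hx', hxq', hwx'⟩ := hwc
      have : ∀ i ≤ k, f ((σ ^ (i + 1)) w) = f (G.opp w) := by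
        intro i
        induction i with
        | zero => intro _; simpa using hf w
        | succ i ihi =>
          intro hi
          have hn := hk' i (by omega)
          rw [Set.mem_insert_iff, not_or] at hn
          rw [pow_succ', mul_apply, hf, hchild x' hx' hxq' _ hn.2 _ hn.1, ihi (by omega)]
          exact (sameCycle_pow_left.2 hwx')
      exact this k le_rfl
    have h1 : f (G.e j) = f (G.opp x) := by
      have := hpass x (Or.inr hx) hxq (SameCycle.refl _ _)
      rwa [Skips.ins_self] at this
    have h2 : f (ν x) = f (G.opp (G.e j)) := by
      have := hpass _ (Or.inl rfl) (h.q_e j (Finset.mem_univ j)) (SameCycle.refl _ _)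
      rwa [Skips.ins_new hfix] at this
    rw [h1, ← h2]
    -- The edge of `j` interrupts the only face of the piece in one corner, between `opp x` and `ν
    -- x`. The half-edges with the value `f (ν x)` are closed under the face permutation of the
    -- piece, the interrupted step not occurring among them; since there is one face, they include
    -- `opp x`.
    by_contra hne
    have hνx : ν x ∈ G.old := hg.skip.mem hx
    have hoppx : G.opp x ∈ G.old := opp_mem_placed_iff.2 hx
    refine hne (hface j {w | f w = f (ν x)} ?_ (ν x) hνx (G.opp x) hoppx
      ((h.q_next x).trans hxq) ((h.q_opp x).trans hxq) rfl).symm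
    intro w hw hwq hfw
    have hwx : G.opp w ≠ x := by
      rintro rfl
      rw [G.opp_opp] at hne
      exact hne hfw.symm
    have hwo : G.opp w ∈ G.old := opp_mem_placed_iff.2 hw
    have := hpass (G.opp w) (Or.inr hwo) ((h.q_opp w).trans hwq) (SameCycle.refl _ _)
    rw [Skips.ins_of_ne hfix (ne_of_mem_of_not_mem hwo (e_notMem (Finset.mem_univ j))) hwx,
      G.opp_opp] at this
    exact this.trans hfw

theorem face_opp_of_notMem {x : Ω} (hx : x ∉ G.old) : f (G.opp x) = f x := by
  obtain ⟨j, rfl | rfl⟩ := notMem_old.1 hx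
  · exact face_opp_e h hg hf hface j
  · rw [G.opp_opp, face_opp_e h hg hf hface j]

theorem face_old {x : Ω} (hx : x ∈ G.old) : f (ν x) = f (G.opp x) :=
  hg.skip.label_apply hf (fun _ hy => face_opp_of_notMem h hg hf hface hy) hx

/-- The face of a new half-edge is that of the corner at which it is attached. -/
theorem exists_corner {z : Ω} (hz : z ∉ G.old) :
    ∃ x ∈ G.old, σ.SameCycle x z ∧ f z = f (G.opp x) := by
  obtain ⟨y, hy, hzy⟩ := hit h hg z
  have := Skips.mem_of_sameCycle (σ := σ)
    (T := {z | z ∈ G.old ∨ ∃ x ∈ G.old, σ.SameCycle x z ∧ f z = f (G.opp x)}) ?_ hzy.symm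
    (Or.inl hy)
  · exact this.resolve_left hz
  · intro w hw
    by_cases hwo : w ∈ G.old
    · exact Or.inr ⟨w, hwo, sameCycle_apply_right.2 (SameCycle.refl _ _), hf w⟩
    · obtain ⟨x, h1, h2, h3⟩ := hw.resolve_left hwo
      refine Or.inr ⟨x, h1, sameCycle_apply_right.2 h2, ?_⟩
      rw [hf, face_opp_of_notMem h hg hf hface hwo, h3]

theorem face_piece {j : ι} {x y : Ω} (hx : x ∈ G.old) (hy : y ∈ G.old) (hxq : q x = some j)
    (hyq : q y = some j) : f x = f y := by
  refine (hface j {w | f w = f x} ?_ x hx y hy hxq hyq rfl).symm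
  intro w hw hwq hfw
  have hwo : G.opp w ∈ G.old := opp_mem_placed_iff.2 hw
  have := face_old h hg hf hface hwo
  rw [G.opp_opp] at this
  exact this.trans hfw

theorem face_e {j : ι} {x : Ω} (hx : x ∈ G.old) (hxq : q x = some j) : f (G.e j) = f x := by
  obtain ⟨y, hy, hyc, hyf⟩ := exists_corner h hg hf hface (e_notMem (Finset.mem_univ j))
  obtain ⟨w, hw, hwq, hwc⟩ := hg.hit₀ j
  have : q y = some j := (h.q_eq_of_sameCycle hg.skip hy hw (hyc.trans hwc)).trans hwq
  rw [hyf]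
  exact face_piece h hg hf hface (opp_mem_placed_iff.2 hy) hx ((h.q_opp y).trans this) hxq

/-- Every face contains a half-edge of the core. -/
theorem exists_core_face (x : Ω) : ∃ c ∈ G.old, q c = none ∧ f x = f c := by
  classical
  choose T χ hT using hg.side
  have key : ∀ j, ∃ c ∈ G.old, q c = none ∧ f (G.e j) = f c := by
    intro j
    -- Sides grow towards the core, so the induction is on the size of the complement.
    induction hN : (Set.univ : Set Ω).ncard - (T j).ncard using Nat.strong_induction_on
      generalizing j with
    | _ N ih =>
      subst hN
      rw [← face_opp_e h hg hf hface j]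
      obtain ⟨y, hy, hyc, hyf⟩ := exists_corner h hg hf hface (opp_e_notMem (Finset.mem_univ j))
      rcases hq : q y with _ | k
      · exact ⟨G.opp y, opp_mem_placed_iff.2 hy, (h.q_opp y).trans hq, hyf⟩
      · have h1 := Set.ncard_lt_ncard (side_ssubset h hg (hT j) (hT k) hy hq hyc.symm)
          (Set.toFinite _)
        have h2 : (T k).ncard ≤ (Set.univ : Set Ω).ncard :=
          Set.ncard_le_ncard (Set.subset_univ _) (Set.toFinite _)
        obtain ⟨c, hc1, hc2, hc3⟩ := ih _ (by omega) k rfl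
        refine ⟨c, hc1, hc2, ?_⟩
        rw [hyf, ← hc3]
        exact (face_e h hg hf hface (opp_mem_placed_iff.2 hy) ((h.q_opp y).trans hq)).symm
  by_cases hx : x ∈ G.old
  · rcases hq : q x with _ | k
    · exact ⟨x, hx, hq, rfl⟩
    · rw [← face_e h hg hf hface hx hq]
      exact key k
  · obtain ⟨j, rfl | rfl⟩ := notMem_old.1 hx
    · exact key j
    · rw [face_opp_e h hg hf hface j]; exact key j

end Glued

end Gluing

/-! ### Weights of edges whose sides consist of whole pieces. -/

theorem sum_range_two_pow (k : ℕ) : ∑ i ∈ Finset.range k, (2 : ℝ) ^ (i + 1) = 2 ^ (k + 1) - 2 := by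
  induction k with
  | zero => norm_num
  | succ k ih => rw [Finset.sum_range_succ, ih]; ring

/-- The sign of a signed sum of distinct powers of two is that of the highest one. -/
theorem sum_mul_two_pow_pos {p : ℕ} (δ : Fin p → ℝ) (s₀ : Fin p) (h1 : δ s₀ = 1)
    (hδ : ∀ s, -1 ≤ δ s) (h0 : ∀ s, s₀ < s → δ s = 0) :
    0 < ∑ s, δ s * 2 ^ ((s : ℕ) + 1) := by
  -- In the worst case all lower coefficients are -1, and the leading power exceeds the sum of the
  -- lower ones by 2.
  have hle : ∑ s, ((if s = s₀ then (2 : ℝ) ^ ((s₀ : ℕ) + 1) else 0) -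
      (if s < s₀ then (2 : ℝ) ^ ((s : ℕ) + 1) else 0)) ≤ ∑ s, δ s * 2 ^ ((s : ℕ) + 1) := by
    refine Finset.sum_le_sum fun s _ => ?_
    rcases lt_trichotomy s s₀ with h | h | h
    · rw [if_neg h.ne, if_pos h]
      have := mul_le_mul_of_nonneg_right (hδ s) (by positivity : (0 : ℝ) ≤ 2 ^ ((s : ℕ) + 1))
      linarith
    · subst h
      simp [h1]
    · rw [if_neg h.ne', if_neg h.not_gt, h0 s h]
      simp
  refine lt_of_lt_of_le ?_ hle
  rw [Finset.sum_sub_distrib, Finset.sum_ite_eq', if_pos (Finset.mem_univ _), ← Finset.sum_filter]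
  have h2 : ∑ s with s < s₀, (2 : ℝ) ^ ((s : ℕ) + 1) ≤
      ∑ i ∈ Finset.range (s₀ : ℕ), (2 : ℝ) ^ (i + 1) := by
    refine (Finset.sum_map (Finset.univ.filter fun s => s < s₀) Fin.valEmbedding
      (fun i => (2 : ℝ) ^ (i + 1))).ge.trans ?_
    refine Finset.sum_le_sum_of_subset_of_nonneg ?_ fun i _ _ => by positivity
    intro i hi
    simp only [Finset.mem_map, Finset.mem_filter, Finset.mem_univ, true_and,
      Fin.valEmbedding_apply] at hi
    obtain ⟨s, hs, rfl⟩ := hi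
    exact Finset.mem_range.2 hs
  rw [sum_range_two_pow] at h2
  linarith

namespace DegenPieces

variable {n p ℓ m : ℕ} {P : WallPartition n p} {κ : Fin ℓ → ℕ} {D : DegenIndex p ℓ m}

variable (P D) in
/-- `(I, J)` colours some of the pieces other than the core by black and white. -/
def ColorsPieces (I J : Finset (Fin n)) : Prop :=
  ∀ i, (∀ v, labelPiece P D v = i → v ∉ I ∧ v ∉ J) ∨ ∃ (j : Fin m) (c : Bool), i = j.succ ∧
    ∀ v, labelPiece P D v = i → (v ∈ I ↔ xor c (decide (v ∈ D.black P i)) = true) ∧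
      (v ∈ J ↔ xor c (decide (v ∈ D.black P i)) = false)

/-- The sets `I⁰_s` and `I¹_s` are in the same piece, one in its black and one in its white part.
They are both missed or get opposite colours. -/
theorem ColorsPieces.wall {I J : Finset (Fin n)} (h : ColorsPieces P D I J) (s : Fin p) :
    (∀ e, ∀ v ∈ P.I s e, v ∉ I ∧ v ∉ J) ∨
    ((∀ v ∈ P.I s false, v ∈ I ∧ v ∉ J) ∧ (∀ v ∈ P.I s true, v ∉ I ∧ v ∈ J)) ∨
    ((∀ v ∈ P.I s false, v ∉ I ∧ v ∈ J) ∧ (∀ v ∈ P.I s true, v ∈ I ∧ v ∉ J)) := by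
  rcases h (D.A s) with h | ⟨j, c, hj, h⟩
  · exact Or.inl fun e v hv => h v (labelPiece_of_mem hv)
  · right
    have hb : ∀ e, ∀ v ∈ P.I s e, (v ∈ D.black P (D.A s) ↔ e = D.ε s) := by
      intro e v hv
      rw [mem_black]
      constructor
      · rintro ⟨s', -, hs'⟩
        obtain ⟨rfl, rfl⟩ := wall_index_unique hv hs'
        rfl
      · rintro rfl
        exact ⟨s, rfl, hv⟩
    have h' : ∀ e, ∀ v ∈ P.I s e, (v ∈ I ↔ xor c (decide (e = D.ε s)) = true) ∧
        (v ∈ J ↔ xor c (decide (e = D.ε s)) = false) := by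
      intro e v hv
      have := h v (labelPiece_of_mem hv)
      simpa only [hb e v hv] using this
    cases c <;> cases hε : D.ε s <;> simp only [hε] at h'
    · exact Or.inl ⟨fun v hv => by simp [h' _ v hv], fun v hv => by simp [h' _ v hv]⟩
    · exact Or.inr ⟨fun v hv => by simp [h' _ v hv], fun v hv => by simp [h' _ v hv]⟩
    · exact Or.inr ⟨fun v hv => by simp [h' _ v hv], fun v hv => by simp [h' _ v hv]⟩
    · exact Or.inl ⟨fun v hv => by simp [h' _ v hv], fun v hv => by simp [h' _ v hv]⟩

theorem ColorsPieces.notMem_zero {I J : Finset (Fin n)} (h : ColorsPieces P D I J) {v : Fin n}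
    (hv : v ∈ P.I₀) : v ∉ I ∧ v ∉ J := by
  rcases h 0 with h | ⟨j, c, hj, -⟩
  · exact h v (labelPiece_of_mem_zero hv)
  · exact absurd hj.symm (Fin.succ_ne_zero j)

theorem sum_indicator {I : Finset (Fin n)} (y : Fin n → ℝ) :
    ∑ v ∈ I, y v = ∑ v, (if v ∈ I then 1 else 0) * y v := by
  simp

/-- The weight of an edge with sides coloured by whole pieces is a signed sum of the wall
equations. -/
theorem ColorsPieces.exists_sum {I J : Finset (Fin n)} (h : ColorsPieces P D I J) :
    ∃ δ : Fin p → ℝ, (∀ s, (δ s = 0 ∧ ∀ v ∈ P.I s false, v ∉ I ∧ v ∉ J) ∨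
        (δ s = 1 ∧ ∀ v ∈ P.I s false, v ∈ I ∧ v ∉ J) ∨
        (δ s = -1 ∧ ∀ v ∈ P.I s false, v ∉ I ∧ v ∈ J)) ∧
      ∀ y : Fin n → ℝ, ∑ v ∈ I, y v - ∑ v ∈ J, y v =
        ∑ s, δ s * wallForm (P.I s false) (P.I s true) y := by
  classical
  let c : Fin n → ℝ := fun v => (if v ∈ I then 1 else 0) - (if v ∈ J then 1 else 0)
  choose r hr using fun s => P.nonempty s false
  have hc : ∀ s, (∀ v ∈ P.I s false, c v = c (r s)) ∧ ∀ v ∈ P.I s true, c v = -c (r s) := by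
    intro s
    rcases h.wall s with h | ⟨h1, h2⟩ | ⟨h1, h2⟩
    · have := h false _ (hr s)
      constructor <;> intro v hv <;> simp [c, h _ v hv, this]
    · have := h1 _ (hr s)
      constructor
      · intro v hv; simp [c, h1 v hv, this]
      · intro v hv; simp [c, h2 v hv, this]
    · have := h1 _ (hr s)
      constructor
      · intro v hv; simp [c, h1 v hv, this]
      · intro v hv; simp [c, h2 v hv, this]
  refine ⟨fun s => c (r s), fun s => ?_, fun y => ?_⟩
  · rcases h.wall s with h | ⟨h1, h2⟩ | ⟨h1, h2⟩
    · have := h false _ (hr s)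
      exact Or.inl ⟨by simp [c, this], h false⟩
    · have := h1 _ (hr s)
      exact Or.inr (Or.inl ⟨by simp [c, this], h1⟩)
    · have := h1 _ (hr s)
      exact Or.inr (Or.inr ⟨by simp [c, this], h1⟩)
  · have hpt : ∀ v, c v = ∑ s, c (r s) * ((if v ∈ P.I s false then 1 else 0) -
        (if v ∈ P.I s true then 1 else 0)) := by
      intro v
      rcases P.cover v with hv | ⟨s, e, hv⟩
      · have h0 := h.notMem_zero hv
        rw [Finset.sum_eq_zero]
        · simp [c, h0]
        · intro s _
          have h1 : ∀ e, v ∉ P.I s e := fun e he =>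
            Finset.disjoint_left.1 (P.disjoint₀ s e) hv he
          simp [h1]
      · rw [Finset.sum_eq_single s]
        · cases e
          · have h1 : v ∉ P.I s true := fun hh => by
              simpa using (wall_index_unique hv hh).2
            rw [if_pos hv, if_neg h1, (hc s).1 v hv]; ring
          · have h1 : v ∉ P.I s false := fun hh => by
              simpa using (wall_index_unique hv hh).2
            rw [if_pos hv, if_neg h1, (hc s).2 v hv]; ring
        · intro s' _ hs'
          have h1 : ∀ e, v ∉ P.I s' e := fun e he => hs' (wall_index_unique he hv).1
          simp [h1]
        · exact fun hh => absurd (Finset.mem_univ s) hh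
    have e1 : ∑ v ∈ I, y v - ∑ v ∈ J, y v = ∑ v, c v * y v := by
      rw [sum_indicator (I := I), sum_indicator (I := J), ← Finset.sum_sub_distrib]
      exact Finset.sum_congr rfl fun v _ => by ring
    rw [e1]
    have e2 : ∀ s, c (r s) * wallForm (P.I s false) (P.I s true) y = ∑ v, c (r s) *
        ((if v ∈ P.I s false then 1 else 0) * y v - (if v ∈ P.I s true then 1 else 0) * y v) := by
      intro s
      rw [wallForm, sum_indicator (I := P.I s false), sum_indicator (I := P.I s true),
        ← Finset.sum_sub_distrib, Finset.mul_sum]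
    simp only [e2]
    rw [Finset.sum_comm]
    refine Finset.sum_congr rfl fun v _ => ?_
    rw [hpt v, Finset.sum_mul]
    exact Finset.sum_congr rfl fun s _ => by ring

theorem ColorsPieces.sum_wall {I J : Finset (Fin n)} (h : ColorsPieces P D I J) {b : Fin n → ℝ}
    (hb : b ∈ P.wall) : ∑ v ∈ I, b v - ∑ v ∈ J, b v = 0 := by
  obtain ⟨δ, -, hδ⟩ := h.exists_sum
  rw [hδ b]
  exact Finset.sum_eq_zero fun s _ => by rw [hb s, mul_zero]

/-- The sign of the weight near the wall is decided by the highest equation. -/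
theorem ColorsPieces.sum_pos {I J : Finset (Fin n)} (h : ColorsPieces P D I J) {y : Fin n → ℝ}
    {t : ℝ} (ht : 0 < t)
    (hy : ∀ s : Fin p, wallForm (P.I s false) (P.I s true) y = 2 ^ ((s : ℕ) + 1) * t)
    (s₀ : Fin p) (h0 : ∀ s, s₀ < s → ∀ v ∈ P.I s false, v ∉ I ∧ v ∉ J)
    (h1 : ∀ v ∈ P.I s₀ false, v ∈ I) : 0 < ∑ v ∈ I, y v - ∑ v ∈ J, y v := by
  obtain ⟨δ, hδ, hsum⟩ := h.exists_sum
  rw [hsum y]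
  have hne : ∀ s, ∃ v, v ∈ P.I s false := fun s => P.nonempty s false
  have key := sum_mul_two_pow_pos δ s₀ ?_ ?_ ?_
  · have : ∑ s, δ s * wallForm (P.I s false) (P.I s true) y =
        (∑ s, δ s * 2 ^ ((s : ℕ) + 1)) * t := by
      rw [Finset.sum_mul]
      exact Finset.sum_congr rfl fun s _ => by rw [hy]; ring
    rw [this]
    positivity
  · obtain ⟨v, hv⟩ := hne s₀
    have := h1 v hv
    rcases hδ s₀ with ⟨-, h2⟩ | ⟨h2, -⟩ | ⟨-, h2⟩
    · exact absurd this (h2 v hv).1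
    · exact h2
    · exact absurd this (h2 v hv).1
  · intro s
    rcases hδ s with ⟨h2, -⟩ | ⟨h2, -⟩ | ⟨h2, -⟩ <;> rw [h2] <;> norm_num
  · intro s hs
    obtain ⟨v, hv⟩ := hne s
    have := h0 s hs v hv
    rcases hδ s with ⟨h2, -⟩ | ⟨-, h2⟩ | ⟨-, h2⟩
    · exact h2
    · exact absurd (h2 v hv).1 this.1
    · exact absurd (h2 v hv).2 this.2

theorem ColorsPieces.symm {I J : Finset (Fin n)} (h : ColorsPieces P D I J) :
    ColorsPieces P D J I := by
  intro i
  rcases h i with h | ⟨j, c, hj, h⟩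
  · exact Or.inl fun v hv => (h v hv).symm
  · refine Or.inr ⟨j, !c, hj, fun v hv => ?_⟩
    have := h v hv
    constructor
    · rw [this.2]; cases c <;> simp
    · rw [this.1]; cases c <;> simp

variable (Q : DegenPieces P κ D)

/-- The core has no proper colouring. -/
theorem not_bipartite_core (hκ : ∀ i, Odd (κ i)) (χ : Q.H 0 → Bool)
    (h1 : ∀ h, χ ((Q.G 0).next h) = χ h) (h2 : ∀ h, χ ((Q.G 0).opp h) = !χ h) : False := by
  classical
  obtain ⟨h₀⟩ := (Q.G 0).nonempty
  set f := Q.F₀ h₀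
  -- The degree of a core face differs from `κ` by a sum of even numbers `2 E + 2`.
  have hodd : Odd (Q.degOld f) := by
    have := Q.labCard_eq_add f
    rw [Q.labCard_eq] at this
    have h3 := hκ f
    rw [this, Finset.sum_add_distrib, ← Finset.mul_sum, Finset.sum_const, smul_eq_mul] at h3
    obtain ⟨c, hc⟩ := h3
    rw [← Nat.not_even_iff_odd]
    rintro ⟨d, hd⟩
    omega
  have hface : ∀ h, χ ((Q.G 0).face h) = !χ h := fun h => by
    rw [RibbonGraph.face, Equiv.Perm.mul_apply, h1, h2]
  have hF : ∀ h, Q.F₀ ((Q.G 0).face h) = Q.F₀ h := fun h =>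
    (Q.isFaceLabelling₀ _ _).2 (sameCycle_apply_left.2 (SameCycle.refl _ _))
  have e := Nat.card_congr (Equiv.sumCompl fun h : {h // Q.F₀ h = f} => χ h = true)
  rw [Nat.card_sum] at e
  -- A proper colouring alternates along a face, so the face permutation exchanges the two colours
  -- within the face and the degree would be even.
  have e2 : Nat.card {h : {h // Q.F₀ h = f} // χ h = true} =
      Nat.card {h : {h // Q.F₀ h = f} // ¬ χ h = true} := by
    refine Nat.card_congr (Equiv.subtypeEquiv (Equiv.subtypeEquiv (Q.G 0).face fun h => ?_) ?_)
    · rw [hF]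
    · rintro ⟨h, hh⟩
      simp only [Equiv.subtypeEquiv_apply, hface]
      cases χ h <;> simp
  rw [e2] at e
  rw [degOld, ← e] at hodd
  rw [← Nat.not_even_iff_odd] at hodd
  exact hodd ⟨_, rfl⟩

/-- A pair of sets of labels that are exchanged along the edges of a piece colours the piece or does
not meet it; it does not meet the core. -/
theorem dichotomy (hκ : ∀ i, Odd (κ i)) {I J : Finset (Fin n)} (hd : Disjoint I J)
    (i : Fin (m + 1))
    (hI : ∀ h, (Q.G i).vert h ∈ I → (Q.G i).vert ((Q.G i).opp h) ∈ J)
    (hJ : ∀ h, (Q.G i).vert h ∈ J → (Q.G i).vert ((Q.G i).opp h) ∈ I) :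
    (∀ v, labelPiece P D v = i → v ∉ I ∧ v ∉ J) ∨ ∃ (j : Fin m) (c : Bool), i = j.succ ∧
      ∀ v, labelPiece P D v = i → (v ∈ I ↔ xor c (decide (v ∈ D.black P i)) = true) ∧
        (v ∈ J ↔ xor c (decide (v ∈ D.black P i)) = false) := by
  classical
  by_cases hex : ∃ h, (Q.G i).vert h ∈ I ∨ (Q.G i).vert h ∈ J
  · right
    obtain ⟨h₀, hh₀⟩ := hex
    have hall : ∀ h, (Q.G i).vert h ∈ I ∨ (Q.G i).vert h ∈ J := by
      intro h
      refine (Q.G i).mem_of_closed (T := {h | (Q.G i).vert h ∈ I ∨ (Q.G i).vert h ∈ J}) ?_ ?_ hh₀ h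
      · intro x hx
        change (Q.G i).vert ((Q.G i).next x) ∈ I ∨ (Q.G i).vert ((Q.G i).next x) ∈ J
        rw [RibbonGraph.vert_next]
        exact hx
      · rintro x (hx | hx)
        · exact Or.inr (hI x hx)
        · exact Or.inl (hJ x hx)
    have hJn : ∀ v, v ∈ I → v ∉ J := fun v hv hv' => Finset.disjoint_left.1 hd hv hv'
    have hopp : ∀ h, ((Q.G i).vert ((Q.G i).opp h) ∈ I ↔ ¬ (Q.G i).vert h ∈ I) := by
      intro h
      constructor
      · intro h1 h2
        exact hJn _ h1 (hI h h2)
      · intro h1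
        exact hJ h ((hall h).resolve_left h1)
    cases i using Fin.cases with
    | zero =>
      refine (Q.not_bipartite_core hκ (fun h => decide ((Q.G 0).vert h ∈ I)) ?_ ?_).elim
      · intro h; simp only [RibbonGraph.vert_next]
      · intro h; simp only [hopp h, decide_not]
    | succ j =>
      refine ⟨j, xor (decide ((Q.G j.succ).vert h₀ ∈ I))
        (decide ((Q.G j.succ).vert h₀ ∈ D.black P j.succ)), rfl, ?_⟩
      have hc : ∀ h, decide ((Q.G j.succ).vert h ∈ I) = xor (xor (decide ((Q.G j.succ).vert h₀ ∈ I))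
          (decide ((Q.G j.succ).vert h₀ ∈ D.black P j.succ)))
          (decide ((Q.G j.succ).vert h ∈ D.black P j.succ)) := by
        intro h
        refine (Q.G j.succ).mem_of_closed (T := {h | decide ((Q.G j.succ).vert h ∈ I) =
          xor (xor (decide ((Q.G j.succ).vert h₀ ∈ I))
          (decide ((Q.G j.succ).vert h₀ ∈ D.black P j.succ)))
          (decide ((Q.G j.succ).vert h ∈ D.black P j.succ))}) ?_ ?_ (x := h₀) ?_ h
        · intro x hx
          simp only [Set.mem_ofPred_eq, RibbonGraph.vert_next] at hx ⊢
          exact hx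
        · intro x hx
          simp only [Set.mem_ofPred_eq, hopp x, Q.mem_black_opp x, decide_not] at hx ⊢
          rw [hx]
          simp
        · simp only [Set.mem_ofPred_eq]
          rw [Bool.xor_assoc, Bool.xor_self, Bool.xor_false]
      intro v hv
      obtain ⟨h, rfl⟩ := Q.mem_range_vert.2 hv
      rw [← hc h]
      have h1 := hall h
      have h2 := hJn ((Q.G j.succ).vert h)
      constructor
      · simp
      · simp only [decide_eq_false_iff_not]
        tauto
  · left
    push Not at hex
    intro v hv
    obtain ⟨h, rfl⟩ := Q.mem_range_vert.2 hv
    exact hex h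

end DegenPieces

/-! ### Construction of the glued ribbon graph from a rotation. -/

theorem RibbonGraph.mem_of_reach {V H : Type*} {G : RibbonGraph V H} {D : Set H} {T : Set V}
    (hT : ∀ h, h ∉ D → G.vert h ∈ T → G.vert (G.opp h) ∈ T) {u v : V} (huv : G.Reach D u v)
    (hu : u ∈ T) : v ∈ T := by
  induction huv with
  | refl => exact hu
  | tail _ hbc ih =>
    obtain ⟨h, h1, rfl, rfl⟩ := hbc
    exact hT h h1 ih

theorem RibbonGraph.Reach.opp {V H : Type*} {G : RibbonGraph V H} {D : Set H} {u : V} {x : H}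
    (h : G.Reach D u (G.vert x)) (hx : x ∉ D) : G.Reach D u (G.vert (G.opp x)) :=
  Relation.ReflTransGen.tail h ⟨x, hx, rfl, rfl⟩

theorem RibbonGraph.IsFaceLabelling.card {V H L : Type*} {G : RibbonGraph V H} {F : H → L}
    (hF : G.IsFaceLabelling F) (hs : Function.Surjective F) :
    Nat.card (Quotient (Equiv.Perm.SameCycle.setoid G.face)) = Nat.card L := by
  refine Nat.card_congr (Equiv.ofBijective
    (Quotient.lift F fun a b hab => (hF a b).2 hab) ⟨?_, fun l => ?_⟩)
  · intro a b
    induction a, b using Quotient.inductionOn₂ with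
    | _ a b => exact fun hab => Quotient.sound ((hF a b).1 hab)
  · obtain ⟨x, rfl⟩ := hs l
    exact ⟨Quotient.mk _ x, rfl⟩

theorem RibbonGraph.even_card {V H : Type*} [Finite H] (G : RibbonGraph V H) :
    2 ∣ Nat.card H := by
  classical
  have := Fintype.ofFinite H
  have h1 : G.opp ^ 2 = 1 := by
    ext x
    rw [pow_two, Equiv.Perm.mul_apply, G.opp_opp]; rfl
  have h2 := Equiv.Perm.two_dvd_card_support h1
  have h3 : G.opp.support = Finset.univ := by
    ext x
    simp [Equiv.Perm.mem_support, G.opp_ne]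
  rwa [h3, Finset.card_univ, ← Nat.card_eq_fintype_card] at h2

namespace DegenPieces

variable {n p ℓ m : ℕ} {P : WallPartition n p} {κ : Fin ℓ → ℕ} {D : DegenIndex p ℓ m}

/-- The side on which the highest wall equation that is involved is positive. -/
theorem ColorsPieces.pos_iff {I J : Finset (Fin n)} (h : ColorsPieces P D I J) {y : Fin n → ℝ}
    {t : ℝ} (ht : 0 < t)
    (hy : ∀ s : Fin p, wallForm (P.I s false) (P.I s true) y = 2 ^ ((s : ℕ) + 1) * t)
    (hd : Disjoint I J) (hne : ∃ s, ∃ v ∈ P.I s false, v ∈ I ∨ v ∈ J) :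
    0 < ∑ v ∈ I, y v - ∑ v ∈ J, y v ↔ ∀ s, ∀ v ∈ P.I s false, (v ∈ I ∨ v ∈ J) →
      (∀ s', ∀ v' ∈ P.I s' false, (v' ∈ I ∨ v' ∈ J) → s' ≤ s) → v ∈ I := by
  classical
  have hd' : ∀ v, v ∈ I → v ∉ J := fun v h1 h2 => Finset.disjoint_left.1 hd h1 h2
  constructor
  · intro hpos s v hv hvIJ hmax
    by_contra hvI
    have hvJ := hvIJ.resolve_left hvI
    have := h.symm.sum_pos ht hy s ?_ ?_
    · linarith
    · intro s' hs' v' hv'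
      by_contra hcon
      exact absurd (hmax s' v' hv' (by tauto)) (not_le.2 hs')
    · rcases h.wall s with hh | ⟨hh, -⟩ | ⟨hh, -⟩
      · exact absurd hvJ (hh _ v hv).2
      · exact absurd hvJ (hh v hv).2
      · exact fun w hw => (hh w hw).2
  · intro hs
    obtain ⟨s, hs1, hs2⟩ := Finset.exists_max_image
      (Finset.univ.filter fun s => ∃ v ∈ P.I s false, v ∈ I ∨ v ∈ J) id
      (by obtain ⟨s, hs⟩ := hne; exact ⟨s, by simpa using hs⟩)
    simp only [Finset.mem_filter, Finset.mem_univ, true_and, id_eq] at hs1 hs2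
    have hmax : ∀ s', ∀ v' ∈ P.I s' false, (v' ∈ I ∨ v' ∈ J) → s' ≤ s :=
      fun s' v' h1 h2 => hs2 s' ⟨v', h1, h2⟩
    obtain ⟨v, hv, hvIJ⟩ := hs1
    have hvI := hs s v hv hvIJ hmax
    refine h.sum_pos ht hy s ?_ ?_
    · intro s' hs' v' hv'
      by_contra hcon
      exact absurd (hmax s' v' hv' (by tauto)) (not_le.2 hs')
    · rcases h.wall s with hh | ⟨hh, -⟩ | ⟨hh, -⟩
      · exact absurd hvI (hh _ v hv).1
      · exact fun w hw => (hh w hw).1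
      · exact absurd hvI (hh v hv).1

variable (Q : DegenPieces P κ D)

noncomputable instance (i : Fin (m + 1)) : DecidableEq (Q.H i) := Classical.decEq _

theorem nextOld_inl (i : Fin (m + 1)) (h : Q.H i) :
    Q.nextOld (Sum.inl ⟨i, h⟩) = Sum.inl ⟨i, (Q.G i).next h⟩ := rfl

theorem inl_mem_old (z : Σ i, Q.H i) : (Sum.inl z : Q.Om) ∈ Q.gluing.old :=
  Q.mem_placed.2 ⟨z.1, z.2, rfl⟩

theorem pieceFun_eq_some {j : Fin m} {x : Q.Om} (hx : x ∈ Q.gluing.old)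
    (h : Q.pieceFun x = some j) : ∃ y, x = Sum.inl ⟨j.succ, y⟩ := by
  obtain ⟨i, y, rfl⟩ := Q.mem_placed.1 hx
  have : i = j.succ := toOpt_eq_some.1 h
  subst this
  exact ⟨y, rfl⟩

theorem pieceFun_eq_none {x : Q.Om} (hx : x ∈ Q.gluing.old)
    (h : Q.pieceFun x = none) : ∃ y, x = Sum.inl ⟨0, y⟩ := by
  obtain ⟨i, y, rfl⟩ := Q.mem_placed.1 hx
  have : i = 0 := toOpt_eq_none.1 h
  subst this
  exact ⟨y, rfl⟩

/-- The bipartite pieces have one face. -/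
theorem face_closed (j : Fin m) (T : Set Q.Om)
    (hT : ∀ x ∈ Q.gluing.old, Q.pieceFun x = some j → x ∈ T → Q.nextOld (Q.gluing.opp x) ∈ T)
    (x : Q.Om) (hx : x ∈ Q.gluing.old) (y : Q.Om) (hy : y ∈ Q.gluing.old)
    (hxj : Q.pieceFun x = some j) (hyj : Q.pieceFun y = some j) (hxT : x ∈ T) : y ∈ T := by
  obtain ⟨x, rfl⟩ := Q.pieceFun_eq_some hx hxj
  obtain ⟨y, rfl⟩ := Q.pieceFun_eq_some hy hyj
  refine Skips.mem_of_sameCycle (σ := (Q.G j.succ).face)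
    (T := {z | (Sum.inl ⟨j.succ, z⟩ : Q.Om) ∈ T}) ?_ (Q.oneFace j x y) hxT
  intro z hz
  exact hT _ (Q.inl_mem_old _) rfl hz

/-- The involution as a permutation. -/
def oppPerm : Equiv.Perm Q.Om := Function.Involutive.toPerm Q.oppFun Q.oppFun_oppFun

variable {Q} {σ : Equiv.Perm Q.Om} (hσ : Q.gluing.Glued Q.nextOld Q.pieceFun σ)
include hσ

/-- Vertex labels of different pieces are disjoint and the induced rotation preserves pieces, so
every vertex of the glued graph comes from exactly one vertex of one piece. This is what makes
`gluedVert` well defined. -/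
theorem sameCycle_inl {a b : Σ i, Q.H i} :
    σ.SameCycle (Sum.inl a) (Sum.inl b) ↔ (Q.G a.1).vert a.2 = (Q.G b.1).vert b.2 := by
  constructor
  · intro h
    have h1 := hσ.skip.sameCycle (Q.inl_mem_old a) (Q.inl_mem_old b) h
    have h2 := Skips.mem_of_sameCycle (T := {x : Q.Om | ∃ z : Σ i, Q.H i, x = Sum.inl z ∧
      (Q.G z.1).vert z.2 = (Q.G a.1).vert a.2}) ?_ h1 ⟨a, rfl, rfl⟩
    · obtain ⟨z, hz, hz'⟩ := h2
      obtain rfl := Sum.inl_injective hz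
      exact hz'.symm
    · rintro _ ⟨⟨i, z⟩, rfl, hz⟩
      exact ⟨⟨i, (Q.G i).next z⟩, rfl, ((Q.G i).vert_next z).trans hz⟩
  · intro h
    obtain ⟨i, a⟩ := a
    obtain ⟨k, b⟩ := b
    have : i = k := by rw [← Q.labelPiece_vert a, ← Q.labelPiece_vert b]; exact congrArg _ h
    subst this
    refine Skips.mem_of_sameCycle (σ := (Q.G i).next)
      (T := {z | σ.SameCycle (Sum.inl ⟨i, a⟩) (Sum.inl ⟨i, z⟩)}) ?_
      (((Q.G i).vert_eq_iff _ _).1 h) (SameCycle.refl _ _)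
    intro z hz
    exact hz.trans (hσ.skip.sameCycle_apply (Sum.inl ⟨i, z⟩))

theorem exists_rep (x : Q.Om) : ∃ z : Σ i, Q.H i, σ.SameCycle x (Sum.inl z) := by
  obtain ⟨y, hy, h⟩ := Gluing.Glued.hit Q.initialState hσ x
  obtain ⟨i, z, rfl⟩ := Q.mem_placed.1 hy
  exact ⟨⟨i, z⟩, h⟩

/-- The vertex label of a half-edge of the glued graph. -/
noncomputable def gluedVert (x : Q.Om) : Fin n :=
  (Q.G (exists_rep hσ x).choose.1).vert (exists_rep hσ x).choose.2

theorem gluedVert_of_sameCycle {x : Q.Om} {z : Σ i, Q.H i} (h : σ.SameCycle x (Sum.inl z)) :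
    gluedVert hσ x = (Q.G z.1).vert z.2 :=
  (sameCycle_inl hσ).1 ((exists_rep hσ x).choose_spec.symm.trans h)

theorem gluedVert_inl (z : Σ i, Q.H i) : gluedVert hσ (Sum.inl z) = (Q.G z.1).vert z.2 :=
  gluedVert_of_sameCycle hσ (SameCycle.refl _ _)

theorem gluedVert_eq_iff (x y : Q.Om) : gluedVert hσ x = gluedVert hσ y ↔ σ.SameCycle x y := by
  obtain ⟨a, ha⟩ := exists_rep hσ x
  obtain ⟨b, hb⟩ := exists_rep hσ y
  rw [gluedVert_of_sameCycle hσ ha, gluedVert_of_sameCycle hσ hb, ← sameCycle_inl hσ]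
  exact ⟨fun h => (ha.trans h).trans hb.symm, fun h => (ha.symm.trans h).trans hb⟩

/-- The graph glued from the pieces. -/
noncomputable def gluedGraph : RibbonGraph (Fin n) Q.Om where
  next := σ
  opp := Q.oppPerm
  opp_opp := Q.oppFun_oppFun
  opp_ne := by
    rintro (⟨i, h⟩ | ⟨j, c⟩) hh
    · have h1 : (Sum.inl ⟨i, (Q.G i).opp h⟩ : Q.Om) = Sum.inl ⟨i, h⟩ := hh
      exact (Q.G i).opp_ne h (by simpa using h1)
    · have h1 : (Sum.inr (j, !c) : Q.Om) = Sum.inr (j, c) := hh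
      simp at h1
  vert := gluedVert hσ
  vert_eq_iff := gluedVert_eq_iff hσ
  nonempty := by
    obtain ⟨h⟩ := (Q.G 0).nonempty
    exact ⟨Sum.inl ⟨0, h⟩⟩
  connected := fun h k => by
    refine Gluing.Glued.closed_eq_univ Q.initialState hσ
      (T := {k | Relation.ReflTransGen (fun x y => y = σ x ∨ y = Q.oppPerm x) h k}) ?_ ?_
      ⟨h, Relation.ReflTransGen.refl⟩ k
    · exact fun x hx => Relation.ReflTransGen.tail hx (Or.inl rfl)
    · exact fun x hx => Relation.ReflTransGen.tail hx (Or.inr rfl)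

/-- The graph glued from the pieces, with its labels. -/
noncomputable def gluedLabelled : WellLabelled n ℓ m Q.Om where
  graph := gluedGraph hσ
  face := Q.faceFun
  piece := labelPiece P D

theorem vert_inl (i : Fin (m + 1)) (z : Q.H i) :
    (gluedGraph hσ).vert (Sum.inl ⟨i, z⟩) = (Q.G i).vert z := gluedVert_inl hσ ⟨i, z⟩

theorem vert_surjective : Function.Surjective (gluedGraph hσ).vert := fun v => by
  obtain ⟨h, hh⟩ := Q.exists_vert v
  exact ⟨Sum.inl ⟨_, h⟩, (vert_inl hσ _ h).trans hh⟩

theorem sameCycle_of_vert_eq {x y : Q.Om} (h : (gluedGraph hσ).vert x = (gluedGraph hσ).vert y) :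
    σ.SameCycle x y := (gluedVert_eq_iff hσ x y).1 h

section Faces

variable (hl : ∀ x, Q.faceFun (σ x) = Q.faceFun (Q.gluing.opp x))
include hl

/-- Every face passes through the core (`exists_core_face`), and core half-edges in one face of the
core stay in one face after gluing (`face_old`). So the labels `F₀` on the core already separate the
faces. -/
theorem isFaceLabelling : (gluedGraph hσ).IsFaceLabelling Q.faceFun := by
  have hback : ∀ x y, (gluedGraph hσ).face.SameCycle x y → Q.faceFun y = Q.faceFun x :=
    fun x y hxy => Skips.apply_eq_of_sameCycle (fun z => by
      change Q.faceFun (σ (Q.gluing.opp z)) = _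
      rw [hl, Q.gluing.opp_opp]) hxy
  intro x y
  refine ⟨fun hxy => ?_, fun hxy => (hback x y hxy).symm⟩
  let f : Q.Om → Quotient (Equiv.Perm.SameCycle.setoid (gluedGraph hσ).face) := Quotient.mk _
  have hf : ∀ x, f (σ x) = f (Q.gluing.opp x) := fun x => by
    refine (Quotient.sound (?_ : (gluedGraph hσ).face.SameCycle (Q.gluing.opp x) (σ x))).symm
    refine ⟨1, ?_⟩
    change σ (Q.gluing.opp (Q.gluing.opp x)) = σ x
    rw [Q.gluing.opp_opp]
  have hc := Gluing.Glued.exists_core_face Q.initialState hσ hf Q.face_closed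
  obtain ⟨c, hc1, hc2, hc3⟩ := hc x
  obtain ⟨d, hd1, hd2, hd3⟩ := hc y
  obtain ⟨c, rfl⟩ := Q.pieceFun_eq_none hc1 hc2
  obtain ⟨d, rfl⟩ := Q.pieceFun_eq_none hd1 hd2
  have h1 : Q.F₀ c = Q.F₀ d :=
    (hback x _ (Quotient.exact hc3)).trans (hxy.trans (hback y _ (Quotient.exact hd3)).symm)
  have h2 := (Q.isFaceLabelling₀ c d).1 h1
  have h3 : f (Sum.inl ⟨0, d⟩) = f (Sum.inl ⟨0, c⟩) :=
    Skips.apply_eq_of_sameCycle (f := fun z => f (Sum.inl ⟨0, z⟩)) (fun z => by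
      have := Gluing.Glued.face_old Q.initialState hσ hf Q.face_closed
        (Q.inl_mem_old ⟨0, (Q.G 0).opp z⟩)
      change _ = f (Sum.inl ⟨0, (Q.G 0).opp ((Q.G 0).opp z)⟩) at this
      rw [(Q.G 0).opp_opp] at this
      exact this) h2
  exact Quotient.exact (hc3.trans (h3.symm.trans hd3.symm))

end Faces

end DegenPieces

/-! ### The degenerating edges of a glued graph are its joining edges. -/

namespace DegenPieces

variable {n p ℓ m : ℕ} {P : WallPartition n p} {κ : Fin ℓ → ℕ} {D : DegenIndex p ℓ m}
variable {Q : DegenPieces P κ D} {σ : Equiv.Perm Q.Om}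
  (hσ : Q.gluing.Glued Q.nextOld Q.pieceFun σ)
include hσ

theorem gluedGraph_opp (x : Q.Om) : (gluedGraph hσ).opp x = Q.gluing.opp x := rfl

theorem labelPiece_gluedVert (i : Fin (m + 1)) (z : Q.H i) :
    labelPiece P D ((gluedGraph hσ).vert (Sum.inl ⟨i, z⟩)) = i := by
  rw [vert_inl, Q.labelPiece_vert]

theorem exists_vert_eq {v : Fin n} {i : Fin (m + 1)} (hv : labelPiece P D v = i) :
    ∃ z : Q.H i, (gluedGraph hσ).vert (Sum.inl ⟨i, z⟩) = v := by
  obtain ⟨z, hz⟩ := Q.mem_range_vert.2 hv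
  exact ⟨z, (vert_inl hσ i z).trans hz⟩

/-- A side of a joining edge is a component of the complement of this edge that is bipartite. -/
theorem exists_isBipartiteSide (j : Fin m) {T : Set Q.Om} {χ : Q.Om → Bool}
    (hT : Q.gluing.IsSide σ j T χ) :
    ∃ I J : Finset (Fin n), (gluedGraph hσ).IsBipartiteSide (Sum.inr (j, false)) I J ∧
      (∀ x, (gluedGraph hσ).vert x ∈ I ↔ x ∈ T ∧ χ x = true) ∧
      ∀ x, (gluedGraph hσ).vert x ∈ J ↔ x ∈ T ∧ χ x = false := by
  classical
  have hcol : ∀ c : Bool, ∃ I : Finset (Fin n), ∀ x, (gluedGraph hσ).vert x ∈ I ↔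
      x ∈ T ∧ χ x = c := by
    intro c
    refine ⟨Finset.univ.filter fun v => ∃ x, (gluedGraph hσ).vert x = v ∧ x ∈ T ∧ χ x = c,
      fun x => ?_⟩
    simp only [Finset.mem_filter, Finset.mem_univ, true_and]
    constructor
    · rintro ⟨y, hy, hyT⟩
      exact Skips.mem_of_sameCycle (T := {x | x ∈ T ∧ χ x = c})
        (fun z hz => ⟨hT.next_mem z hz.1, (hT.color_next z hz.1).trans hz.2⟩)
        (sameCycle_of_vert_eq hσ hy) hyT
    · exact fun hx => ⟨x, rfl, hx⟩
  obtain ⟨I, hI⟩ := hcol true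
  obtain ⟨J, hJ⟩ := hcol false
  have hmem : ∀ x, ((gluedGraph hσ).vert x ∈ I ∨ (gluedGraph hσ).vert x ∈ J) ↔ x ∈ T := by
    intro x
    rw [hI, hJ, ← and_or_left]
    cases χ x <;> simp
  refine ⟨I, J, ⟨fun v => ?_, ?_, ?_, ?_, ?_, ?_⟩, hI, hJ⟩
  · obtain ⟨x, rfl⟩ := vert_surjective hσ v
    rw [hmem]
    constructor
    · intro hx
      refine hT.minimal {y | (gluedGraph hσ).Reach
        {Sum.inr (j, false), (gluedGraph hσ).opp (Sum.inr (j, false))}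
        ((gluedGraph hσ).vert (Sum.inr (j, false))) ((gluedGraph hσ).vert y)}
        Relation.ReflTransGen.refl ?_ ?_ hx
      · intro y hy
        have h1 := (gluedGraph hσ).vert_next y
        have h2 : (gluedGraph hσ).next y = σ y := rfl
        rw [h2] at h1
        rwa [Set.mem_ofPred_eq, h1]
      · intro y hy h1 h2
        refine RibbonGraph.Reach.opp hy ?_
        rintro (h | h)
        · exact h1 h
        · exact h2 h
    · intro hr
      have := RibbonGraph.mem_of_reach (T := {v | v ∈ I ∨ v ∈ J}) ?_ hr ((hmem _).2 hT.base_mem)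
      · exact (hmem x).1 this
      · intro y hy hyT
        refine (hmem _).2 (hT.opp_mem y ((hmem y).1 hyT) ?_)
        rintro rfl
        exact hy (Or.inl rfl)
  · rw [Finset.disjoint_left]
    intro v h1 h2
    obtain ⟨x, rfl⟩ := vert_surjective hσ v
    have h1 := ((hI x).1 h1).2
    rw [((hJ x).1 h2).2] at h1
    exact absurd h1 (by simp)
  · exact (hI _).2 ⟨hT.base_mem, hT.color_base⟩
  · exact fun h => hT.opp_notMem ((hJ _).1 h).1
  · intro x hx _ hxI
    obtain ⟨h1, h2⟩ := (hI x).1 hxI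
    exact (hJ _).2 ⟨hT.opp_mem x h1 hx, by
      rw [gluedGraph_opp, hT.color_opp x h1 hx, h2]; rfl⟩
  · intro x hx _ hxJ
    obtain ⟨h1, h2⟩ := (hJ x).1 hxJ
    exact (hI _).2 ⟨hT.opp_mem x h1 hx, by
      rw [gluedGraph_opp, hT.color_opp x h1 hx, h2]; rfl⟩

/-- The two colour classes of the side colour whole pieces, so the weight vanishes on the wall. The
sign condition of `IsSide` is the criterion of `ColorsPieces.pos_iff`, which holds for every `t` at
once. -/
theorem inr_mem_degenerating (hκ : ∀ i, Odd (κ i)) {b : Fin n → ℝ} (hb : b ∈ P.wall)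
    {γ : ℝ → Fin n → ℝ} (hγ : ∀ t ∈ Set.Ioc (0 : ℝ) 1, ∀ s : Fin p,
      wallForm (P.I s false) (P.I s true) (γ t) = 2 ^ ((s : ℕ) + 1) * t) (j : Fin m) (c : Bool) :
    (Sum.inr (j, c) : Q.Om) ∈ (gluedGraph hσ).degenerating b γ := by
  classical
  obtain ⟨T, χ, hT⟩ := hσ.side j
  obtain ⟨I, J, hIJ, hI, hJ⟩ := exists_isBipartiteSide hσ j hT
  have hmem : ∀ x, ((gluedGraph hσ).vert x ∈ I ∨ (gluedGraph hσ).vert x ∈ J) ↔ x ∈ T := by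
    intro x
    rw [hI, hJ, ← and_or_left]
    cases χ x <;> simp
  have hcol : ColorsPieces P D I J := by
    intro i
    refine Q.dichotomy hκ hIJ.disjoint i (fun h hh => ?_) fun h hh => ?_
    · rw [← vert_inl hσ] at hh ⊢
      exact hIJ.black (Sum.inl ⟨i, h⟩) (by simp) (by simp [gluedGraph_opp, gluing, oppFun]) hh
    · rw [← vert_inl hσ] at hh ⊢
      exact hIJ.white (Sum.inl ⟨i, h⟩) (by simp) (by simp [gluedGraph_opp, gluing, oppFun]) hh
  have hopp : (gluedGraph hσ).vert ((gluedGraph hσ).opp (Sum.inr (j, false))) ∉ I :=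
    fun hh => hT.opp_notMem ((hI _).1 hh).1
  refine ⟨fun b => ∑ v ∈ I, b v - ∑ v ∈ J, b v, ⟨Sum.inr (j, false), ?_, I, J, hIJ, ?_⟩,
    hcol.sum_wall hb, fun t ht => (hcol.pos_iff ht.1 (hγ t ht) hIJ.disjoint ?_).2 ?_⟩
  · cases c
    · exact Or.inl rfl
    · exact Or.inr rfl
  · funext b
    rw [if_neg hopp, one_mul]
  · obtain ⟨v, hv⟩ := P.nonempty (maxIndex D j) false
    refine ⟨maxIndex D j, v, hv, ?_⟩
    obtain ⟨z, rfl⟩ := exists_vert_eq hσ ((labelPiece_of_mem hv).trans (A_maxIndex j))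
    exact (hmem _).2 (Gluing.Glued.piece_subset Q.initialState hσ hT hT.base_mem
      (Q.inl_mem_old _) rfl)
  · intro s v hv hvIJ hmax
    obtain ⟨i, hi⟩ : ∃ i, labelPiece P D v = i := ⟨_, rfl⟩
    obtain ⟨z, rfl⟩ := exists_vert_eq hσ hi
    have hz : (Sum.inl ⟨_, z⟩ : Q.Om) ∈ Q.gluing.Z s := ⟨_, z, rfl, by rwa [← vert_inl hσ]⟩
    refine (hI _).2 ⟨(hmem _).1 hvIJ, hT.sign s _ hz ((hmem _).1 hvIJ) ?_⟩
    rintro s' _ ⟨i', z', rfl, hz'⟩ hzT'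
    rw [← vert_inl hσ] at hz'
    exact hmax s' _ hz' ((hmem _).2 hzT')

/-- The part of a component of the complement of an edge of a piece that lies in this piece is a
component in this piece. -/
theorem reach_of_reach {i : Fin (m + 1)} (k : Q.H i) {v : Fin n} (hv : labelPiece P D v = i)
    (h : (gluedGraph hσ).Reach {(Sum.inl ⟨i, k⟩ : Q.Om), (gluedGraph hσ).opp (Sum.inl ⟨i, k⟩)}
      ((gluedGraph hσ).vert (Sum.inl ⟨i, k⟩)) v) :
    (Q.G i).Reach {k, (Q.G i).opp k} ((Q.G i).vert k) v := by
  classical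
  choose T χ hT using hσ.side
  set R : Set Q.Om := {y | ∃ z : Q.H i, σ.SameCycle y (Sum.inl ⟨i, z⟩) ∧
    (Q.G i).Reach {k, (Q.G i).opp k} ((Q.G i).vert k) ((Q.G i).vert z)} with hR
  -- `Y` adds to the component `R` inside the piece all that hangs on it: the sides of the children
  -- attached at `R`, and the complement of the own side if the lower end of the piece sits at `R`.
  -- A path that leaves through a joining edge can only come back through it, so `Y` is closed and
  -- meets the piece only in `R`.
  set Y : Set Q.Om := {y | y ∈ R ∨ (∃ j, Q.gluing.opp (Q.gluing.e j) ∈ R ∧ y ∈ T j) ∨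
    ∃ j, i = j.succ ∧ Q.gluing.e j ∈ R ∧ y ∉ T j} with hY
  have hRσ : ∀ {x y}, σ.SameCycle x y → x ∈ R → y ∈ R := by
    rintro x y hxy ⟨z, hz, hz'⟩
    exact ⟨z, hxy.symm.trans hz, hz'⟩
  have hTσ : ∀ j {x y}, σ.SameCycle x y → x ∈ T j → y ∈ T j := fun j x y hxy =>
    Skips.mem_of_sameCycle (hT j).next_mem hxy
  have hYσ : ∀ {x y}, σ.SameCycle x y → x ∈ Y → y ∈ Y := by
    rintro x y hxy (hx | ⟨j, h1, h2⟩ | ⟨j, h1, h2, h3⟩)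
    · exact Or.inl (hRσ hxy hx)
    · exact Or.inr (Or.inl ⟨j, h1, hTσ j hxy h2⟩)
    · exact Or.inr (Or.inr ⟨j, h1, h2, fun hh => h3 (hTσ j hxy.symm hh)⟩)
  have hYopp : ∀ x ∈ Y, x ≠ Sum.inl ⟨i, k⟩ → x ≠ Q.gluing.opp (Sum.inl ⟨i, k⟩) →
      Q.gluing.opp x ∈ Y := by
    rintro x (hx | ⟨j, h1, h2⟩ | ⟨j, h1, h2, h3⟩) hxk hxk'
    · rcases x with ⟨i', x⟩ | ⟨j, c⟩
      · obtain ⟨z, hz, hz'⟩ := hx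
        have h1 := (sameCycle_inl hσ).1 hz
        have h2 : i' = i := by
          rw [← Q.labelPiece_vert x, ← Q.labelPiece_vert z]; exact congrArg _ h1
        subst h2
        refine Or.inl ⟨(Q.G i').opp x, SameCycle.refl _ _, ?_⟩
        refine RibbonGraph.Reach.opp (h1 ▸ hz') ?_
        rintro (rfl | rfl)
        · exact hxk rfl
        · exact hxk' rfl
      · cases c
        · refine Or.inr (Or.inr ⟨j, ?_, hx, (hT j).opp_notMem⟩)
          obtain ⟨y, hy, hyq, hyc⟩ := hσ.hit₀ j
          obtain ⟨y, rfl⟩ := Q.pieceFun_eq_some hy hyq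
          obtain ⟨z, hz, -⟩ := hx
          have h1 := (sameCycle_inl hσ).1 (hz.symm.trans hyc)
          rw [← Q.labelPiece_vert y, ← Q.labelPiece_vert z]; exact congrArg _ h1
        · exact Or.inr (Or.inl ⟨j, hx, (hT j).base_mem⟩)
    · by_cases hxe : x = Q.gluing.e j
      · subst hxe
        exact Or.inl h1
      · exact Or.inr (Or.inl ⟨j, h1, (hT j).opp_mem x h2 hxe⟩)
    · by_cases hxe : Q.gluing.opp x ∈ T j
      · by_cases hxe' : Q.gluing.opp x = Q.gluing.e j
        · rw [hxe']
          exact Or.inl h2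
        · have := (hT j).opp_mem _ hxe hxe'
          rw [Q.gluing.opp_opp] at this
          exact absurd this h3
      · exact Or.inr (Or.inr ⟨j, h1, h2, hxe⟩)
  have hbase : (Sum.inl ⟨i, k⟩ : Q.Om) ∈ Y :=
    Or.inl ⟨k, SameCycle.refl _ _, Relation.ReflTransGen.refl⟩
  obtain ⟨z, rfl⟩ := exists_vert_eq hσ hv
  have hz := RibbonGraph.mem_of_reach (T := {v | ∀ y, (gluedGraph hσ).vert y = v → y ∈ Y}) ?_ h
    (fun y hy => hYσ (sameCycle_of_vert_eq hσ hy).symm hbase) _ rfl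
  · rw [vert_inl]
    rcases hz with ⟨z', h1, h2⟩ | ⟨j, ⟨z', h1, h2⟩, h3⟩ | ⟨j, rfl, h2, h3⟩
    · rwa [(sameCycle_inl hσ).1 h1]
    · refine absurd (hTσ j h1.symm ?_) (hT j).opp_notMem
      exact Q.initialState.mem_side hσ.skip (Finset.mem_univ j) (hT j) (Q.inl_mem_old ⟨i, z⟩)
        (Q.inl_mem_old _) rfl h3
    · exact absurd (Gluing.Glued.piece_subset Q.initialState hσ (hT j) (hT j).base_mem
        (Q.inl_mem_old _) rfl) h3
  · intro y hy hyY w hw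
    refine hYσ (sameCycle_of_vert_eq hσ hw).symm (hYopp y (hyY y rfl) ?_ ?_)
    · rintro rfl
      exact hy (Or.inl rfl)
    · rintro rfl
      exact hy (Or.inr rfl)

theorem reach_of_reach_piece {i : Fin (m + 1)} (k : Q.H i) {v : Fin n}
    (h : (Q.G i).Reach {k, (Q.G i).opp k} ((Q.G i).vert k) v) :
    labelPiece P D v = i ∧
    (gluedGraph hσ).Reach {(Sum.inl ⟨i, k⟩ : Q.Om), (gluedGraph hσ).opp (Sum.inl ⟨i, k⟩)}
      ((gluedGraph hσ).vert (Sum.inl ⟨i, k⟩)) v := by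
  refine RibbonGraph.mem_of_reach (T := {v | labelPiece P D v = i ∧ (gluedGraph hσ).Reach
    {(Sum.inl ⟨i, k⟩ : Q.Om), (gluedGraph hσ).opp (Sum.inl ⟨i, k⟩)}
      ((gluedGraph hσ).vert (Sum.inl ⟨i, k⟩)) v}) ?_ h
      ⟨Q.labelPiece_vert k, by rw [vert_inl]; exact Relation.ReflTransGen.refl⟩
  rintro x hx ⟨-, hx'⟩
  refine ⟨Q.labelPiece_vert _, ?_⟩
  rw [← vert_inl hσ] at hx' ⊢
  refine RibbonGraph.Reach.opp hx' ?_
  rintro (hh | hh)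
  · exact hx (Or.inl (by simpa using hh))
  · refine hx (Or.inr ?_)
    have hh : (Sum.inl ⟨i, x⟩ : Q.Om) = Sum.inl ⟨i, (Q.G i).opp k⟩ := hh
    simpa using hh

/-- A side of an edge of the piece `i` restricts to a side of the same edge in `Q.G i`. At `b` the
two weights agree, and that in the piece is not zero. -/
theorem inl_notMem_degenerating (hκ : ∀ i, Odd (κ i)) {b : Fin n → ℝ} (hb : b ∈ P.wall)
    (γ : ℝ → Fin n → ℝ) (hQ : ∀ i h f, (Q.G i).HasStaticWeight h f → f b ≠ 0)
    (z : Σ i, Q.H i) : (Sum.inl z : Q.Om) ∉ (gluedGraph hσ).degenerating b γ := by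
  classical
  rintro ⟨f, ⟨k, hk, I, J, hIJ, rfl⟩, hfb, -⟩
  obtain ⟨i, z⟩ := z
  obtain ⟨k, rfl⟩ : ∃ k' : Q.H i, k = Sum.inl ⟨i, k'⟩ := by
    rcases hk with rfl | rfl
    · exact ⟨z, rfl⟩
    · exact ⟨(Q.G i).opp z, rfl⟩
  have hopp : ∀ x : Q.H i, (gluedGraph hσ).opp (Sum.inl ⟨i, x⟩) = Sum.inl ⟨i, (Q.G i).opp x⟩ :=
    fun _ => rfl
  have hvert : ∀ x : Q.H i, (gluedGraph hσ).vert (Sum.inl ⟨i, x⟩) = (Q.G i).vert x :=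
    fun x => vert_inl hσ i x
  have hlab : ∀ x : Q.H i, labelPiece P D ((Q.G i).vert x) = i := fun x => Q.labelPiece_vert x
  set I' := I.filter fun v => labelPiece P D v = i with hI'
  set J' := J.filter fun v => labelPiece P D v = i with hJ'
  have hIm : ∀ x : Q.H i, (Q.G i).vert x ∈ I' ↔ (gluedGraph hσ).vert (Sum.inl ⟨i, x⟩) ∈ I := by
    intro x; simp [hI', hlab, hvert]
  have hJm : ∀ x : Q.H i, (Q.G i).vert x ∈ J' ↔ (gluedGraph hσ).vert (Sum.inl ⟨i, x⟩) ∈ J := by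
    intro x; simp [hJ', hlab, hvert]
  have hside : (Q.G i).IsBipartiteSide k I' J' := by
    refine ⟨fun v => ?_, ?_, (hIm k).2 hIJ.base, ?_, ?_, ?_⟩
    · rw [hI', hJ', Finset.mem_filter, Finset.mem_filter, ← or_and_right, hIJ.component]
      constructor
      · rintro ⟨h1, h2⟩
        exact reach_of_reach hσ k h2 h1
      · intro h
        exact (reach_of_reach_piece hσ k h).symm
    · exact (hIJ.disjoint.mono (Finset.filter_subset _ _) (Finset.filter_subset _ _))
    · rw [hJm]
      exact hIJ.other_end
    · intro x hx hx' hxI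
      rw [hJm]
      exact hIJ.black (Sum.inl ⟨i, x⟩) (by simpa using hx) (by simpa [hopp] using hx')
        ((hIm x).1 hxI)
    · intro x hx hx' hxJ
      rw [hIm]
      exact hIJ.white (Sum.inl ⟨i, x⟩) (by simpa using hx) (by simpa [hopp] using hx')
        ((hJm x).1 hxJ)
  refine hQ i k _ ⟨k, Or.inl rfl, I', J', hside, rfl⟩ ?_
  -- Every other piece contains no half of this edge, so it is coloured as a whole or missed, and
  -- contributes nothing at a point of the wall.
  have hrest : ColorsPieces P D (I.filter fun v => labelPiece P D v ≠ i)
      (J.filter fun v => labelPiece P D v ≠ i) := by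
    intro i'
    by_cases hi : i' = i
    · subst hi
      left
      intro v hv
      simp [hv]
    · refine Q.dichotomy hκ
        (hIJ.disjoint.mono (Finset.filter_subset _ _) (Finset.filter_subset _ _)) i' ?_ ?_
      · intro x hx
        rw [Finset.mem_filter, Q.labelPiece_vert, ← vert_inl hσ] at hx ⊢
        refine ⟨hIJ.black (Sum.inl ⟨i', x⟩) ?_ ?_ hx.1, hi⟩
        · intro hh; exact hi (congrArg Sigma.fst (Sum.inl_injective hh))
        · intro hh; exact hi (congrArg Sigma.fst (Sum.inl_injective hh))
      · intro x hx
        rw [Finset.mem_filter, Q.labelPiece_vert, ← vert_inl hσ] at hx ⊢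
        refine ⟨hIJ.white (Sum.inl ⟨i', x⟩) ?_ ?_ hx.1, hi⟩
        · intro hh; exact hi (congrArg Sigma.fst (Sum.inl_injective hh))
        · intro hh; exact hi (congrArg Sigma.fst (Sum.inl_injective hh))
  have h0 := hrest.sum_wall hb
  have hsI := Finset.sum_filter_add_sum_filter_not I (fun v => labelPiece P D v = i) b
  have hsJ := Finset.sum_filter_add_sum_filter_not J (fun v => labelPiece P D v = i) b
  have hsum : ∑ v ∈ I', b v - ∑ v ∈ J', b v = ∑ v ∈ I, b v - ∑ v ∈ J, b v := by
    rw [hI', hJ']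
    linarith
  have hif : (Q.G i).vert ((Q.G i).opp k) ∈ I' ↔
      (gluedGraph hσ).vert ((gluedGraph hσ).opp (Sum.inl ⟨i, k⟩)) ∈ I := hIm _
  simp only [hsum, hif]
  convert hfb

theorem degenerating_eq (hκ : ∀ i, Odd (κ i)) {b : Fin n → ℝ} (hb : b ∈ P.wall)
    {γ : ℝ → Fin n → ℝ} (hγ : ∀ t ∈ Set.Ioc (0 : ℝ) 1, ∀ s : Fin p,
      wallForm (P.I s false) (P.I s true) (γ t) = 2 ^ ((s : ℕ) + 1) * t)
    (hQ : ∀ i h f, (Q.G i).HasStaticWeight h f → f b ≠ 0) :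
    (gluedGraph hσ).degenerating b γ = Set.range Sum.inr := by
  ext x
  rcases x with z | ⟨j, c⟩
  · simp [inl_notMem_degenerating hσ hκ hb γ hQ z]
  · simp [inr_mem_degenerating hσ hκ hb hγ j c]

end DegenPieces

/-! ### Genus, faces and pieces of a glued graph. -/

namespace DegenPieces

variable {n p ℓ m : ℕ} {P : WallPartition n p} {κ : Fin ℓ → ℕ} {D : DegenIndex p ℓ m}

variable (Q : DegenPieces P κ D)

theorem faceCard_eq (f : Fin ℓ) : Nat.card {x // Q.faceFun x = f} = κ f := by
  classical
  rw [← Q.labCard_eq f, Gluing.labCard, Nat.card_eq_fintype_card, Fintype.card_subtype]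
  congr!

theorem sum_ncard_range_vert : ∑ i, (Set.range (Q.G i).vert).ncard = n := by
  classical
  have h : ∀ i, (Set.range (Q.G i).vert).ncard =
      (Finset.univ.filter fun v => labelPiece P D v = i).card := by
    intro i
    rw [← Set.ncard_coe_finset]
    congr 1
    ext v
    simp only [Finset.coe_filter, Finset.mem_univ, true_and]
    exact Q.mem_range_vert
  simp only [h]
  rw [← Finset.card_eq_sum_card_fiberwise (fun _ _ => by simp), Finset.card_univ, Fintype.card_fin]

theorem card_Om_eq : Nat.card Q.Om / 2 = ∑ i, Nat.card (Q.H i) / 2 + m := by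
  have h1 : Nat.card Q.Om = ∑ i, Nat.card (Q.H i) + 2 * m := by
    classical
    simp only [Nat.card_eq_fintype_card, Fintype.card_sum, Fintype.card_sigma, Fintype.card_prod,
      Fintype.card_fin, Fintype.card_bool]
    ring
  have h2 : ∑ i, Nat.card (Q.H i) = 2 * ∑ i, Nat.card (Q.H i) / 2 := by
    rw [Finset.mul_sum]
    exact Finset.sum_congr rfl fun i _ => (Nat.mul_div_cancel' (Q.G i).even_card).symm
  rw [h1, h2]
  omega

theorem F₀_surjective : Function.Surjective Q.F₀ := fun f => by
  have h := Q.kappa₀_pos f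
  rw [← Q.degree₀ f] at h
  have h' : 0 < Nat.card {x // Q.F₀ x = f} := by exact_mod_cast h
  obtain ⟨⟨x, hx⟩⟩ := (Nat.card_pos_iff.1 h').1
  exact ⟨x, hx⟩

theorem faceFun_surjective : Function.Surjective Q.faceFun := fun f => by
  obtain ⟨x, hx⟩ := Q.F₀_surjective f
  exact ⟨Sum.inl ⟨0, x⟩, hx⟩

variable {Q} {σ : Equiv.Perm Q.Om} (hσ : Q.gluing.Glued Q.nextOld Q.pieceFun σ)
include hσ

/-- In the sum of Euler's relations of the pieces, gluing adds `m` edges and makes the `m` faces of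
the one-faced pieces disappear into faces of the core. -/
theorem hasGenus (hl : ∀ x, Q.faceFun (σ x) = Q.faceFun (Q.gluing.opp x)) :
    (gluedGraph hσ).HasGenus (∑ i, D.g i) := by
  have h0 := (Q.isFaceLabelling₀).card Q.F₀_surjective
  have hj : ∀ j : Fin m, Nat.card (Quotient (Equiv.Perm.SameCycle.setoid (Q.G j.succ).face)) = 1 := by
    intro j
    have h1 : (Q.G j.succ).IsFaceLabelling (fun _ => ()) := fun h k => by simp [Q.oneFace j h k]
    rw [h1.card fun _ => ⟨(Q.G j.succ).nonempty.some, rfl⟩]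
    simp
  have hsum := Finset.sum_congr rfl fun i (_ : i ∈ Finset.univ) => Q.genus i
  unfold RibbonGraph.HasGenus
  rw [(isFaceLabelling hσ hl).card Q.faceFun_surjective, Nat.card_fin,
    (vert_surjective hσ).range_eq, Set.ncard_univ, Nat.card_fin, Q.card_Om_eq]
  rw [Finset.sum_add_distrib, Finset.sum_sub_distrib, Finset.sum_sub_distrib, ← Finset.mul_sum,
    Fin.sum_univ_succ (fun i => (Nat.card (Quotient (SameCycle.setoid (Q.G i).face)) : ℤ)), h0] at hsum
  simp only [hj] at hsum
  have h1 := Q.sum_ncard_range_vert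
  zify at h1
  rw [h1] at hsum
  simp only [Nat.card_eq_fintype_card, Fintype.card_fin, Nat.cast_one, Finset.sum_const,
    Finset.card_univ, nsmul_eq_mul, mul_one] at hsum
  simp only [Nat.card_eq_fintype_card]
  push_cast at hsum ⊢
  linarith

theorem reach_iff (u v : Fin n) : labelPiece P D u = labelPiece P D v ↔
    (gluedGraph hσ).Reach (Set.range Sum.inr) u v := by
  constructor
  · intro h
    obtain ⟨i, hi⟩ : ∃ i, labelPiece P D v = i := ⟨_, rfl⟩
    obtain ⟨x, rfl⟩ := exists_vert_eq hσ (h.trans hi)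
    obtain ⟨y, rfl⟩ := exists_vert_eq hσ hi
    refine (Q.G _).mem_of_closed (T := {z | (gluedGraph hσ).Reach (Set.range Sum.inr)
      ((gluedGraph hσ).vert (Sum.inl ⟨_, x⟩)) ((gluedGraph hσ).vert (Sum.inl ⟨_, z⟩))}) ?_ ?_
      (x := x) Relation.ReflTransGen.refl y
    · intro z hz
      rw [Set.mem_ofPred_eq, vert_inl hσ i ((Q.G i).next z), RibbonGraph.vert_next, ← vert_inl hσ]
      exact hz
    · intro z hz
      exact RibbonGraph.Reach.opp hz (by simp)
  · intro h
    refine (RibbonGraph.mem_of_reach (T := {v | labelPiece P D u = labelPiece P D v}) ?_ h rfl)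
    rintro (⟨i, x⟩ | x) hx hu
    · rw [Set.mem_ofPred_eq, labelPiece_gluedVert] at hu
      rw [Set.mem_ofPred_eq, hu]
      exact (labelPiece_gluedVert hσ i ((Q.G i).opp x)).symm
    · exact absurd ⟨x, rfl⟩ hx

theorem isPiece_inl (i : Fin (m + 1)) : (gluedGraph hσ).IsPiece (Set.range Sum.inr)
    {v | labelPiece P D v = i} (Q.G i) (fun x => Sum.inl ⟨i, x⟩) := by
  refine ⟨fun x y h => by simpa using h, ?_, vert_inl hσ i, fun x => rfl, fun x => ?_⟩
  · ext x
    constructor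
    · rintro ⟨x, rfl⟩
      exact ⟨by simp, labelPiece_gluedVert hσ i x⟩
    · rcases x with ⟨k, x⟩ | x
      · rintro ⟨-, hx⟩
        rw [Set.mem_ofPred_eq, labelPiece_gluedVert] at hx
        subst hx
        exact ⟨x, rfl⟩
      · rintro ⟨hx, -⟩
        exact absurd ⟨x, rfl⟩ hx
  · obtain ⟨k, hk, hk'⟩ := hσ.skip.ret _ (Q.inl_mem_old ⟨i, x⟩)
    refine ⟨k, hk, fun j hj => ?_⟩
    rcases h : (σ ^ (j + 1)) (Sum.inl ⟨i, x⟩) with z | z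
    · exact absurd (h ▸ Q.inl_mem_old z) (hk' j hj)
    · exact ⟨z, h.symm⟩

theorem gluedLabelled_degeneratesTo (hκ : ∀ i, Odd (κ i)) (hm : 1 ≤ m) {b : Fin n → ℝ}
    (hb : b ∈ P.wall)
    {γ : ℝ → Fin n → ℝ} (hγ : ∀ t ∈ Set.Ioc (0 : ℝ) 1, ∀ s : Fin p,
      wallForm (P.I s false) (P.I s true) (γ t) = 2 ^ ((s : ℕ) + 1) * t)
    (hQ : ∀ i h f, (Q.G i).HasStaticWeight h f → f b ≠ 0)
    (hl : ∀ x, Q.faceFun (σ x) = Q.faceFun (Q.gluing.opp x)) :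
    (gluedLabelled hσ).DegeneratesTo (∑ i, D.g i) b γ Q := by
  have hdeg := degenerating_eq hσ hκ hb hγ hQ
  have hpiece : ∀ i, (gluedLabelled hσ).graph.IsPiece
      ((gluedLabelled hσ).graph.degenerating b γ)
      {v | (gluedLabelled hσ).piece v = i} (Q.G i) (fun x => Sum.inl ⟨i, x⟩) := by
    intro i
    have := isPiece_inl hσ i
    rw [← hdeg] at this
    exact this
  refine ⟨hasGenus hσ hl, vert_surjective hσ, isFaceLabelling hσ hl, Q.faceCard_eq, ?_, ?_, ?_,
    ⟨_, hpiece 0, fun _ => rfl⟩, fun j => ⟨_, hpiece j.succ, fun _ => rfl⟩⟩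
  · exact ⟨_, inr_mem_degenerating hσ hκ hb hγ ⟨0, hm⟩ false⟩
  · intro u v
    change _ ↔ (gluedGraph hσ).Reach ((gluedGraph hσ).degenerating b γ) u v
    rw [hdeg]
    exact reach_iff hσ u v
  · intro i
    obtain ⟨x⟩ := (Q.G i).nonempty
    exact ⟨_, labelPiece_gluedVert hσ i x⟩

end DegenPieces

/-! ### Bridges whose side avoids the core. -/

namespace DegenPieces

variable {n p ℓ m : ℕ} {P : WallPartition n p} {κ : Fin ℓ → ℕ} {D : DegenIndex p ℓ m}

variable (P D) in
/-- A set of vertices that is connected to its complement by the edge of `k` only, and that does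
not meet the core. -/
structure AvoidsCore {H : Type*} (G : RibbonGraph (Fin n) H) (k : H) (S : Set (Fin n)) : Prop where
  base_mem : G.vert k ∈ S
  opp_mem : ∀ x, G.vert x ∈ S → x ≠ k → G.vert (G.opp x) ∈ S
  core : ∀ v, labelPiece P D v = 0 → v ∉ S

/-- If the edges were different, each would lead from its own set into the other one at worst. The
union of the two sets would be closed, hence everything, although neither meets the core. -/
theorem AvoidsCore.eq {H : Type*} {G : RibbonGraph (Fin n) H} {k k' : H} {S S' : Set (Fin n)}
    (h : AvoidsCore P D G k S) (h' : AvoidsCore P D G k' S')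
    (hc : ∃ x, labelPiece P D (G.vert x) = 0) (hk : G.vert k ∈ S') (hk' : G.vert k' ∈ S) :
    k = k' := by
  by_contra hne
  obtain ⟨x, hx⟩ := hc
  have hcl := G.mem_of_closed (T := {x | G.vert x ∈ S ∨ G.vert x ∈ S'}) ?_ ?_
    (Or.inl h.base_mem) x
  · exact hcl.elim (h.core _ hx) (h'.core _ hx)
  · intro y hy
    rwa [Set.mem_ofPred_eq, G.vert_next]
  · intro y hy
    by_cases hy1 : y = k
    · subst hy1
      exact Or.inr (h'.opp_mem _ hk hne)
    · by_cases hy2 : y = k'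
      · subst hy2
        exact Or.inl (h.opp_mem _ hk' hy1)
      · exact hy.imp (fun hh => h.opp_mem _ hh hy1) (fun hh => h'.opp_mem _ hh hy2)

theorem ColorsPieces.mem_of_mem {I J : Finset (Fin n)} (h : ColorsPieces P D I J) {u v : Fin n}
    (huv : labelPiece P D u = labelPiece P D v) (hu : u ∈ I ∨ u ∈ J) : v ∈ I ∨ v ∈ J := by
  rcases h (labelPiece P D v) with hh | ⟨j, c, -, hh⟩
  · have := hh u huv
    tauto
  · rw [(hh v rfl).1, (hh v rfl).2]
    cases xor c (decide (v ∈ D.black P (labelPiece P D v))) <;> simp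

theorem ColorsPieces.core_notMem {I J : Finset (Fin n)} (h : ColorsPieces P D I J) {v : Fin n}
    (hv : labelPiece P D v = 0) : v ∉ I ∧ v ∉ J := by
  rcases h 0 with hh | ⟨j, c, hj, -⟩
  · exact hh v hv
  · exact absurd hj.symm (Fin.succ_ne_zero j)

section Side

variable (Q : DegenPieces P κ D) {H : Type*} {G : RibbonGraph (Fin n) H}
  {ι : ∀ i, Q.H i → H} (hv : ∀ i x, G.vert (ι i x) = (Q.G i).vert x)
  (ho : ∀ i x, G.opp (ι i x) = ι i ((Q.G i).opp x)) {k : H} {I J : Finset (Fin n)}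
  (h : G.IsBipartiteSide k I J) (hk : ∀ i x, ι i x ≠ k)
include hv ho h hk

theorem colorsPieces_of_side (hκ : ∀ i, Odd (κ i)) : ColorsPieces P D I J := by
  have hk' : ∀ i x, ι i x ≠ G.opp k := fun i x hh => hk i ((Q.G i).opp x) (by
    rw [← ho, hh, G.opp_opp])
  intro i
  refine Q.dichotomy hκ h.disjoint i (fun x hx => ?_) fun x hx => ?_
  · rw [← hv] at hx ⊢
    rw [← ho]
    exact h.black _ (hk i x) (hk' i x) hx
  · rw [← hv] at hx ⊢
    rw [← ho]
    exact h.white _ (hk i x) (hk' i x) hx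

/-- If both ends were on the side, the side would be the whole graph and contain the core. Such an
edge is therefore a bridge, and the factor 1/2 in its weight does not occur. -/
theorem side_opp_notMem (hκ : ∀ i, Odd (κ i)) : G.vert (G.opp k) ∉ I ∧ G.vert (G.opp k) ∉ J := by
  refine ⟨fun hI => ?_, h.other_end⟩
  obtain ⟨x⟩ := (Q.G 0).nonempty
  have hc := (colorsPieces_of_side Q hv ho h hk hκ).core_notMem (Q.labelPiece_vert x)
  have hcl := G.mem_of_closed (T := {x | G.vert x ∈ I ∨ G.vert x ∈ J}) ?_ ?_
    (Or.inl h.base) (ι 0 x)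
  · rw [Set.mem_ofPred_eq, hv] at hcl
    exact hcl.elim hc.1 hc.2
  · intro y hy
    rwa [Set.mem_ofPred_eq, G.vert_next]
  · intro y hy
    by_cases hy1 : y = k
    · subst hy1
      exact Or.inl hI
    · by_cases hy2 : y = G.opp k
      · subst hy2
        rw [Set.mem_ofPred_eq, G.opp_opp]
        exact Or.inl h.base
      · exact hy.symm.imp (fun hh => h.white _ hy1 hy2 hh) (fun hh => h.black _ hy1 hy2 hh)

theorem avoidsCore_of_side (hκ : ∀ i, Odd (κ i)) :
    AvoidsCore P D G k {v | v ∈ I ∨ v ∈ J} := by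
  refine ⟨Or.inl h.base, fun x hx hxk => ?_, fun v hv0 => ?_⟩
  · have h2 : x ≠ G.opp k := by
      rintro rfl
      have := side_opp_notMem Q hv ho h hk hκ
      exact hx.elim this.1 this.2
    exact hx.symm.imp (fun hh => h.white _ hxk h2 hh) (fun hh => h.black _ hxk h2 hh)
  · have := (colorsPieces_of_side Q hv ho h hk hκ).core_notMem hv0
    exact fun hh => hh.elim this.1 this.2

end Side

end DegenPieces

/-! ### Every degenerating graph is obtained by gluing. -/

namespace WellLabelled

open DegenPieces

variable {n p ℓ m : ℕ} {P : WallPartition n p} {κ : Fin ℓ → ℕ} {D : DegenIndex p ℓ m}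
  {Q : DegenPieces P κ D} {H : Type*} {X : WellLabelled n ℓ m H} {g : ℕ}
  {b : Fin n → ℝ} {γ : ℝ → Fin n → ℝ}

variable (X b γ) in
/-- `θ` identifies the half-edges of the pieces and of the joining edges with those of `X`. -/
structure Marking (θ : Q.Om ≃ H) : Prop where
  opp : ∀ x, θ (Q.gluing.opp x) = X.graph.opp (θ x)
  piece : ∀ i, X.graph.IsPiece (X.graph.degenerating b γ) {v | X.piece v = i} (Q.G i)
    fun z => θ (Sum.inl ⟨i, z⟩)
  face : ∀ i z, X.face (θ (Sum.inl ⟨i, z⟩)) = Q.faceOld i z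
  side : ∀ j : Fin m, X.piece (X.graph.vert (θ (Sum.inr (j, false)))) = j.succ ∧
    ∃ I J : Finset (Fin n), X.graph.IsBipartiteSide (θ (Sum.inr (j, false))) I J ∧
      0 < ∑ v ∈ I, γ 1 v - ∑ v ∈ J, γ 1 v

namespace DegeneratesTo

variable (hX : X.DegeneratesTo g b γ Q)
include hX

theorem exists_pieces : ∃ ι : ∀ i, Q.H i → H, ∀ i, X.graph.IsPiece (X.graph.degenerating b γ)
    {v | X.piece v = i} (Q.G i) (ι i) ∧ ∀ x, X.face (ι i x) = Q.faceOld i x := by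
  have : ∀ i, ∃ ι : Q.H i → H, X.graph.IsPiece (X.graph.degenerating b γ)
      {v | X.piece v = i} (Q.G i) ι ∧ ∀ x, X.face (ι x) = Q.faceOld i x := by
    intro i
    cases i using Fin.cases with
    | zero => exact hX.piece_zero
    | succ j => exact hX.piece_succ j
  choose ι hι using this
  exact ⟨ι, hι⟩

/-- A piece of `X` is connected, and the image of `Q.G i` is closed in it. So all its vertices carry
labels of `Q.G i`, and the labels alone determine the distribution. -/
theorem piece_eq : X.piece = labelPiece P D := by
  obtain ⟨ι, hι⟩ := hX.exists_pieces
  funext v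
  obtain ⟨i, hi⟩ : ∃ i, X.piece v = i := ⟨_, rfl⟩
  obtain ⟨x₀⟩ := (Q.G i).nonempty
  have hmem : ∀ x, X.piece (X.graph.vert (ι i x)) = i := by
    intro x
    have : ι i x ∈ Set.range (ι i) := ⟨x, rfl⟩
    rw [(hι i).1.range_eq] at this
    exact this.2
  have hr := (hX.piece_eq_iff (X.graph.vert (ι i x₀)) v).1 ((hmem x₀).trans hi.symm)
  obtain ⟨x, hx⟩ := RibbonGraph.mem_of_reach (T := {v | ∃ x, X.graph.vert (ι i x) = v}) (by
    rintro y hy ⟨x, hx⟩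
    have hy' : y ∈ Set.range (ι i) := by
      rw [(hι i).1.range_eq]
      refine ⟨hy, ?_⟩
      rw [← hx]
      exact hmem x
    obtain ⟨z, rfl⟩ := hy'
    exact ⟨(Q.G i).opp z, by rw [(hι i).1.opp_eq]⟩) hr ⟨x₀, rfl⟩
  rw [hi, ← hx, (hι i).1.vert_eq, Q.labelPiece_vert]

theorem card_eq [Finite H] : Nat.card H = ∑ i, κ i := by
  classical
  have := Fintype.ofFinite H
  rw [Nat.card_eq_fintype_card, ← Finset.card_univ,
    Finset.card_eq_sum_card_fiberwise (f := X.face) (t := Finset.univ) (fun _ _ => by simp)]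
  refine Finset.sum_congr rfl fun f _ => ?_
  rw [← hX.degree f, Nat.card_eq_fintype_card, Fintype.card_subtype]

theorem opp_mem_degenerating {x : H} (hx : x ∈ X.graph.degenerating b γ) :
    X.graph.opp x ∈ X.graph.degenerating b γ := by
  obtain ⟨f, ⟨k, hk, h⟩, hf⟩ := hx
  refine ⟨f, ⟨k, ?_, h⟩, hf⟩
  rw [X.graph.opp_opp]
  exact hk.symm

/-- Every degenerating ribbon graph is glued from the pieces. -/
theorem exists_marking [Finite H] (hκ : ∀ i, Odd (κ i)) : ∃ θ : Q.Om ≃ H, X.Marking b γ θ := by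
  classical
  obtain ⟨ι, hι⟩ := hX.exists_pieces
  have hv := fun i => (hι i).1.vert_eq
  have ho := fun i => (hι i).1.opp_eq
  have hrange : ∀ x, x ∉ X.graph.degenerating b γ ↔ ∃ i z, ι i z = x := by
    intro x
    constructor
    · intro hx
      have : x ∈ Set.range (ι (X.piece (X.graph.vert x))) := by
        rw [(hι _).1.range_eq]
        exact ⟨hx, rfl⟩
      exact ⟨_, this⟩
    · rintro ⟨i, z, rfl⟩
      have : ι i z ∈ Set.range (ι i) := ⟨z, rfl⟩
      rw [(hι i).1.range_eq] at this
      exact this.1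
  let Lower := {k : H // k ∈ X.graph.degenerating b γ ∧ ∃ I J : Finset (Fin n),
    X.graph.IsBipartiteSide k I J ∧ 0 < ∑ v ∈ I, γ 1 v - ∑ v ∈ J, γ 1 v}
  have hne : ∀ k : Lower, ∀ i x, ι i x ≠ k.1 := by
    rintro ⟨k, hk, -⟩ i x rfl
    exact (hrange _).2 ⟨i, x, rfl⟩ hk
  have hcore : ∃ x, labelPiece P D (X.graph.vert x) = 0 := by
    obtain ⟨x⟩ := (Q.G 0).nonempty
    exact ⟨ι 0 x, by rw [hv, Q.labelPiece_vert]⟩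
  have hside : ∀ k : Lower, ∃ S : Set (Fin n), AvoidsCore P D X.graph k.1 S ∧
      ∀ u v, labelPiece P D u = labelPiece P D v → u ∈ S → v ∈ S := by
    intro k
    obtain ⟨I, J, hIJ, -⟩ := k.2.2
    exact ⟨_, avoidsCore_of_side Q hv ho hIJ (hne k) hκ, fun u v huv hu =>
      (colorsPieces_of_side Q hv ho hIJ (hne k) hκ).mem_of_mem huv hu⟩
  have hq : ∀ k : Lower, ∃ j : Fin m, j.succ = labelPiece P D (X.graph.vert k.1) := by
    intro k
    obtain ⟨S, hS, -⟩ := hside k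
    exact Fin.exists_succ_eq_of_ne_zero fun h0 => hS.core _ h0 hS.base_mem
  choose q hq using hq
  -- Sides consist of whole pieces, so two edges starting at the same piece have their bases in each
  -- other's sides.
  have hqinj : Function.Injective q := by
    intro k k' hkk
    obtain ⟨S, hS, hS'⟩ := hside k
    obtain ⟨T, hT, hT'⟩ := hside k'
    have hl : labelPiece P D (X.graph.vert k.1) = labelPiece P D (X.graph.vert k'.1) := by
      rw [← hq, ← hq, hkk]
    exact Subtype.ext (hS.eq hT hcore (hT' _ _ hl.symm hT.base_mem) (hS' _ _ hl hS.base_mem))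
  have hlow : ∀ x ∈ X.graph.degenerating b γ, ∃ k : Lower, x = k.1 ∨ x = X.graph.opp k.1 := by
    intro x hx
    obtain ⟨f, ⟨k, hk, I, J, hIJ, rfl⟩, hf0, hf⟩ := id hx
    have hkD : k ∈ X.graph.degenerating b γ := by
      rcases hk with rfl | rfl
      · exact hx
      · exact hX.opp_mem_degenerating hx
    refine ⟨⟨k, hkD, I, J, hIJ, ?_⟩, ?_⟩
    · have h1 := hf 1 ⟨one_pos, le_rfl⟩
      refine (mul_pos_iff_of_pos_left ?_).1 h1
      split_ifs <;> norm_num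
    · rcases hk with rfl | rfl
      · exact Or.inl rfl
      · exact Or.inr (X.graph.opp_opp x).symm
  have hcard := hX.card_eq
  -- Injectivity gives at most `m` joining edges. There are at least `m`, because the number of
  -- half-edges is `∑ κ`, which is that of the pieces plus `2 m`.
  have hqsurj : Function.Bijective q := by
    refine hqinj.bijective_of_nat_card_le ?_
    have h1 := Nat.card_le_card_of_surjective
      (Sum.elim (fun z : Σ i, Q.H i => ι z.1 z.2)
        (fun z : Lower × Bool => if z.2 then X.graph.opp z.1.1 else z.1.1)) (by
      intro x
      by_cases hx : x ∈ X.graph.degenerating b γ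
      · obtain ⟨k, rfl | rfl⟩ := hlow x hx
        · exact ⟨Sum.inr (k, false), rfl⟩
        · exact ⟨Sum.inr (k, true), rfl⟩
      · obtain ⟨i, z, rfl⟩ := (hrange x).1 hx
        exact ⟨Sum.inl ⟨i, z⟩, rfl⟩)
    rw [hcard, ← Q.card_Om, Nat.card_sum, Nat.card_sum, Nat.card_prod, Nat.card_prod] at h1
    have h2 : Nat.card Bool = 2 := by simp
    rw [h2] at h1
    omega
  choose e he using hqsurj.2
  have hθ : Function.Bijective (Sum.elim (fun z : Σ i, Q.H i => ι z.1 z.2)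
        (fun z : Fin m × Bool => if z.2 then X.graph.opp (e z.1).1 else (e z.1).1)) := by
    refine Function.Surjective.bijective_of_nat_card_le ?_ (by rw [hcard, ← Q.card_Om])
    intro x
    by_cases hx : x ∈ X.graph.degenerating b γ
    · obtain ⟨k, hk⟩ := hlow x hx
      have hek : e (q k) = k := hqinj (he _)
      rcases hk with rfl | rfl
      · exact ⟨Sum.inr (q k, false), by simp [hek]⟩
      · exact ⟨Sum.inr (q k, true), by simp [hek]⟩
    · obtain ⟨i, z, rfl⟩ := (hrange x).1 hx
      exact ⟨Sum.inl ⟨i, z⟩, rfl⟩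
  refine ⟨Equiv.ofBijective _ hθ, ⟨?_, fun i => (hι i).1, fun i => (hι i).2, fun j => ⟨?_, ?_⟩⟩⟩
  · rintro (⟨i, z⟩ | ⟨j, c⟩)
    · exact ((hι i).1.opp_eq z).symm
    · cases c
      · rfl
      · exact (X.graph.opp_opp _).symm
  · rw [hX.piece_eq]
    change labelPiece P D (X.graph.vert (e j).1) = _
    rw [← hq, he]
  · exact (e j).2.2

end DegeneratesTo

end WellLabelled

/-! ### The rotation of a marked graph is valid. -/

/-- Isomorphisms of well-labelled ribbon graphs. -/
structure WellLabelled.IsIso {n ℓ m : ℕ} {H H' : Type*} (X : WellLabelled n ℓ m H)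
    (Y : WellLabelled n ℓ m H') (f : H ≃ H') : Prop where
  graph : X.graph.IsIso Y.graph f
  face : ∀ h, Y.face (f h) = X.face h
  piece : Y.piece = X.piece

namespace WellLabelled

open DegenPieces

variable {n p ℓ m : ℕ} {P : WallPartition n p} {κ : Fin ℓ → ℕ} {D : DegenIndex p ℓ m}
  {Q : DegenPieces P κ D} {H : Type*} {X : WellLabelled n ℓ m H} {g : ℕ}
  {b : Fin n → ℝ} {γ : ℝ → Fin n → ℝ}

variable (X) in
/-- The rotation transported to the half-edges of the gluing problem. -/
def rotation (θ : Q.Om ≃ H) : Equiv.Perm Q.Om := θ.trans (X.graph.next.trans θ.symm)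

theorem apply_rotation (θ : Q.Om ≃ H) (x : Q.Om) : θ (X.rotation θ x) = X.graph.next (θ x) := by
  simp [rotation]

theorem apply_rotation_pow (θ : Q.Om ≃ H) (k : ℕ) (x : Q.Om) :
    θ ((X.rotation θ ^ k) x) = (X.graph.next ^ k) (θ x) := by
  induction k with
  | zero => rfl
  | succ k ih => rw [pow_succ', pow_succ', mul_apply, mul_apply, apply_rotation, ih]

theorem rotation_sameCycle [Finite H] (θ : Q.Om ≃ H) {x y : Q.Om}
    (h : X.graph.vert (θ x) = X.graph.vert (θ y)) : (X.rotation θ).SameCycle x y := by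
  obtain ⟨k, -, hk⟩ := ((X.graph.vert_eq_iff _ _).1 h).exists_pow_eq'
  refine ⟨k, θ.injective ?_⟩
  rw [zpow_natCast, apply_rotation_pow, hk]

theorem vert_rotation (θ : Q.Om ≃ H) (x : Q.Om) :
    X.graph.vert (θ (X.rotation θ x)) = X.graph.vert (θ x) := by
  rw [apply_rotation, X.graph.vert_next]

namespace Marking

variable {θ : Q.Om ≃ H} (hθ : X.Marking b γ θ)
include hθ

theorem exists_side (hκ : ∀ i, Odd (κ i)) (j : Fin m) : ∃ I J : Finset (Fin n),
    X.graph.IsBipartiteSide (θ (Sum.inr (j, false))) I J ∧ ColorsPieces P D I J ∧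
    AvoidsCore P D X.graph (θ (Sum.inr (j, false))) {v | v ∈ I ∨ v ∈ J} ∧
    X.graph.vert (X.graph.opp (θ (Sum.inr (j, false)))) ∉ I ∧
    X.graph.vert (X.graph.opp (θ (Sum.inr (j, false)))) ∉ J ∧
    0 < ∑ v ∈ I, γ 1 v - ∑ v ∈ J, γ 1 v := by
  obtain ⟨-, I, J, hIJ, hpos⟩ := hθ.side j
  have hv := fun i => (hθ.piece i).vert_eq
  have ho := fun i => (hθ.piece i).opp_eq
  have hk : ∀ i x, (fun i x => θ (Sum.inl ⟨i, x⟩)) i x ≠ θ (Sum.inr (j, false)) := by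
    intro i x hh
    simpa using θ.injective hh
  have := side_opp_notMem Q hv ho hIJ hk hκ
  exact ⟨I, J, hIJ, colorsPieces_of_side Q hv ho hIJ hk hκ, avoidsCore_of_side Q hv ho hIJ hk hκ,
    this.1, this.2, hpos⟩

theorem vert_inl (z : Σ i, Q.H i) : X.graph.vert (θ (Sum.inl z)) = (Q.G z.1).vert z.2 :=
  (hθ.piece z.1).vert_eq z.2

/-- The side of a joining edge is its bipartite component, coloured by membership in the black set.
The sign condition comes from positivity of the weight at `t = 1`, through `ColorsPieces.pos_iff`.
-/
theorem glued [Finite H] (hX : X.DegeneratesTo g b γ Q) (hκ : ∀ i, Odd (κ i))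
    (hγ : ∀ t ∈ Set.Ioc (0 : ℝ) 1, ∀ s : Fin p,
      wallForm (P.I s false) (P.I s true) (γ t) = 2 ^ ((s : ℕ) + 1) * t) :
    Q.gluing.Glued Q.nextOld Q.pieceFun (X.rotation θ) := by
  classical
  have hrep : ∀ x, ∃ z : Q.H (labelPiece P D (X.graph.vert (θ x))),
      (X.rotation θ).SameCycle x (Sum.inl ⟨_, z⟩) := by
    intro x
    obtain ⟨z, hz⟩ := Q.exists_vert (X.graph.vert (θ x))
    refine ⟨z, rotation_sameCycle θ ?_⟩
    rw [hθ.vert_inl, hz]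
  refine ⟨⟨?_, ?_⟩, ?_, ?_, ?_⟩
  · rintro (z | x) hx
    · exact absurd (Q.inl_mem_old z) hx
    · rfl
  · intro x hx
    obtain ⟨i, z, rfl⟩ := Q.mem_placed.1 hx
    obtain ⟨k, hk, hk'⟩ := (hθ.piece i).next_eq z
    refine ⟨k, θ.injective ?_, fun j hj hmem => ?_⟩
    · rw [apply_rotation_pow, hk]; rfl
    · obtain ⟨i', z', hz'⟩ := Q.mem_placed.1 hmem
      have h1 := hk' j hj
      rw [← apply_rotation_pow, hz'] at h1
      have h2 : θ (Sum.inl ⟨i', z'⟩) ∈ Set.range fun z => θ (Sum.inl ⟨i', z⟩) := ⟨z', rfl⟩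
      rw [(hθ.piece i').range_eq] at h2
      exact h2.1 h1
  · intro j
    obtain ⟨z, hz⟩ := hrep (Sum.inr (j, false))
    refine ⟨_, Q.inl_mem_old _, ?_, hz⟩
    change toOpt (labelPiece P D (X.graph.vert (θ (Sum.inr (j, false))))) = some j
    rw [← hX.piece_eq, (hθ.side j).1, toOpt_succ]
  · intro j
    obtain ⟨z, hz⟩ := hrep (Sum.inr (j, true))
    exact ⟨_, Q.inl_mem_old _, hz⟩
  · intro j
    obtain ⟨I, J, hIJ, hcol, havoid, hoI, hoJ, hpos⟩ := hθ.exists_side hκ j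
    have hd : ∀ v, v ∈ I → v ∉ J := fun v h1 h2 => Finset.disjoint_left.1 hIJ.disjoint h1 h2
    have ho := hθ.opp (Sum.inr (j, false))
    have hopp : ∀ x, X.graph.vert (θ x) ∈ I ∨ X.graph.vert (θ x) ∈ J → θ x ≠
        X.graph.opp (θ (Sum.inr (j, false))) := by
      intro x hx hh
      rw [hh] at hx
      exact hx.elim hoI hoJ
    refine ⟨{x | X.graph.vert (θ x) ∈ I ∨ X.graph.vert (θ x) ∈ J},
      fun x => decide (X.graph.vert (θ x) ∈ I), ⟨Or.inl hIJ.base, ?_, ?_, ?_, ?_, ?_, ?_, ?_, ?_, ?_⟩⟩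
    · intro hh
      have hh : X.graph.vert (θ (Q.gluing.opp (Sum.inr (j, false)))) ∈ I ∨
        X.graph.vert (θ (Q.gluing.opp (Sum.inr (j, false)))) ∈ J := hh
      rw [ho] at hh
      exact hh.elim hoI hoJ
    · intro x hx
      rwa [Set.mem_ofPred_eq, vert_rotation]
    · intro x hx hxe
      rw [Set.mem_ofPred_eq, hθ.opp]
      exact havoid.opp_mem _ hx fun hh => hxe (θ.injective hh)
    · intro T' h1 h2 h3 x hx
      have hr := (hIJ.component _).1 hx
      refine RibbonGraph.mem_of_reach
        (T := {v | ∀ y, X.graph.vert (θ y) = v → y ∈ T'}) ?_ hr ?_ x rfl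
      · intro y hy hyT z hz
        obtain ⟨y, rfl⟩ := θ.surjective y
        rw [← hθ.opp] at hz
        refine Skips.mem_of_sameCycle h2 (rotation_sameCycle θ hz.symm) (h3 y (hyT y rfl) ?_ ?_)
        · rintro rfl
          exact hy (Or.inl rfl)
        · rintro rfl
          exact hy (Or.inr ho)
      · intro y hy
        exact Skips.mem_of_sameCycle h2 (rotation_sameCycle θ hy.symm) h1
    · intro x _
      simp only [vert_rotation]
    · intro x hx hxe
      have hne : θ x ≠ θ (Sum.inr (j, false)) := fun hh => hxe (θ.injective hh)
      simp only [hθ.opp]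
      by_cases hI : X.graph.vert (θ x) ∈ I
      · have := hIJ.black _ hne (hopp x hx) hI
        have h2 : X.graph.vert (X.graph.opp (θ x)) ∉ I := fun h => hd _ h this
        simp [hI, h2]
      · have := hIJ.white _ hne (hopp x hx) (hx.resolve_left hI)
        simp [hI, this]
    · exact decide_eq_true hIJ.base
    · rintro x ⟨z, rfl⟩ hx
      refine havoid.core _ ?_ hx
      rw [hθ.vert_inl, Q.labelPiece_vert]
    · intro s z hz hzT hmax
      obtain ⟨i, z, rfl, hzv⟩ := hz
      refine decide_eq_true ?_
      obtain ⟨v, hv⟩ := P.nonempty (maxIndex D j) false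
      have hvIJ : v ∈ I ∨ v ∈ J := by
        refine hcol.mem_of_mem ?_ (Or.inl hIJ.base)
        rw [← hX.piece_eq, (hθ.side j).1, hX.piece_eq, labelPiece_of_mem hv, A_maxIndex]
      refine (hcol.pos_iff one_pos (hγ 1 ⟨one_pos, le_rfl⟩) hIJ.disjoint ⟨_, v, hv, hvIJ⟩).1 hpos s _
        ?_ hzT ?_
      · rwa [hθ.vert_inl]
      · intro s' v' hv' hvIJ'
        obtain ⟨z', hz'⟩ := Q.exists_vert v'
        refine hmax s' (Sum.inl ⟨_, z'⟩) ⟨_, z', rfl, hz'.symm ▸ hv'⟩ ?_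
        rwa [Set.mem_ofPred_eq, hθ.vert_inl, hz']

/-- A marking prescribes the faces only on the pieces. On a joining edge they are forced: both
halves lie in the face that contains the piece at its lower end (`face_e`, `face_opp_e`). -/
theorem face_eq [Finite H] (hX : X.DegeneratesTo g b γ Q) (hκ : ∀ i, Odd (κ i))
    (hγ : ∀ t ∈ Set.Ioc (0 : ℝ) 1, ∀ s : Fin p,
      wallForm (P.I s false) (P.I s true) (γ t) = 2 ^ ((s : ℕ) + 1) * t) (x : Q.Om) :
    X.face (θ x) = Q.faceFun x ∧ X.face (θ (X.rotation θ x)) = X.face (θ (Q.gluing.opp x)) := by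
  have hσ := hθ.glued hX hκ hγ
  have hf : ∀ x, X.face (θ (X.rotation θ x)) = X.face (θ (Q.gluing.opp x)) := by
    intro x
    rw [apply_rotation, hθ.opp, eq_comm, hX.isFaceLabelling]
    refine ⟨1, ?_⟩
    simp [RibbonGraph.face, X.graph.opp_opp]
  refine ⟨?_, hf x⟩
  rcases x with ⟨i, z⟩ | ⟨j, c⟩
  · exact hθ.face i z
  · obtain ⟨z⟩ := (Q.G j.succ).nonempty
    have h1 := Gluing.Glued.face_e (j := j) Q.initialState hσ (f := fun x => X.face (θ x)) hf
      Q.face_closed (Q.inl_mem_old ⟨j.succ, z⟩) rfl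
    have h2 := Gluing.Glued.face_opp_e Q.initialState hσ (f := fun x => X.face (θ x)) hf
      Q.face_closed j
    have h3 := hθ.face j.succ z
    cases c
    · exact h1.trans h3
    · exact h2.trans (h1.trans h3)

theorem isValid [Finite H] (hX : X.DegeneratesTo g b γ Q) (hκ : ∀ i, Odd (κ i))
    (hγ : ∀ t ∈ Set.Ioc (0 : ℝ) 1, ∀ s : Fin p,
      wallForm (P.I s false) (P.I s true) (γ t) = 2 ^ ((s : ℕ) + 1) * t) :
    Q.IsValid (X.rotation θ) :=
  (hθ.glued hX hκ hγ).valid fun x => by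
    have h := fun x => (hθ.face_eq hX hκ hγ x).1
    have := (hθ.face_eq hX hκ hγ x).2
    rwa [h, h] at this

theorem isIso [Finite H] (hX : X.DegeneratesTo g b γ Q)
    (hσ : Q.gluing.Glued Q.nextOld Q.pieceFun (X.rotation θ)) (hκ : ∀ i, Odd (κ i))
    (hγ : ∀ t ∈ Set.Ioc (0 : ℝ) 1, ∀ s : Fin p,
      wallForm (P.I s false) (P.I s true) (γ t) = 2 ^ ((s : ℕ) + 1) * t) :
    (gluedLabelled hσ).IsIso X θ := by
  refine ⟨fun x => ⟨apply_rotation θ x, hθ.opp x, ?_⟩, fun x => (hθ.face_eq hX hκ hγ x).1,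
    hX.piece_eq⟩
  obtain ⟨z, hz⟩ := exists_rep hσ x
  have h1 : (gluedGraph hσ).vert x = (Q.G z.1).vert z.2 := gluedVert_of_sameCycle hσ hz
  have h2 := Skips.apply_eq_of_sameCycle (f := fun x => X.graph.vert (θ x))
    (fun x => vert_rotation θ x) hz
  rw [hθ.vert_inl] at h2
  exact h2.symm.trans h1.symm

end Marking

end WellLabelled

/-! ### Invariance under isomorphism and transport of half-edges. -/

theorem Equiv.Perm.SameCycle.map {α β : Type*} [Finite α] {σ : Equiv.Perm α} {τ : Equiv.Perm β}
    {f : α → β} (h : ∀ x, f (σ x) = τ (f x)) {x y : α} (hxy : σ.SameCycle x y) :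
    τ.SameCycle (f x) (f y) :=
  Skips.mem_of_sameCycle (T := {z | τ.SameCycle (f x) (f z)}) (fun z hz => by
    rw [Set.mem_ofPred_eq, h]
    exact sameCycle_apply_right.2 hz) hxy (SameCycle.refl _ _)

namespace RibbonGraph.IsIso

variable {V H H' : Type*} {G : RibbonGraph V H} {G' : RibbonGraph V H'} {f : H ≃ H'}

theorem symm (hf : G.IsIso G' f) : G'.IsIso G f.symm := by
  intro h
  obtain ⟨h1, h2, h3⟩ := hf (f.symm h)
  simp only [Equiv.apply_symm_apply] at h1 h2 h3
  exact ⟨by rw [Equiv.symm_apply_eq, h1], by rw [Equiv.symm_apply_eq, h2], h3.symm⟩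

theorem reach (hf : G.IsIso G' f) {D : Set H} {D' : Set H'} (hD : ∀ h, f h ∈ D' ↔ h ∈ D) {u v : V}
    (h : G.Reach D u v) : G'.Reach D' u v := by
  refine Relation.ReflTransGen.mono (fun u v => ?_) _ _ h
  rintro ⟨h, h1, h2, h3⟩
  exact ⟨f h, fun hh => h1 ((hD h).1 hh), (hf h).2.2.trans h2, by
    rw [← (hf h).2.1, (hf _).2.2, h3]⟩

theorem reach_iff (hf : G.IsIso G' f) {D : Set H} {D' : Set H'} (hD : ∀ h, f h ∈ D' ↔ h ∈ D)
    {u v : V} : G'.Reach D' u v ↔ G.Reach D u v :=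
  ⟨fun h => hf.symm.reach (fun x => by rw [← hD, Equiv.apply_symm_apply]) h, fun h => hf.reach hD h⟩

theorem isBipartiteSide (hf : G.IsIso G' f) {k : H} {I J : Finset V}
    (h : G.IsBipartiteSide k I J) : G'.IsBipartiteSide (f k) I J := by
  have ho : G'.opp (f k) = f (G.opp k) := ((hf k).2.1).symm
  refine ⟨fun v => ?_, h.disjoint, ?_, ?_, fun x hx hx' hxI => ?_, fun x hx hx' hxJ => ?_⟩
  · rw [h.component, (hf k).2.2, hf.reach_iff]
    intro x
    rw [ho]
    simp
  · rw [(hf k).2.2]; exact h.base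
  · rw [ho, (hf _).2.2]; exact h.other_end
  · obtain ⟨x, rfl⟩ := f.surjective x
    rw [← (hf x).2.1, (hf _).2.2]
    rw [(hf x).2.2] at hxI
    exact h.black x (fun hh => hx (congrArg f hh)) (fun hh => hx' (by rw [ho, hh])) hxI
  · obtain ⟨x, rfl⟩ := f.surjective x
    rw [← (hf x).2.1, (hf _).2.2]
    rw [(hf x).2.2] at hxJ
    exact h.white x (fun hh => hx (congrArg f hh)) (fun hh => hx' (by rw [ho, hh])) hxJ

theorem hasStaticWeight (hf : G.IsIso G' f) {h : H} {w : (V → ℝ) → ℝ}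
    (hw : G.HasStaticWeight h w) : G'.HasStaticWeight (f h) w := by
  obtain ⟨k, hk, I, J, hIJ, rfl⟩ := hw
  refine ⟨f k, ?_, I, J, hf.isBipartiteSide hIJ, ?_⟩
  · rw [← (hf h).2.1]
    exact hk.imp (congrArg f) (congrArg f)
  · rw [← (hf k).2.1, (hf _).2.2]

theorem mem_degenerating (hf : G.IsIso G' f) {b : V → ℝ} {γ : ℝ → V → ℝ} (h : H) :
    f h ∈ G'.degenerating b γ ↔ h ∈ G.degenerating b γ := by
  constructor
  · rintro ⟨w, h1, h2⟩
    have := hf.symm.hasStaticWeight h1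
    rw [Equiv.symm_apply_apply] at this
    exact ⟨w, this, h2⟩
  · rintro ⟨w, h1, h2⟩
    exact ⟨w, hf.hasStaticWeight h1, h2⟩

theorem apply_face (hf : G.IsIso G' f) (h : H) : f (G.face h) = G'.face (f h) := by
  rw [face, face, mul_apply, mul_apply, (hf _).1, (hf _).2.1]

theorem face_sameCycle [Finite H] (hf : G.IsIso G' f) {h k : H} :
    G'.face.SameCycle (f h) (f k) ↔ G.face.SameCycle h k := by
  have : Finite H' := Finite.of_equiv H f
  refine ⟨fun hh => ?_, fun hh => hh.map hf.apply_face⟩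
  have := hh.map hf.symm.apply_face
  rwa [Equiv.symm_apply_apply, Equiv.symm_apply_apply] at this

theorem range_vert (hf : G.IsIso G' f) : Set.range G'.vert = Set.range G.vert := by
  ext v
  constructor
  · rintro ⟨x, rfl⟩
    exact ⟨f.symm x, (hf.symm x).2.2⟩
  · rintro ⟨x, rfl⟩
    exact ⟨f x, (hf x).2.2⟩

theorem hasGenus [Finite H] (hf : G.IsIso G' f) {g : ℕ} (h : G.HasGenus g) : G'.HasGenus g := by
  unfold HasGenus at h ⊢
  rw [hf.range_vert, Nat.card_congr f.symm, ← h]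
  congr 2
  exact Nat.card_congr (Quotient.congr f fun a b => hf.face_sameCycle.symm).symm

theorem pow_next (hf : G.IsIso G' f) (k : ℕ) (h : H) : f ((G.next ^ k) h) = (G'.next ^ k) (f h) := by
  induction k with
  | zero => rfl
  | succ k ih => rw [pow_succ', pow_succ', mul_apply, mul_apply, (hf _).1, ih]

theorem isPiece {K : Type*} (hf : G.IsIso G' f) {D : Set H} {D' : Set H'}
    (hD : ∀ h, f h ∈ D' ↔ h ∈ D) {S : Set V} {Γ : RibbonGraph V K} {ι : K → H}
    (h : G.IsPiece D S Γ ι) : G'.IsPiece D' S Γ (fun x => f (ι x)) := by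
  refine ⟨f.injective.comp h.injective, ?_, fun x => ?_, fun x => ?_, fun x => ?_⟩
  · ext y
    obtain ⟨y, rfl⟩ := f.surjective y
    rw [Set.mem_ofPred_eq, hD, (hf y).2.2]
    have : f y ∈ Set.range (fun x => f (ι x)) ↔ y ∈ Set.range ι := by simp
    rw [this, h.range_eq, Set.mem_ofPred_eq]
  · rw [(hf _).2.2, h.vert_eq]
  · rw [← (hf _).2.1, h.opp_eq]
  · obtain ⟨k, h1, h2⟩ := h.next_eq x
    refine ⟨k, by rw [← hf.pow_next, h1], fun j hj => ?_⟩
    rw [← hf.pow_next, hD]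
    exact h2 j hj

end RibbonGraph.IsIso

theorem WellLabelled.IsIso.degeneratesTo {n p ℓ m : ℕ} {P : WallPartition n p} {κ : Fin ℓ → ℕ}
    {D : DegenIndex p ℓ m} {Q : DegenPieces P κ D} {H H' : Type*} [Finite H]
    {X : WellLabelled n ℓ m H} {Y : WellLabelled n ℓ m H'} {f : H ≃ H'} (hf : X.IsIso Y f)
    {g : ℕ} {b : Fin n → ℝ} {γ : ℝ → Fin n → ℝ} (hX : X.DegeneratesTo g b γ Q) :
    Y.DegeneratesTo g b γ Q := by
  have hD := hf.graph.mem_degenerating (b := b) (γ := γ)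
  refine ⟨hf.graph.hasGenus hX.genus, ?_, fun h k => ?_, fun i => ?_, ?_, fun u v => ?_, ?_, ?_,
    fun j => ?_⟩
  · rw [← Set.range_eq_univ, hf.graph.range_vert]
    exact hX.labels.range_eq
  · obtain ⟨h, rfl⟩ := f.surjective h
    obtain ⟨k, rfl⟩ := f.surjective k
    rw [hf.face, hf.face, hf.graph.face_sameCycle]
    exact hX.isFaceLabelling h k
  · rw [← hX.degree i]
    exact (Nat.card_congr (Equiv.subtypeEquiv f fun h => by rw [hf.face])).symm
  · obtain ⟨x, hx⟩ := hX.degenerates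
    exact ⟨f x, (hD x).2 hx⟩
  · rw [hf.piece, hX.piece_eq_iff, hf.graph.reach_iff hD]
  · rw [hf.piece]
    exact hX.piece_surjective
  · obtain ⟨ι, h1, h2⟩ := hX.piece_zero
    rw [hf.piece]
    exact ⟨_, hf.graph.isPiece hD h1, fun x => (hf.face _).trans (h2 x)⟩
  · obtain ⟨ι, h1, h2⟩ := hX.piece_succ j
    rw [hf.piece]
    exact ⟨_, hf.graph.isPiece hD h1, fun x => (hf.face _).trans (h2 x)⟩

namespace WellLabelled.IsIso

variable {n ℓ m : ℕ} {H H' H'' : Type*} {X : WellLabelled n ℓ m H} {Y : WellLabelled n ℓ m H'}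
  {Z : WellLabelled n ℓ m H''}

theorem symm {f : H ≃ H'} (hf : X.IsIso Y f) : Y.IsIso X f.symm :=
  ⟨hf.graph.symm, fun h => by rw [← hf.face, Equiv.apply_symm_apply], hf.piece.symm⟩

theorem trans {f : H ≃ H'} {k : H' ≃ H''} (hf : X.IsIso Y f) (hk : Y.IsIso Z k) :
    X.IsIso Z (f.trans k) :=
  ⟨fun h => ⟨by rw [Equiv.trans_apply, (hf.graph h).1, (hk.graph _).1]; rfl,
    by rw [Equiv.trans_apply, (hf.graph h).2.1, (hk.graph _).2.1]; rfl,
    by rw [Equiv.trans_apply, (hk.graph _).2.2, (hf.graph h).2.2]⟩,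
    fun h => by rw [Equiv.trans_apply, hk.face, hf.face], hk.piece.trans hf.piece⟩

end WellLabelled.IsIso

/-- Transport of a well-labelled ribbon graph along a bijection of the half-edges. -/
def WellLabelled.map {n ℓ m : ℕ} {H H' : Type*} (X : WellLabelled n ℓ m H) (f : H ≃ H')
    [Finite H] : WellLabelled n ℓ m H' where
  graph :=
    { next := f.symm.trans (X.graph.next.trans f)
      opp := f.symm.trans (X.graph.opp.trans f)
      opp_opp := fun h => by simp [X.graph.opp_opp]
      opp_ne := fun h hh => by
        exact X.graph.opp_ne (f.symm h) (by simpa using congrArg f.symm hh)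
      vert := fun h => X.graph.vert (f.symm h)
      vert_eq_iff := fun h k => by
        have : Finite H' := Finite.of_equiv H f
        rw [X.graph.vert_eq_iff]
        constructor
        · intro hh
          simpa using hh.map (f := f) (τ := f.symm.trans (X.graph.next.trans f)) (by simp)
        · intro hh
          exact hh.map (f := f.symm) (by simp)
      nonempty := X.graph.nonempty.map f
      connected := fun h k => by
        have := (X.graph.connected (f.symm h) (f.symm k)).lift f
          (p := fun x y => y = f.symm.trans (X.graph.next.trans f) x ∨
            y = f.symm.trans (X.graph.opp.trans f) x) (by
              rintro x y (rfl | rfl)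
              · exact Or.inl (by simp)
              · exact Or.inr (by simp))
        rwa [Function.onFun, f.apply_symm_apply, f.apply_symm_apply] at this }
  face := fun h => X.face (f.symm h)
  piece := X.piece

theorem WellLabelled.isIso_map {n ℓ m : ℕ} {H H' : Type*} (X : WellLabelled n ℓ m H) (f : H ≃ H')
    [Finite H] : X.IsIso (X.map f) f :=
  ⟨fun h => ⟨by simp [map], by simp [map], by simp [map]⟩, fun h => by simp [map], rfl⟩

/-! ### The free action of the symmetries of the pieces. -/

namespace DegenPieces

variable {n p ℓ m : ℕ} {P : WallPartition n p} {κ : Fin ℓ → ℕ} {D : DegenIndex p ℓ m}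

variable (Q : DegenPieces P κ D)

/-- The symmetries of the pieces. -/
abbrev Symmetries : Type := ∀ i, (Q.G i).autFaces

theorem autFaces_succ (j : Fin m) : (Q.G j.succ).autFaces = (Q.G j.succ).aut := by
  ext f
  exact ⟨fun h => h.1, fun h => ⟨h, fun x => Q.oneFace j _ _⟩⟩

theorem card_symmetries : Nat.card Q.Symmetries =
    Nat.card (Q.G 0).autFaces * ∏ j : Fin m, Nat.card (Q.G j.succ).aut := by
  rw [Nat.card_pi, Fin.prod_univ_succ]
  simp only [autFaces_succ]

theorem card_symmetries_pos : 0 < Nat.card Q.Symmetries := Nat.card_pos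

/-- The action of the symmetries on the half-edges. -/
def act (a : Q.Symmetries) : Equiv.Perm Q.Om :=
  Equiv.sumCongr (Equiv.sigmaCongrRight fun i => (a i : Equiv.Perm (Q.H i))) (Equiv.refl _)

theorem act_inl (a : Q.Symmetries) (i : Fin (m + 1)) (z : Q.H i) :
    Q.act a (Sum.inl ⟨i, z⟩) = Sum.inl ⟨i, (a i : Equiv.Perm (Q.H i)) z⟩ := rfl

theorem act_injective : Function.Injective Q.act := by
  intro a b h
  funext i
  refine Subtype.ext (Equiv.ext fun z => ?_)
  have := Equiv.congr_fun h (Sum.inl ⟨i, z⟩)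
  simpa [act_inl] using this

theorem act_opp (a : Q.Symmetries) (x : Q.Om) :
    Q.act a (Q.gluing.opp x) = Q.gluing.opp (Q.act a x) := by
  rcases x with ⟨i, z⟩ | x
  · change (Sum.inl ⟨i, (a i : Equiv.Perm (Q.H i)) ((Q.G i).opp z)⟩ : Q.Om) =
      Sum.inl ⟨i, (Q.G i).opp ((a i : Equiv.Perm (Q.H i)) z)⟩
    rw [((a i).2.1 z).2.1]
  · rfl

theorem faceOld_act (a : Q.Symmetries) (i : Fin (m + 1)) (z : Q.H i) :
    Q.faceOld i ((a i : Equiv.Perm (Q.H i)) z) = Q.faceOld i z := by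
  cases i using Fin.cases with
  | zero => exact (Q.isFaceLabelling₀ _ _).2 ((a 0).2.2 z)
  | succ j => rfl

end DegenPieces

theorem RibbonGraph.IsPiece.comp_aut {V H K : Type*} {G : RibbonGraph V H} {D : Set H} {S : Set V}
    {Γ : RibbonGraph V K} {ι : K → H} (h : G.IsPiece D S Γ ι) {f : Equiv.Perm K} (hf : f ∈ Γ.aut) :
    G.IsPiece D S Γ (fun x => ι (f x)) := by
  refine ⟨h.injective.comp f.injective, ?_, fun x => ?_, fun x => ?_, fun x => ?_⟩
  · rw [← h.range_eq]
    exact f.surjective.range_comp ι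
  · rw [h.vert_eq, (hf x).2.2]
  · rw [h.opp_eq, (hf x).2.1]
  · rw [(hf x).1]
    exact h.next_eq (f x)

namespace WellLabelled

open DegenPieces

variable {n p ℓ m : ℕ} {P : WallPartition n p} {κ : Fin ℓ → ℕ} {D : DegenIndex p ℓ m}
  {Q : DegenPieces P κ D} {H : Type*} {X : WellLabelled n ℓ m H} {g : ℕ}
  {b : Fin n → ℝ} {γ : ℝ → Fin n → ℝ} {θ : Q.Om ≃ H}

namespace Marking

variable (hθ : X.Marking b γ θ)
include hθ

theorem act (a : Q.Symmetries) : X.Marking b γ ((Q.act a).trans θ) := by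
  refine ⟨fun x => ?_, fun i => ?_, fun i z => ?_, hθ.side⟩
  · rw [Equiv.trans_apply, Q.act_opp, hθ.opp]; rfl
  · exact (hθ.piece i).comp_aut (a i).2.1
  · rw [Equiv.trans_apply, Q.act_inl, hθ.face, Q.faceOld_act]

/-- An isomorphism with a glued graph differs from a given one by symmetries of the pieces. -/
theorem exists_act [Finite H] (hX : X.DegeneratesTo g b γ Q) (hκ : ∀ i, Odd (κ i))
    (hγ : ∀ t ∈ Set.Ioc (0 : ℝ) 1, ∀ s : Fin p,
      wallForm (P.I s false) (P.I s true) (γ t) = 2 ^ ((s : ℕ) + 1) * t)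
    {σ : Equiv.Perm Q.Om} (hσ : Q.gluing.Glued Q.nextOld Q.pieceFun σ) {f : Q.Om ≃ H}
    (hf : (gluedLabelled hσ).IsIso X f) : ∃ a : Q.Symmetries, f = (Q.act a).trans θ := by
  classical
  have hcore : ∃ x, labelPiece P D (X.graph.vert x) = 0 := by
    obtain ⟨x⟩ := (Q.G 0).nonempty
    exact ⟨θ (Sum.inl ⟨0, x⟩), by rw [hθ.vert_inl, Q.labelPiece_vert]⟩
  have hfn : ∀ x, f (σ x) = X.graph.next (f x) := fun x => (hf.graph x).1
  have hfo : ∀ x, f (Q.gluing.opp x) = X.graph.opp (f x) := fun x => (hf.graph x).2.1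
  have hfv : ∀ x, X.graph.vert (f x) = (gluedGraph hσ).vert x := fun x => (hf.graph x).2.2
  -- Both images are lower ends of bridges that start at the piece `j` and whose sides avoid the
  -- core, so `AvoidsCore.eq` identifies them.
  have hnew₀ : ∀ j, f (Sum.inr (j, false)) = θ (Sum.inr (j, false)) := by
    intro j
    obtain ⟨I, J, hIJ, hcol, havoid, -⟩ := hθ.exists_side hκ j
    obtain ⟨T, χ, hT⟩ := hσ.side j
    obtain ⟨I', J', hIJ', -, -⟩ := exists_isBipartiteSide hσ j hT
    have h1 := hf.graph.isBipartiteSide hIJ'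
    have hv : ∀ i x, X.graph.vert ((fun i x => f (Sum.inl ⟨i, x⟩)) i x) = (Q.G i).vert x :=
      fun i x => (hfv _).trans (DegenPieces.vert_inl hσ i x)
    have ho : ∀ i x, X.graph.opp ((fun i x => f (Sum.inl ⟨i, x⟩)) i x) =
        (fun i x => f (Sum.inl ⟨i, x⟩)) i ((Q.G i).opp x) := fun i x => (hfo _).symm
    have hk : ∀ i x, (fun i x => f (Sum.inl ⟨i, x⟩)) i x ≠ f (Sum.inr (j, false)) :=
      fun i x hh => by simpa using f.injective hh
    have hcol' := colorsPieces_of_side Q hv ho h1 hk hκ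
    have hl : labelPiece P D (X.graph.vert (f (Sum.inr (j, false)))) =
        labelPiece P D (X.graph.vert (θ (Sum.inr (j, false)))) := by
      rw [← hX.piece_eq, (hθ.side j).1, hX.piece_eq, hfv]
      obtain ⟨x, hx, hxq, hxc⟩ := hσ.hit₀ j
      obtain ⟨z, rfl⟩ := Q.pieceFun_eq_some hx hxq
      have := gluedVert_of_sameCycle hσ hxc
      change (gluedGraph hσ).vert (Sum.inr (j, false)) = _ at this
      rw [this, Q.labelPiece_vert]
    exact (avoidsCore_of_side Q hv ho h1 hk hκ).eq havoid hcore
      (hcol.mem_of_mem hl.symm (Or.inl hIJ.base)) (hcol'.mem_of_mem hl (Or.inl h1.base))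
  have hnew : ∀ x, f (Sum.inr x) = θ (Sum.inr x) := by
    rintro ⟨j, c⟩
    cases c
    · exact hnew₀ j
    · have h1 := hfo (Sum.inr (j, false))
      have h2 := hθ.opp (Sum.inr (j, false))
      rw [hnew₀ j, ← h2] at h1
      exact h1
  have hold : ∀ i (z : Q.H i), ∃ z' : Q.H i, f (Sum.inl ⟨i, z⟩) = θ (Sum.inl ⟨i, z'⟩) := by
    intro i z
    obtain ⟨y, hy⟩ := θ.surjective (f (Sum.inl ⟨i, z⟩))
    rcases y with ⟨i', z'⟩ | y
    · have h1 := hθ.vert_inl ⟨i', z'⟩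
      rw [hy, hfv, DegenPieces.vert_inl] at h1
      have : i = i' := by rw [← Q.labelPiece_vert z, ← Q.labelPiece_vert z']; exact congrArg _ h1
      subst this
      exact ⟨z', hy.symm⟩
    · rw [← hnew] at hy
      simpa using f.injective hy
  choose a ha using hold
  have hainj : ∀ i, Function.Injective (a i) := by
    intro i z w hzw
    have : f (Sum.inl ⟨i, z⟩) = f (Sum.inl ⟨i, w⟩) := by rw [ha, ha, hzw]
    simpa using f.injective this
  let A : ∀ i, Equiv.Perm (Q.H i) := fun i => Equiv.ofBijective (a i)
    (Finite.injective_iff_bijective.1 (hainj i))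
  have hopp : ∀ i z, a i ((Q.G i).opp z) = (Q.G i).opp (a i z) := by
    intro i z
    have h1 := hfo (Sum.inl ⟨i, z⟩)
    rw [ha, ← hθ.opp] at h1
    have h2 : f (Sum.inl ⟨i, (Q.G i).opp z⟩) = θ (Sum.inl ⟨i, (Q.G i).opp (a i z)⟩) := h1
    rw [ha] at h2
    simpa using θ.injective h2
  have hvert : ∀ i z, (Q.G i).vert (a i z) = (Q.G i).vert z := by
    intro i z
    have h1 := hθ.vert_inl ⟨i, a i z⟩
    rw [← ha, hfv, DegenPieces.vert_inl] at h1
    exact h1.symm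
  have hnext : ∀ i z, a i ((Q.G i).next z) = (Q.G i).next (a i z) := by
    have hs := (hθ.glued hX hκ hγ).skip
    have hpow : ∀ k x, θ.symm (f ((σ ^ k) x)) = (X.rotation θ ^ k) (θ.symm (f x)) := by
      intro k x
      induction k with
      | zero => rfl
      | succ k ih =>
        rw [pow_succ', pow_succ', mul_apply, mul_apply, ← ih, Equiv.symm_apply_eq, apply_rotation,
          hfn, Equiv.apply_symm_apply]
    -- The conjugate of `nextOld` by `A` is induced by the same rotation as `nextOld` itself.
    -- Uniqueness of induced permutations then makes `A` commute with the rotations of the pieces.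
    have h1 : Skips (X.rotation θ) Q.gluing.old
        ((Equiv.sumCongr (Equiv.sigmaCongrRight A) (Equiv.refl _)).symm.trans
          (Q.nextOld.trans (Equiv.sumCongr (Equiv.sigmaCongrRight A) (Equiv.refl _)))) := by
      constructor
      · rintro (z | x) hx
        · exact absurd (Q.inl_mem_old z) hx
        · rfl
      · intro x hx
        obtain ⟨i, z, rfl⟩ := Q.mem_placed.1 hx
        obtain ⟨z, rfl⟩ := (A i).surjective z
        obtain ⟨k, hk, hk'⟩ := hσ.skip.ret _ (Q.inl_mem_old ⟨i, z⟩)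
        have e : (Sum.inl ⟨i, A i z⟩ : Q.Om) = θ.symm (f (Sum.inl ⟨i, z⟩)) := by
          rw [ha, Equiv.symm_apply_apply]; rfl
        refine ⟨k, ?_, fun j hj hmem => ?_⟩
        · have e2 : (Sum.inl ⟨i, A i z⟩ : Q.Om) =
              Equiv.sumCongr (Equiv.sigmaCongrRight A) (Equiv.refl _) (Sum.inl ⟨i, z⟩) := rfl
          rw [Equiv.trans_apply, e2, Equiv.symm_apply_apply, ← e2, e, ← hpow, hk,
            Equiv.symm_apply_eq, nextOld_inl, ha]
          rfl
        · rw [e, ← hpow] at hmem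
          refine hk' j hj ?_
          rcases hy : (σ ^ (j + 1)) (Sum.inl ⟨i, z⟩) with y | y
          · exact Q.inl_mem_old y
          · rw [hy, hnew, Equiv.symm_apply_apply] at hmem
            exact hmem
    have h2 := h1.unique hs
    intro i z
    have h3 := Equiv.congr_fun h2 (Sum.inl ⟨i, A i z⟩)
    have e2 : (Sum.inl ⟨i, A i z⟩ : Q.Om) =
      Equiv.sumCongr (Equiv.sigmaCongrRight A) (Equiv.refl _) (Sum.inl ⟨i, z⟩) := rfl
    rw [Equiv.trans_apply, e2, Equiv.symm_apply_apply, ← e2] at h3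
    have h4 : (Sum.inl ⟨i, a i ((Q.G i).next z)⟩ : Q.Om) = Sum.inl ⟨i, (Q.G i).next (a i z)⟩ := h3
    simpa using h4
  refine ⟨fun i => ⟨A i, fun z => ⟨hnext i z, hopp i z, hvert i z⟩, ?_⟩, ?_⟩
  · cases i using Fin.cases with
    | zero =>
      intro z
      rw [← Q.isFaceLabelling₀]
      have h1 := hθ.face 0 (a 0 z)
      rw [← ha, hf.face] at h1
      exact h1.symm
    | succ j => exact fun z => Q.oneFace j _ _
  · ext x
    rcases x with ⟨i, z⟩ | x
    · exact ha i z
    · exact hnew x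

/-- If two symmetries give the same rotation, the set where they agree is closed. It contains the
joining half-edges, which all symmetries fix and which exist because `m ≥ 1`, so by connectedness it
is everything. -/
theorem rotation_act_injective [Finite H] (hX : X.DegeneratesTo g b γ Q) (hκ : ∀ i, Odd (κ i))
    (hγ : ∀ t ∈ Set.Ioc (0 : ℝ) 1, ∀ s : Fin p,
      wallForm (P.I s false) (P.I s true) (γ t) = 2 ^ ((s : ℕ) + 1) * t) (hm : 1 ≤ m) :
    Function.Injective fun a : Q.Symmetries => X.rotation ((Q.act a).trans θ) := by
  intro a c hac
  have hσ := (hθ.act a).glued hX hκ hγ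
  refine Q.act_injective (Equiv.ext fun x => θ.injective ?_)
  refine Gluing.Glued.closed_eq_univ Q.initialState hσ
    (T := {x | (Q.act a).trans θ x = (Q.act c).trans θ x}) ?_ ?_ ⟨Sum.inr (⟨0, hm⟩, false), rfl⟩ x
  · intro x hx
    have h1 := apply_rotation (X := X) ((Q.act a).trans θ) x
    have h2 := apply_rotation (X := X) ((Q.act c).trans θ) x
    have hac : X.rotation ((Q.act a).trans θ) = X.rotation ((Q.act c).trans θ) := hac
    rw [Set.mem_ofPred_eq] at hx
    rw [← hac, ← hx, ← h1] at h2
    exact h2.symm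
  · intro x hx
    rw [Set.mem_ofPred_eq] at hx
    rw [Set.mem_ofPred_eq, (hθ.act a).opp, (hθ.act c).opp, hx]

end Marking

end WellLabelled

/-! ### Valid rotations modulo symmetries. -/

namespace DegenPieces

variable {n p ℓ m : ℕ} {P : WallPartition n p} {κ : Fin ℓ → ℕ} {D : DegenIndex p ℓ m}

/-- The glued rotations are counted by the isomorphism classes and the symmetries. -/
theorem card_isValid_eq (Q : DegenPieces P κ D) (hκ : ∀ i, Odd (κ i)) (hm : 1 ≤ m)
    {b : Fin n → ℝ} (hb : b ∈ P.wall) {γ : ℝ → Fin n → ℝ}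
    (hγ : ∀ t ∈ Set.Ioc (0 : ℝ) 1, ∀ s : Fin p,
      wallForm (P.I s false) (P.I s true) (γ t) = 2 ^ ((s : ℕ) + 1) * t)
    (hQ : ∀ i h f, (Q.G i).HasStaticWeight h f → f b ≠ 0) :
    Nat.card {σ // Q.IsValid σ} = degenCount (∑ i, D.g i) b γ Q * Nat.card Q.Symmetries := by
  classical
  have e₀ : Nonempty (Q.Om ≃ Fin (∑ i, κ i)) :=
    ⟨Finite.equivFinOfCardEq Q.card_Om⟩
  obtain ⟨e₀⟩ := e₀
  let C := {q : Quotient (WellLabelled.isoSetoid n ℓ m (Fin (∑ i, κ i))) //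
    ∃ X : WellLabelled n ℓ m (Fin (∑ i, κ i)), Quotient.mk _ X = q ∧
      X.DegeneratesTo (∑ i, D.g i) b γ Q}
  let Y : {σ // Q.IsValid σ} → WellLabelled n ℓ m (Fin (∑ i, κ i)) := fun σ =>
    (gluedLabelled σ.2.glued).map e₀
  have hY : ∀ σ, (gluedLabelled σ.2.glued).IsIso (Y σ) e₀ := fun σ =>
    (gluedLabelled σ.2.glued).isIso_map e₀
  let Φ : {σ // Q.IsValid σ} → C := fun σ => ⟨Quotient.mk _ (Y σ), Y σ, rfl,
    (hY σ).degeneratesTo (gluedLabelled_degeneratesTo σ.2.glued hκ hm hb hγ hQ σ.2.lab)⟩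
  -- Each fibre is a torsor under the symmetries: after the choice of a marking `θ` of a
  -- representative, a symmetry gives the rotation transported through it and `θ`. Injectivity is
  -- freeness of the action, surjectivity is `Marking.exists_act`.
  have key : ∀ c : C, Nonempty ({σ // Φ σ = c} ≃ Q.Symmetries) := by
    rintro ⟨c, X, rfl, hX⟩
    obtain ⟨θ, hθ⟩ := hX.exists_marking hκ
    have hΦ : ∀ σ, Φ σ = ⟨Quotient.mk _ X, X, rfl, hX⟩ ↔
        ∃ f, (gluedLabelled σ.2.glued).IsIso X f := by
      intro σ
      rw [Subtype.mk.injEq, Quotient.eq]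
      constructor
      · rintro ⟨f, h1, h2, h3⟩
        exact ⟨_, (hY σ).trans ⟨h1, h2, h3⟩⟩
      · rintro ⟨f, hf⟩
        have := (hY σ).symm.trans hf
        exact ⟨_, this.graph, this.face, this.piece⟩
    refine ⟨(Equiv.ofBijective (fun a : Q.Symmetries =>
      (⟨⟨X.rotation ((Q.act a).trans θ), (hθ.act a).isValid hX hκ hγ⟩, (hΦ _).2
        ⟨_, (hθ.act a).isIso hX _ hκ hγ⟩⟩ : {σ // Φ σ = _})) ⟨?_, ?_⟩).symm⟩
    · intro a c hac
      exact hθ.rotation_act_injective hX hκ hγ hm (congrArg (fun z => z.1.1) hac)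
    · rintro ⟨⟨σ, hσ⟩, h⟩
      obtain ⟨f, hf⟩ := (hΦ _).1 h
      obtain ⟨a, rfl⟩ := hθ.exists_act hX hκ hγ hσ.glued hf
      refine ⟨a, Subtype.ext (Subtype.ext (Equiv.ext fun x => ?_))⟩
      refine ((Q.act a).trans θ).injective ?_
      rw [WellLabelled.apply_rotation]
      exact (hf.graph x).1.symm
  rw [degenCount, ← Nat.card_prod]
  exact Nat.card_congr ((Equiv.sigmaFiberEquiv Φ).symm.trans
    ((Equiv.sigmaCongrRight fun c => (key c).some).trans (Equiv.sigmaEquivProd _ _)))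

end DegenPieces

theorem proposition4p4 {n p ℓ m : ℕ} (g : ℕ) (κ : Fin ℓ → ℕ) (hκ : ∀ i, Odd (κ i))
    (P : WallPartition n p) (hp : 1 ≤ p) (hI₀ : P.I₀.Nonempty ∨ 3 ≤ ℓ)
    (b : Fin n → ℝ) (hb : P.IsGeneric b)
    (C₀ : Set (Fin n → ℝ)) (hC₀ : IsTopCell C₀) (hadj : wallCell b ⊆ closure C₀)
    (γ : ℝ → Fin n → ℝ) (hγC₀ : ∀ t ∈ Set.Ioc (0 : ℝ) 1, γ t ∈ C₀)
    (hγlim : Filter.Tendsto γ (nhdsWithin 0 (Set.Ioi 0)) (nhds b))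
    (hγ : ∀ t ∈ Set.Ioc (0 : ℝ) 1, ∀ s : Fin p,
      wallForm (P.I s false) (P.I s true) (γ t) = 2 ^ ((s : ℕ) + 1) * t)
    (hm : 1 ≤ m) (D : DegenIndex p ℓ m) (hg : ∑ i, D.g i = g) (Q : DegenPieces P κ D)
    (hQ : ∀ i h f, (Q.G i).HasStaticWeight h f → f b ≠ 0) :
    (degenCount g b γ Q : ℚ) =
      D.coeff P κ / ((Nat.card (Q.G 0).autFaces : ℚ) *
        ∏ j : Fin m, (Nat.card (Q.G j.succ).aut : ℚ)) := by
  subst hg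
  have h1 := Q.card_isValid_eq hκ hm hb.1 hγ hQ
  have h2 := Q.card_isValid hκ
  have h3 := Q.card_symmetries
  have hpos : (Nat.card Q.Symmetries : ℚ) ≠ 0 := by
    exact_mod_cast Q.card_symmetries_pos.ne'
  have h4 : (Nat.card (Q.G 0).autFaces : ℚ) * ∏ j : Fin m, (Nat.card (Q.G j.succ).aut : ℚ) =
      (Nat.card Q.Symmetries : ℚ) := by
    rw [h3]
    push_cast
    rfl
  rw [h4, eq_div_iff hpos, ← h2, h1]
  push_cast
  rfl
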